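/- **Setting.** Write $\mathbb T=\mathbb R/2\pi\mathbb Z$. Consider variables $x=(x_1,\dots,x_n)$ and $z$ (each real, or an angle in $\mathbb T$) and the nonholonomic system with Lagrangian $$L=\tfrac12|\dot x|^2+\tfrac12\dot z^2-U(x)-V(z),\qquad U(x)=\tfrac12|Bx|^2-f^{\top}x,$$ and constraint $A(z)\dot x=0$, where $B$ is an $m\times n$ matrix of rank $m$, $f\in\mathbb R^n$, and $\ker A(z)$ is spanned by a unit vector $\kappa(z)$. With $\dot x=v\,\kappa(z)$ its equations of motion are given by the vector field $X$ in the variables $(x,v,z,\dot z)$: $$\dot x=v\,\kappa(z),\qquad \dot v=\kappa(z)^{\top}(-B^{\top}Bx+f),\qquad \ddot z=-V'(z).$$ Let $\pi(x,v,z,\dot z)=(Bx,v,z,\dot z)$, a map onto the cylinder $\mathcal N$ of the variables $(y,v,z,\dot z)$, $y\in\mathbb R^m$. Consider the following systems. 1. *Harmonic CVT*: $x\in\mathbb R^2$, $z\in\mathbb R$, $A=(1,\ z)$, $\kappa=(1+z^2)^{-1/2}(-z,1)$, $B=\mathrm{Id}_2$, $f=0$, $V=z^2/2$. 2. *Pendulum-driven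 CVT* (unperturbed): $x\in\mathbb R^2$, $z\in\mathbb T$, $A=(1,\ \sin z)$, $\kappa=(1+\sin^2 z)^{-1/2}(-\sin z,1)$, $B=\mathrm{Id}_2$, $f=0$, $V=\cos z$. 3. *Nonholonomic particle*: as 1, but with $B=(0\ \ 1)$. 4. *Knife edge*: $x\in\mathbb R^2$, $z\in\mathbb T$, $A=(-\sin z,\ \cos z)$, $\kappa=(\cos z,\sin z)$, $B$ the empty $0\times2$ matrix, $f=(1,0)$, $V=0$. 5. *Vertical rolling disk*: $x\in\mathbb R^2\times\mathbb T$, $z\in\mathbb T$, $A=\begin{pmatrix}1&0&\cos z\\0&1&\sin z\end{pmatrix}$, $\kappa=\tfrac1{\sqrt2}(-\cos z,-\sin z,1)$, $B$ the empty $0\times 3$ matrix, $f=0$, $V=0$. 6. *Mobile robot*: as 5, but with $V=\sin z$. **Definition.** Let $Y$ be a vector field on a manifold $\mathcal N$ and $R$ a smooth involution of $\mathcal N$. Then $Y$ is *$R$-integrable* with $p$ actions and $k$ angles if there is a family of pairwise disjoint open sets $W\subset\mathcal N$ with $R(W)\subset W$, whose union is dense in $\mathcal N$, such that for each of them there are a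 nonempty connected open set $D\subset\mathbb R^p$, a map $\omega\colon D\to\mathbb R^k$ and a diffeomorphism $\varphi=(I,\theta)\colon W\to D\times(\mathbb R/\mathbb Z)^k$ with * (i) $\varphi\circ R=(I,-\theta)$ on $W$; * (ii) in the variables $(I,\theta)$ the vector field $Y$ reads $\dot I=0$, $\dot\theta=\omega(I)$; * (iii) the image $\omega(D)$ does not lie in a proper linear subspace of $\mathbb R^k$. **Theorem.** Each of the systems 1–6 is fibrated over a reversible integrable system: $\pi$ is surjective, there is a vector field $Y$ on $\mathcal N$ with $\pi_*X=Y$, and there is a smooth involution $R$ of $\mathcal N$ such that $Y$ is $R$-integrable. The numbers $(p,k)$ of actions and angles are $(3,2)$ for systems 1 and 2, $(2,2)$ for system 3, and $(2,1)$ for systems 4, 5 and 6. -/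

import Mathlib

open Matrix Topology
open scoped ContDiff

/-! ### Calculus on cylinders

A cylinder is a quotient `E ⧸ Λ` of a normed space by a lattice (for instance a vector space or a
product of lines and circles).  Its tangent spaces are all identified with `E` through the
covering `E → E ⧸ Λ`, so that a vector field is a function `E ⧸ Λ → E`. Smoothness and derivatives
of maps are those of their local lifts to the coverings. -/

section Cylinder

variable {E E' C C' : Type*} [NormedAddCommGroup E] [NormedSpace ℝ E]
  [NormedAddCommGroup E'] [NormedSpace ℝ E']

/-- `F : E → E'` is, near the point `x`, a smooth lift of the map `g : C → C'` through the
coverings `c : E → C` and `c' : E' → C'`. -/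
def IsSmoothLiftAt (c : E → C) (c' : E' → C') (g : C → C') (F : E → E') (x : E) : Prop :=
  ContDiffAt ℝ ∞ F x ∧ ∀ᶠ y in 𝓝 x, c' (F y) = g (c y)

/-- The covering `ℝᵖ × ℝᵏ → ℝᵖ × (ℝ/ℤ)ᵏ`. -/
def torusCover (p k : ℕ) (a : (Fin p → ℝ) × (Fin k → ℝ)) :
    (Fin p → ℝ) × (Fin k → UnitAddCircle) :=
  (a.1, fun j => (a.2 j : UnitAddCircle))

variable {Λ : AddSubgroup E} {Λ' : AddSubgroup E'}

/-- The map `g` of cylinders is smooth. -/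
def IsSmoothMap (g : E ⧸ Λ → E' ⧸ Λ') : Prop :=
  ∀ x : E, ∃ F : E → E', IsSmoothLiftAt (fun y : E => (y : E ⧸ Λ)) (fun y : E' => (y : E' ⧸ Λ'))
    g F x

/-- The smooth map `g` pushes the vector field `X` forward to the vector field `Y`,
that is, `g_* X = Y`. -/
def PushesForward (g : E ⧸ Λ → E' ⧸ Λ') (X : E ⧸ Λ → E) (Y : E' ⧸ Λ' → E') : Prop :=
  ∀ x : E, ∃ F : E → E',
    IsSmoothLiftAt (fun y : E => (y : E ⧸ Λ)) (fun y : E' => (y : E' ⧸ Λ')) g F x ∧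
    fderiv ℝ F x (X x) = Y (g x)

/-- On the open set `W`, the vector field `Y` is `R`-integrable with `p` actions and `k` angles:
there is a diffeomorphism `φ = (I, θ)` from `W` onto `D × (ℝ/ℤ)ᵏ`, with `D` a connected open subset
of `ℝᵖ`, such that `φ ∘ R = (I, -θ)`, such that the induced vector field is `I' = 0`,
`θ' = freq(I)`, and such that the image of `freq` does not lie in a proper linear subspace of `ℝᵏ`. -/
def IsRIntegrableOn (Y : E ⧸ Λ → E) (R : E ⧸ Λ → E ⧸ Λ) (p k : ℕ) (W : Set (E ⧸ Λ)) : Prop :=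
  IsOpen W ∧ Set.MapsTo R W W ∧
  ∃ (D : Set (Fin p → ℝ)) (φ : E ⧸ Λ → (Fin p → ℝ) × (Fin k → UnitAddCircle))
    (freq : (Fin p → ℝ) → (Fin k → ℝ)),
    IsOpen D ∧ IsConnected D ∧
    Set.BijOn φ W (D ×ˢ Set.univ) ∧
    (∀ q ∈ W, φ (R q) = ((φ q).1, -(φ q).2)) ∧
    (∀ x : E, (x : E ⧸ Λ) ∈ W → ∃ F : E → (Fin p → ℝ) × (Fin k → ℝ),
      IsSmoothLiftAt (fun y : E => (y : E ⧸ Λ)) (torusCover p k) φ F x ∧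
      Function.Bijective (fderiv ℝ F x) ∧
      fderiv ℝ F x (Y x) = (0, freq (φ x).1)) ∧
    ∀ L : Submodule ℝ (Fin k → ℝ), freq '' D ⊆ L → L = ⊤

/-- The vector field `Y` is `R`-integrable with `p` actions and `k` angles: an open dense subset
of the phase space is a disjoint union of open sets on each of which action-angle variables
as in `IsRIntegrableOn` exist. -/
def IsRIntegrable (Y : E ⧸ Λ → E) (R : E ⧸ Λ → E ⧸ Λ) (p k : ℕ) : Prop :=
  ∃ 𝒲 : Set (Set (E ⧸ Λ)),
    (∀ W ∈ 𝒲, IsRIntegrableOn Y R p k W) ∧ 𝒲.PairwiseDisjoint id ∧ Dense (⋃₀ 𝒲)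

/-- The vector field `X` descends through the surjection `π` to a vector field `Y` which, for some
smooth involution `R`, is `R`-integrable with `p` actions and `k` angles. -/
def IsFibratedOverRIntegrable (π : E ⧸ Λ → E' ⧸ Λ') (X : E ⧸ Λ → E) (p k : ℕ) : Prop :=
  Function.Surjective π ∧ ∃ Y : E' ⧸ Λ' → E', PushesForward π X Y ∧
    ∃ R : E' ⧸ Λ' → E' ⧸ Λ', Function.Involutive R ∧ IsSmoothMap R ∧ IsRIntegrable Y R p k

end Cylinder

/-! ### Nonholonomically coupled systems with quadratic potential -/

/-- The group of periods of a coordinate: `2πℤ` for an angle and `0` for a real variable. -/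
noncomputable def periods : Bool → AddSubgroup ℝ
  | true => AddSubgroup.zmultiples (2 * Real.pi)
  | false => ⊥

theorem apply_add_periods {α : Type*} {g : ℝ → α} {b : Bool}
    (hg : b = true → Function.Periodic g (2 * Real.pi)) {t : ℝ} (ht : t ∈ periods b) (z : ℝ) :
    g (z + t) = g z := by
  cases b with
  | true =>
    obtain ⟨k, rfl⟩ := AddSubgroup.mem_zmultiples_iff.1 ht
    exact (hg rfl).zsmul k z
  | false =>
    have : t = 0 := ht
    simp [this]

/-- The nonholonomic system on the variables `(x, z)` with Lagrangian
`½ |x'|² + ½ z'² - U(x) - V(z)`, where `U(x) = ½ |B x|² - f ⬝ x`, and constraint `A(z) x' = 0`,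
where the kernel of `A(z)` is the line spanned by the unit vector `κ(z)`.  The coordinate `x i`
(respectively `z`) is an angle when `xAngle i` (respectively `zAngle`) is `true`. -/
structure CoupledSystem (n c m : ℕ) where
  A : ℝ → Matrix (Fin c) (Fin n) ℝ
  κ : ℝ → Fin n → ℝ
  B : Matrix (Fin m) (Fin n) ℝ
  f : Fin n → ℝ
  V : ℝ → ℝ
  xAngle : Fin n → Bool
  zAngle : Bool
  kernel : ∀ z w, A z *ᵥ w = 0 ↔ ∃ s : ℝ, w = s • κ z
  unit : ∀ z, κ z ⬝ᵥ κ z = 1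
  fullRank : Function.Surjective fun x => B *ᵥ x
  B_angle : ∀ i, xAngle i = true → ∀ j, B j i = 0
  f_angle : ∀ i, xAngle i = true → f i = 0
  A_periodic : zAngle = true → Function.Periodic A (2 * Real.pi)
  κ_periodic : zAngle = true → Function.Periodic κ (2 * Real.pi)
  V_periodic : zAngle = true → Function.Periodic V (2 * Real.pi)

namespace CoupledSystem

variable {n c m : ℕ} (S : CoupledSystem n c m)

/-- The periods of the variables `(x, v, z, z')`. -/
noncomputable def upPeriods : AddSubgroup ((Fin n → ℝ) × ℝ × ℝ × ℝ) :=
  (AddSubgroup.pi Set.univ fun i => periods (S.xAngle i)).prod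
    ((⊥ : AddSubgroup ℝ).prod ((periods S.zAngle).prod ⊥))

/-- The periods of the variables `(y, v, z, z')`. -/
noncomputable def downPeriods : AddSubgroup ((Fin m → ℝ) × ℝ × ℝ × ℝ) :=
  (⊥ : AddSubgroup (Fin m → ℝ)).prod ((⊥ : AddSubgroup ℝ).prod ((periods S.zAngle).prod ⊥))

/-- The phase space of the variables `(x, v, z, z')`, where `x' = v κ(z)`. -/
abbrev Up : Type := ((Fin n → ℝ) × ℝ × ℝ × ℝ) ⧸ S.upPeriods

/-- The phase space of the variables `(y, v, z, z')`, where `y = B x`. -/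
abbrev Down : Type := ((Fin m → ℝ) × ℝ × ℝ × ℝ) ⧸ S.downPeriods

/-- The force `F(x) = -∇U(x) = -Bᵀ B x + f`. -/
def force (x : Fin n → ℝ) : Fin n → ℝ := -(S.Bᵀ *ᵥ (S.B *ᵥ x)) + S.f

/-- The equations of motion `x' = v κ(z)`, `v' = κ(z) ⬝ F(x)`, `z'' = -V'(z)`, as a first order
system in the variables `(x, v, z, z')`. -/
noncomputable def fieldLift (q : (Fin n → ℝ) × ℝ × ℝ × ℝ) : (Fin n → ℝ) × ℝ × ℝ × ℝ :=
  (q.2.1 • S.κ q.2.2.1, S.κ q.2.2.1 ⬝ᵥ S.force q.1, q.2.2.2, -deriv S.V q.2.2.1)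

/-- The linear projection `(x, v, z, z') ↦ (B x, v, z, z')`. -/
noncomputable def projLift : (Fin n → ℝ) × ℝ × ℝ × ℝ →+ (Fin m → ℝ) × ℝ × ℝ × ℝ :=
  (S.B.mulVecLin.prodMap (LinearMap.id : ℝ × ℝ × ℝ →ₗ[ℝ] ℝ × ℝ × ℝ)).toAddMonoidHom

theorem mulVec_of_mem {t : Fin n → ℝ}
    (ht : t ∈ AddSubgroup.pi Set.univ fun i => periods (S.xAngle i)) : S.B *ᵥ t = 0 := by
  ext j
  simp only [Matrix.mulVec, dotProduct, Pi.zero_apply]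
  refine Finset.sum_eq_zero fun i _ => ?_
  cases h : S.xAngle i with
  | true => rw [S.B_angle i h j, zero_mul]
  | false =>
    have h0 := ht i (Set.mem_univ i)
    simp only [h] at h0
    have h1 : t i = 0 := h0
    rw [h1, mul_zero]

theorem fieldLift_add (q : (Fin n → ℝ) × ℝ × ℝ × ℝ) {t : (Fin n → ℝ) × ℝ × ℝ × ℝ}
    (ht : t ∈ S.upPeriods) : S.fieldLift (q + t) = S.fieldLift q := by
  obtain ⟨hx, hv, hz, hw⟩ := ht
  have hv' : t.2.1 = 0 := hv
  have hw' : t.2.2.2 = 0 := hw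
  have hV : S.zAngle = true → Function.Periodic (deriv S.V) (2 * Real.pi) := fun h z => by
    rw [← deriv_comp_add_const, (S.V_periodic h).funext]
  simp only [fieldLift, force, Prod.fst_add, Prod.snd_add, hv', hw', add_zero,
    Matrix.mulVec_add, S.mulVec_of_mem hx, apply_add_periods S.κ_periodic hz,
    apply_add_periods hV hz]

theorem upPeriods_le : S.upPeriods ≤ S.downPeriods.comap S.projLift := by
  rintro t ⟨hx, ht⟩
  exact ⟨S.mulVec_of_mem hx, ht⟩

/-- The vector field `fieldLift` on the phase space. -/
noncomputable def field (q : S.Up) : (Fin n → ℝ) × ℝ × ℝ × ℝ :=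
  Quotient.liftOn' q S.fieldLift fun a b h => by
    have := S.fieldLift_add a (QuotientAddGroup.leftRel_apply.1 h)
    simpa using this.symm

/-- The projection `(x, v, z, z') ↦ (B x, v, z, z')` on the phase space. -/
noncomputable def proj : S.Up → S.Down :=
  QuotientAddGroup.map S.upPeriods S.downPeriods S.projLift S.upPeriods_le

end CoupledSystem

/-! ### The examples -/

theorem sqrt_inv_sq (s : ℝ) : (√(1 + s ^ 2))⁻¹ * (√(1 + s ^ 2))⁻¹ * (1 + s ^ 2) = 1 := by
  have h : 0 < 1 + s ^ 2 := by positivity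
  rw [← mul_inv, Real.mul_self_sqrt h.le, inv_mul_cancel₀ h.ne']

theorem cvt_kernel (s : ℝ) (w : Fin 2 → ℝ) :
    !![1, s] *ᵥ w = 0 ↔ ∃ a : ℝ, w = a • ((√(1 + s ^ 2))⁻¹ • ![-s, 1]) := by
  have h : √(1 + s ^ 2) ≠ 0 := (Real.sqrt_pos.2 (by positivity)).ne'
  constructor
  · intro hw
    have h0 := congrFun hw 0
    simp [Matrix.mulVec, dotProduct, Fin.sum_univ_two] at h0
    refine ⟨w 1 * √(1 + s ^ 2), ?_⟩
    ext i
    fin_cases i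
    · simp; field_simp; linarith
    · simp; field_simp
  · rintro ⟨a, rfl⟩
    ext i
    fin_cases i
    simp [Matrix.mulVec, dotProduct, Fin.sum_univ_two]
    ring

theorem cvt_unit (s : ℝ) :
    ((√(1 + s ^ 2))⁻¹ • ![-s, 1]) ⬝ᵥ ((√(1 + s ^ 2))⁻¹ • ![-s, 1]) = 1 := by
  have := sqrt_inv_sq s
  simp [dotProduct, Fin.sum_univ_two]
  linear_combination this

/-- The continuously variable transmission driven by a harmonic oscillator. -/
noncomputable def harmonicCVT : CoupledSystem 2 1 2 where
  A z := !![1, z]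
  κ z := (√(1 + z ^ 2))⁻¹ • ![-z, 1]
  B := !![1, 0; 0, 1]
  f := 0
  V z := z ^ 2 / 2
  xAngle _ := false
  zAngle := false
  kernel := cvt_kernel
  unit := cvt_unit
  fullRank y := ⟨y, by ext i; fin_cases i <;> simp [Matrix.mulVec, dotProduct, Fin.sum_univ_two]⟩
  B_angle _ h := by simp at h
  f_angle _ h := by simp at h
  A_periodic h := by simp at h
  κ_periodic h := by simp at h
  V_periodic h := by simp at h

/-- The continuously variable transmission driven by a pendulum, with perturbation
parameter `ε`. -/
noncomputable def pendulumCVT (ε : ℝ) : CoupledSystem 2 1 2 where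
  A z := !![1, Real.sin z]
  κ z := (√(1 + Real.sin z ^ 2))⁻¹ • ![-Real.sin z, 1]
  B := !![1, 0; 0, 1]
  f := 0
  V z := Real.cos z - ε * Real.sin (2 * z) / 2
  xAngle _ := false
  zAngle := true
  kernel z := cvt_kernel (Real.sin z)
  unit z := cvt_unit (Real.sin z)
  fullRank y := ⟨y, by ext i; fin_cases i <;> simp [Matrix.mulVec, dotProduct, Fin.sum_univ_two]⟩
  B_angle _ h := by simp at h
  f_angle _ h := by simp at h
  A_periodic _ z := by simp
  κ_periodic _ z := by simp
  V_periodic _ z := by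
    have h : 2 * (z + 2 * Real.pi) = 2 * z + 2 * Real.pi + 2 * Real.pi := by ring
    simp [h]

/-- The nonholonomic particle. -/
noncomputable def nonholonomicParticle : CoupledSystem 2 1 1 where
  A z := !![1, z]
  κ z := (√(1 + z ^ 2))⁻¹ • ![-z, 1]
  B := !![0, 1]
  f := 0
  V z := z ^ 2 / 2
  xAngle _ := false
  zAngle := false
  kernel := cvt_kernel
  unit := cvt_unit
  fullRank y := ⟨![0, y 0], by
    ext i; fin_cases i; simp [Matrix.mulVec, dotProduct, Fin.sum_univ_two]⟩
  B_angle _ h := by simp at h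
  f_angle _ h := by simp at h
  A_periodic h := by simp at h
  κ_periodic h := by simp at h
  V_periodic h := by simp at h

/-- The knife edge: a skate sliding on an inclined plane. -/
noncomputable def knifeEdge : CoupledSystem 2 1 0 where
  A z := !![-Real.sin z, Real.cos z]
  κ z := ![Real.cos z, Real.sin z]
  B := 0
  f := ![1, 0]
  V _ := 0
  xAngle _ := false
  zAngle := true
  kernel z w := by
    have hz := Real.sin_sq_add_cos_sq z
    constructor
    · intro hw
      have h0 := congrFun hw 0
      simp [Matrix.mulVec, dotProduct, Fin.sum_univ_two] at h0
      refine ⟨w 0 * Real.cos z + w 1 * Real.sin z, ?_⟩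
      ext i
      fin_cases i
      · simp; linear_combination -(w 0) * hz - Real.sin z * h0
      · simp; linear_combination -(w 1) * hz + Real.cos z * h0
    · rintro ⟨a, rfl⟩
      ext i
      fin_cases i
      simp [Matrix.mulVec, dotProduct, Fin.sum_univ_two]
      ring
  unit z := by
    have hz := Real.sin_sq_add_cos_sq z
    simp [dotProduct, Fin.sum_univ_two]
    linear_combination hz
  fullRank y := ⟨0, Subsingleton.elim _ _⟩
  B_angle _ h := by simp at h
  f_angle _ h := by simp at h
  A_periodic _ z := by simp
  κ_periodic _ z := by simp
  V_periodic _ z := rfl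

/-- A vertical disk rolling without slipping on a plane, whose direction `z` moves in the
`2π`-periodic potential `V`. -/
noncomputable def diskWithPotential (V : ℝ → ℝ) (hV : Function.Periodic V (2 * Real.pi)) :
    CoupledSystem 3 2 0 where
  A z := !![1, 0, Real.cos z; 0, 1, Real.sin z]
  κ z := (√2)⁻¹ • ![-Real.cos z, -Real.sin z, 1]
  B := 0
  f := 0
  V := V
  xAngle := ![false, false, true]
  zAngle := true
  kernel z w := by
    have h2 : √(2 : ℝ) ≠ 0 := by positivity
    constructor
    · intro hw
      have h0 := congrFun hw 0
      have h1 := congrFun hw 1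
      simp [Matrix.mulVec, dotProduct, Fin.sum_univ_three] at h0 h1
      refine ⟨w 2 * √2, ?_⟩
      ext i
      fin_cases i
      · simp; field_simp; linarith
      · simp; field_simp; linarith
      · simp
    · rintro ⟨a, rfl⟩
      ext i
      fin_cases i <;> simp [Matrix.mulVec, dotProduct, Fin.sum_univ_three] <;> ring
  unit z := by
    have hz := Real.sin_sq_add_cos_sq z
    have h2 : (√(2 : ℝ))⁻¹ * (√(2 : ℝ))⁻¹ = 1 / 2 := by
      rw [← mul_inv, Real.mul_self_sqrt (by norm_num)]; norm_num
    simp [dotProduct, Fin.sum_univ_three]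
    linear_combination (Real.cos z ^ 2 + Real.sin z ^ 2 + 1) * h2 + hz / 2
  fullRank y := ⟨0, Subsingleton.elim _ _⟩
  B_angle _ _ j := j.elim0
  f_angle _ _ := rfl
  A_periodic _ z := by simp
  κ_periodic _ z := by simp
  V_periodic _ := hV

/-- The vertical rolling disk. -/
noncomputable def rollingDisk : CoupledSystem 3 2 0 :=
  diskWithPotential (fun _ => 0) fun _ => rfl

/-- The mobile robot. -/
noncomputable def mobileRobot : CoupledSystem 3 2 0 :=
  diskWithPotential Real.sin Real.sin_periodic

/-! The force enters only through κ·f and Bκ·Bx, so the system descends to a field in (y, v, z, z')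
with y = Bx. This field is a skew product. The pair (z, z') moves as an oscillator with one degree
of freedom, and over it y' = v Bκ(z), v' = κ(z)·f − Bκ(z)·y: a linear equation with a skew matrix,
plus the term κ·f. The involution is (y, v, z, z') ↦ (σy, v, e − z, z'), where z ↦ e − z is a
symmetry of V.

The states of the oscillator are covered, up to a small set, by families t ↦ ζ a t of symmetric
periodic orbits (`OscillatorChart`). The parameter a is an action, and the time along the orbit as a
fraction of the period T is an angle. If y is absent, v differs from a constant by a periodic
function of t, and this constant is the second action.

Otherwise f = 0 and the fiber (y, v) rotates. For the particle this is an explicit rotation of a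
plane. For the transmissions the return map along an orbit is M in SO(3). Reversibility gives Mᵀ = R
M R with R = `secondReflection`, so that, when M₁₁² < 1 (indices from 0), the axis of M lies in the
plane of the first and third coordinates and the angle of rotation is α = arccos M₁₁
(`rotation_frame`). The component along the axis and the distance from it are actions. The angle ψ
around the axis, corrected by α times the phase, is the second angle (`FiberChart`). The frequencies
are 1/T and α/(2πT), so condition (iii) says that α is not constant.

Nonconstancy is a matter of analyticity. The equation of the fiber extends analytically to a = 0,
which stands for infinitesimal oscillations or for infinite speed. There M₁₁ = 1, and a first order
computation shows that M₁₁ is not identically 1 (`exists_monodromy_ne_one`). By the identity theorem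
M₁₁ is then nonconstant on every open set of parameters, and M₁₁² < 1 on a dense one. Analytic
dependence on a is obtained by treating functions on a rescaled time interval as elements of the
Banach algebra C([0,1]), where inverses, exponentials, square roots and solutions of Volterra
equations are analytic. -/

/-! ### Action-angle variables from a pair of charts -/

section Charts

variable {M E : Type*} [NormedAddCommGroup M] [NormedSpace ℝ M] [FiniteDimensional ℝ M]
  [NormedAddCommGroup E] [NormedSpace ℝ E] [FiniteDimensional ℝ E]

/-- The inverse function theorem, in the form used below. -/
theorem ContDiffAt.exists_local_inverse {P : M → E} {x : M} (hP : ContDiffAt ℝ ∞ P x)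
    (hi : Function.Injective (fderiv ℝ P x))
    (hd : Module.finrank ℝ M = Module.finrank ℝ E) :
    Function.Bijective (fderiv ℝ P x) ∧ Filter.map P (𝓝 x) = 𝓝 (P x) ∧
      ∃ G : E → M, ContDiffAt ℝ ∞ G (P x) ∧ G (P x) = x ∧ (∀ᶠ y in 𝓝 (P x), P (G y) = y) ∧
        ∀ v, fderiv ℝ G (P x) (fderiv ℝ P x v) = v := by
  have : CompleteSpace M := FiniteDimensional.complete ℝ M
  have : CompleteSpace E := FiniteDimensional.complete ℝ E
  let e : M ≃L[ℝ] E :=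
    (LinearEquiv.ofInjectiveOfFinrankEq (fderiv ℝ P x : M →ₗ[ℝ] E) hi hd).toContinuousLinearEquiv
  have he : (e : M →L[ℝ] E) = fderiv ℝ P x := by ext v; rfl
  have hd' : HasFDerivAt P (e : M →L[ℝ] E) x := by
    rw [he]; exact (hP.differentiableAt (by simp)).hasFDerivAt
  have hs : HasStrictFDerivAt P (e : M →L[ℝ] E) x := hP.hasStrictFDerivAt' hd' (by simp)
  refine ⟨by rw [← he]; exact e.bijective, hs.map_nhds_eq_of_equiv, hP.localInverse hd' (by simp),
    hP.to_localInverse hd' (by simp), hP.localInverse_apply_image hd' (by simp),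
    hs.eventually_right_inverse, fun v => ?_⟩
  have h1 : HasFDerivAt (hP.localInverse hd' (by simp)) (e.symm : E →L[ℝ] M) (P x) :=
    hs.to_localInverse.hasFDerivAt
  rw [h1.fderiv, ← he]
  simp

variable {Λ : AddSubgroup E}

/-- A pair of charts `P : U → E` and `Q : U → ℝᵖ × ℝᵏ` which induce the same identifications
in `E ⧸ Λ` and in `ℝᵖ × (ℝ/ℤ)ᵏ` defines action-angle variables on the image of `P`. -/
theorem isRIntegrableOn_of_charts {Y : E ⧸ Λ → E} {R : E ⧸ Λ → E ⧸ Λ} {p k : ℕ}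
    {U : Set M} {P : M → E} {Q : M → (Fin p → ℝ) × (Fin k → ℝ)} {D : Set (Fin p → ℝ)}
    (freq : (Fin p → ℝ) → (Fin k → ℝ)) (hU : IsOpen U)
    (hME : Module.finrank ℝ M = Module.finrank ℝ E) (hMp : Module.finrank ℝ M = p + k)
    (hP : ∀ x ∈ U, ContDiffAt ℝ ∞ P x) (hPi : ∀ x ∈ U, Function.Injective (fderiv ℝ P x))
    (hQ : ∀ x ∈ U, ContDiffAt ℝ ∞ Q x) (hQi : ∀ x ∈ U, Function.Injective (fderiv ℝ Q x))
    (hiff : ∀ x ∈ U, ∀ x' ∈ U,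
      ((P x : E ⧸ Λ) = P x' ↔ torusCover p k (Q x) = torusCover p k (Q x')))
    (hD : IsOpen D) (hDc : IsConnected D) (hUD : ∀ x ∈ U, (Q x).1 ∈ D)
    (hDU : ∀ I ∈ D, ∀ θ, ∃ x ∈ U, Q x = (I, θ))
    (hR : ∀ x ∈ U, ∃ x' ∈ U, R (P x : E ⧸ Λ) = P x' ∧ Q x' = ((Q x).1, -(Q x).2))
    (hY : ∀ x ∈ U, ∃ v, fderiv ℝ P x v = Y (P x : E ⧸ Λ) ∧ fderiv ℝ Q x v = (0, freq (Q x).1))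
    (hf : ∀ L : Submodule ℝ (Fin k → ℝ), freq '' D ⊆ L → L = ⊤) :
    IsRIntegrableOn Y R p k ((fun x => (P x : E ⧸ Λ)) '' U) := by
  classical
  have hMG : Module.finrank ℝ M = Module.finrank ℝ ((Fin p → ℝ) × (Fin k → ℝ)) := by
    simp [hMp]
  have hne : Nonempty M := ⟨0⟩
  have hopen : IsOpen ((fun x => (P x : E ⧸ Λ)) '' U) := by
    rw [isOpen_iff_mem_nhds]
    rintro _ ⟨x, hx, rfl⟩
    have h1 := ((hP x hx).exists_local_inverse (hPi x hx) hME).2.1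
    have h2 : P '' U ∈ 𝓝 (P x) := h1 ▸ Filter.image_mem_map (hU.mem_nhds hx)
    have h3 := (QuotientAddGroup.isOpenMap_coe (N := Λ)).image_mem_nhds h2
    rwa [Set.image_image] at h3
  -- φ is Q after an arbitrary choice of preimages under P; by `hiff` the choice does not matter.
  let inv : E ⧸ Λ → M := Function.invFunOn (fun x => (P x : E ⧸ Λ)) U
  let φ : E ⧸ Λ → (Fin p → ℝ) × (Fin k → UnitAddCircle) := fun q => torusCover p k (Q (inv q))
  have hφ : ∀ x ∈ U, φ (P x : E ⧸ Λ) = torusCover p k (Q x) := by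
    intro x hx
    have hm : ∃ a ∈ U, (fun x => (P x : E ⧸ Λ)) a = (P x : E ⧸ Λ) := ⟨x, hx, rfl⟩
    exact (hiff _ (Function.invFunOn_mem hm) x hx).1 (Function.invFunOn_eq hm)
  refine ⟨hopen, ?_, D, φ, freq, hD, hDc, ⟨?_, ?_, ?_⟩, ?_, ?_, hf⟩
  · rintro _ ⟨x, hx, rfl⟩
    obtain ⟨x', hx', h1, -⟩ := hR x hx
    exact ⟨x', hx', h1.symm⟩
  · rintro _ ⟨x, hx, rfl⟩
    refine ⟨?_, Set.mem_univ _⟩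
    simp only [hφ x hx]
    exact hUD x hx
  · rintro _ ⟨x, hx, rfl⟩ _ ⟨x', hx', rfl⟩ h
    simp only [hφ x hx, hφ x' hx'] at h
    exact (hiff x hx x' hx').2 h
  · rintro ⟨I, θ⟩ ⟨hI, -⟩
    choose t ht using fun j => QuotientAddGroup.mk_surjective (θ j)
    obtain ⟨x, hx, hQx⟩ := hDU I hI t
    refine ⟨_, ⟨x, hx, rfl⟩, ?_⟩
    simp only [hφ x hx, hQx, torusCover]
    exact Prod.ext rfl (funext ht)
  · rintro _ ⟨x, hx, rfl⟩
    obtain ⟨x', hx', h1, h2⟩ := hR x hx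
    simp only [h1, hφ x' hx', hφ x hx, h2, torusCover]
    refine Prod.ext rfl (funext fun j => ?_)
    simp
  · rintro y ⟨x, hx, hxy⟩
    have hxy' : (P x : E ⧸ Λ) = y := hxy
    obtain ⟨-, -, G, hG, hGx, hGr, hGd⟩ := (hP x hx).exists_local_inverse (hPi x hx) hME
    have hQb := ((hQ x hx).exists_local_inverse (hQi x hx) hMG).1
    have hPb := ((hP x hx).exists_local_inverse (hPi x hx) hME).1
    -- The lift y of the class of P x need not be P x. The period l moves it there, where the local
    -- inverse G of P is available, and e ↦ Q (G (e - l)) lifts φ near y.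
    set l : E := -P x + y with hl
    have hlΛ : l ∈ Λ := QuotientAddGroup.eq.1 hxy'
    have hyl : y - l = P x := by simp [hl]
    have hsub : ContDiffAt ℝ ∞ (fun e : E => e - l) y := contDiffAt_id.sub contDiffAt_const
    have hGs : ContDiffAt ℝ ∞ (fun e : E => G (e - l)) y :=
      ContDiffAt.comp y (g := G) (by rw [hyl]; exact hG) hsub
    have hGy : G (y - l) = x := by rw [hyl, hGx]
    have hcomp : ContDiffAt ℝ ∞ (fun e : E => Q (G (e - l))) y :=
      ContDiffAt.comp y (g := Q) (by rw [hGy]; exact hQ x hx) hGs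
    have hder : ∀ v, fderiv ℝ (fun e : E => Q (G (e - l))) y (fderiv ℝ P x v) =
        fderiv ℝ Q x v := by
      intro v
      have h1 : HasFDerivAt (fun e : E => G (e - l)) (fderiv ℝ G (P x)) y := by
        have := (hyl ▸ (hG.differentiableAt (by simp)).hasFDerivAt :
          HasFDerivAt G (fderiv ℝ G (P x)) (y - l)).comp y ((hasFDerivAt_id y).sub_const l)
        simpa [Function.comp_def] using this
      have h2 : HasFDerivAt Q (fderiv ℝ Q x) (G (y - l)) := by
        rw [hGy]; exact ((hQ x hx).differentiableAt (by simp)).hasFDerivAt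
      have h3 : HasFDerivAt (fun e : E => Q (G (e - l)))
        ((fderiv ℝ Q x).comp (fderiv ℝ G (P x))) y := h2.comp y h1
      rw [h3.fderiv]
      simp [hGd]
    refine ⟨fun e => Q (G (e - l)), ⟨hcomp, ?_⟩, ?_, ?_⟩
    · have ht : Filter.Tendsto (fun e : E => e - l) (𝓝 y) (𝓝 (P x)) := hyl ▸ hsub.continuousAt
      have hUe : ∀ᶠ e in 𝓝 y, G (e - l) ∈ U :=
        hGs.continuousAt.eventually_mem (by rw [hGy]; exact hU.mem_nhds hx)
      filter_upwards [ht.eventually hGr, hUe] with e h1 h2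
      have h3 : (e : E ⧸ Λ) = (P (G (e - l)) : E ⧸ Λ) := by
        rw [h1]
        refine QuotientAddGroup.eq.2 ?_
        rw [show -e + (e - l) = -l by abel]
        exact Λ.neg_mem hlΛ
      rw [h3, hφ _ h2]
    · have hbij : Function.Bijective
          (fderiv ℝ (fun e : E => Q (G (e - l))) y ∘ fderiv ℝ P x) := by
        convert hQb using 1
        exact funext hder
      exact (Function.Bijective.of_comp_iff _ hPb).1 hbij
    · obtain ⟨v, hv1, hv2⟩ := hY x hx
      rw [← hxy', ← hv1, hder, hv2, hφ x hx]
      rfl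

end Charts

/-! ### The reduced systems and their reflections -/

namespace CoupledSystem

variable {n c m : ℕ} (S : CoupledSystem n c m)

theorem mem_downPeriods {t : (Fin m → ℝ) × ℝ × ℝ × ℝ} :
    t ∈ S.downPeriods ↔ t.1 = 0 ∧ t.2.1 = 0 ∧ t.2.2.1 ∈ periods S.zAngle ∧ t.2.2.2 = 0 :=
  Iff.rfl

/-- The reduced equations of motion in the variables `(y, v, z, z')`. -/
noncomputable def reducedLift (q : (Fin m → ℝ) × ℝ × ℝ × ℝ) : (Fin m → ℝ) × ℝ × ℝ × ℝ :=
  (q.2.1 • (S.B *ᵥ S.κ q.2.2.1), S.κ q.2.2.1 ⬝ᵥ S.f - (S.B *ᵥ S.κ q.2.2.1) ⬝ᵥ q.1, q.2.2.2,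
    -deriv S.V q.2.2.1)

theorem reducedLift_add (q : (Fin m → ℝ) × ℝ × ℝ × ℝ) {t : (Fin m → ℝ) × ℝ × ℝ × ℝ}
    (ht : t ∈ S.downPeriods) : S.reducedLift (q + t) = S.reducedLift q := by
  obtain ⟨hy, hv, hz, hw⟩ := S.mem_downPeriods.1 ht
  have hV : S.zAngle = true → Function.Periodic (deriv S.V) (2 * Real.pi) := fun h z => by
    rw [← deriv_comp_add_const, (S.V_periodic h).funext]
  simp only [reducedLift, Prod.fst_add, Prod.snd_add, hy, hv, hw, add_zero,
    apply_add_periods S.κ_periodic hz, apply_add_periods hV hz]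

/-- The vector field `reducedLift` on the reduced phase space. -/
noncomputable def reducedField (q : S.Down) : (Fin m → ℝ) × ℝ × ℝ × ℝ :=
  Quotient.liftOn' q S.reducedLift fun a b h => by
    have := S.reducedLift_add a (QuotientAddGroup.leftRel_apply.1 h)
    simpa using this.symm

@[simp]
theorem reducedField_coe (q : (Fin m → ℝ) × ℝ × ℝ × ℝ) :
    S.reducedField (q : S.Down) = S.reducedLift q := rfl

theorem proj_surjective : Function.Surjective S.proj := by
  intro q
  obtain ⟨⟨y, r⟩, rfl⟩ := QuotientAddGroup.mk_surjective q
  obtain ⟨x, hx⟩ := S.fullRank y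
  refine ⟨((x, r) : (Fin n → ℝ) × ℝ × ℝ × ℝ), ?_⟩
  change ((S.projLift (x, r) : (Fin m → ℝ) × ℝ × ℝ × ℝ) : S.Down) = _
  congr 1
  exact Prod.ext hx rfl

theorem pushesForward_reducedField : PushesForward S.proj S.field S.reducedField := by
  intro q
  let F : (Fin n → ℝ) × ℝ × ℝ × ℝ →L[ℝ] (Fin m → ℝ) × ℝ × ℝ × ℝ :=
    LinearMap.toContinuousLinearMap
      (S.B.mulVecLin.prodMap (LinearMap.id : ℝ × ℝ × ℝ →ₗ[ℝ] ℝ × ℝ × ℝ))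
  refine ⟨F, ⟨F.contDiff.contDiffAt, Filter.Eventually.of_forall fun y => rfl⟩, ?_⟩
  rw [F.fderiv]
  change F (S.fieldLift q) = S.reducedLift (S.projLift q)
  have hF : ∀ a, F a = (S.B *ᵥ a.1, a.2) := fun a => rfl
  have hp : S.projLift q = (S.B *ᵥ q.1, q.2) := rfl
  rw [hF, hp]
  refine Prod.ext ?_ (Prod.ext ?_ rfl)
  · simp [fieldLift, reducedLift, Matrix.mulVec_smul]
  · simp only [fieldLift, reducedLift, force, dotProduct_add, dotProduct_neg]
    -- κ ⬝ Bᵀ(Bx) = Bκ ⬝ Bx: the force is felt only through Bx and κ ⬝ f.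
    rw [dotProduct_mulVec, vecMul_transpose]
    ring

/-- The map `(y, v, z, z') ↦ (σ y, v, c - z, z')`, where `σ` multiplies the coordinates of `y`. -/
noncomputable def reflectionLift (σ : Fin m → ℝ) (e : ℝ) (q : (Fin m → ℝ) × ℝ × ℝ × ℝ) :
    (Fin m → ℝ) × ℝ × ℝ × ℝ :=
  (σ * q.1, q.2.1, e - q.2.2.1, q.2.2.2)

/-- The map `reflectionLift` on the reduced phase space. -/
noncomputable def reflection (σ : Fin m → ℝ) (e : ℝ) : S.Down → S.Down :=
  Quotient.map' (reflectionLift σ e) fun a b h => by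
    rw [QuotientAddGroup.leftRel_apply, mem_downPeriods] at h ⊢
    obtain ⟨hy, hv, hz, hw⟩ := h
    simp only [Prod.fst_add, Prod.snd_add, Prod.fst_neg, Prod.snd_neg] at hy hv hz hw
    refine ⟨?_, hv, ?_, hw⟩
    · simp only [reflectionLift, Prod.fst_add, Prod.fst_neg]
      rw [← mul_neg, ← mul_add, hy, mul_zero]
    · simp only [reflectionLift, Prod.fst_add, Prod.snd_add, Prod.fst_neg, Prod.snd_neg]
      rw [show -(e - a.2.2.1) + (e - b.2.2.1) = -(-a.2.2.1 + b.2.2.1) by ring]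
      exact neg_mem hz

@[simp]
theorem reflection_coe (σ : Fin m → ℝ) (e : ℝ) (q : (Fin m → ℝ) × ℝ × ℝ × ℝ) :
    S.reflection σ e (q : S.Down) = (reflectionLift σ e q : (Fin m → ℝ) × ℝ × ℝ × ℝ) := rfl

theorem reflection_involutive {σ : Fin m → ℝ} (hσ : σ * σ = 1) (e : ℝ) :
    Function.Involutive (S.reflection σ e) := by
  intro q
  obtain ⟨q, rfl⟩ := QuotientAddGroup.mk_surjective q
  rw [reflection_coe, reflection_coe]
  congr 1
  refine Prod.ext ?_ (Prod.ext rfl (Prod.ext ?_ rfl))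
  · simp [reflectionLift, ← mul_assoc, hσ]
  · simp [reflectionLift]

theorem isSmoothMap_reflection (σ : Fin m → ℝ) (e : ℝ) : IsSmoothMap (S.reflection σ e) := by
  intro q
  refine ⟨reflectionLift σ e, ?_, Filter.Eventually.of_forall fun y => rfl⟩
  unfold reflectionLift
  fun_prop

theorem isFibratedOverRIntegrable {σ : Fin m → ℝ} (hσ : σ * σ = 1) (e : ℝ) {p k : ℕ}
    (h : IsRIntegrable S.reducedField (S.reflection σ e) p k) :
    IsFibratedOverRIntegrable S.proj S.field p k :=
  ⟨S.proj_surjective, S.reducedField, S.pushesForward_reducedField, S.reflection σ e,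
    S.reflection_involutive hσ e, S.isSmoothMap_reflection σ e, h⟩

end CoupledSystem

/-! ### Analytic families of functions and linear differential equations -/

section AnalyticFamily

variable {F G : Type*} [NormedAddCommGroup F] [NormedSpace ℝ F]
  [NormedAddCommGroup G] [NormedSpace ℝ G]

/-- Integration from `0`, as an operator on the continuous functions on the unit interval. -/
noncomputable def volterra (F : Type*) [NormedAddCommGroup F] [NormedSpace ℝ F] :
    C(unitInterval, F) →L[ℝ] C(unitInterval, F) :=
  LinearMap.mkContinuous
    { toFun := fun f =>
        ⟨fun s => ∫ r in (0 : ℝ)..s, f (Set.projIcc 0 1 zero_le_one r),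
          (intervalIntegral.continuous_primitive
            (fun _ _ => (f.continuous.comp continuous_projIcc).intervalIntegrable _ _) 0).comp
            continuous_subtype_val⟩
      map_add' := fun f g => by
        ext s
        exact intervalIntegral.integral_add
          ((f.continuous.comp continuous_projIcc).intervalIntegrable _ _)
          ((g.continuous.comp continuous_projIcc).intervalIntegrable _ _)
      map_smul' := fun c f => by
        ext s
        exact intervalIntegral.integral_smul c _ } 1 fun f => by
    refine (ContinuousMap.norm_le _ (by positivity)).2 fun s => ?_
    refine (intervalIntegral.norm_integral_le_of_norm_le_const (C := ‖f‖)
      fun r _ => f.norm_coe_le_norm _).trans ?_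
    have := s.2
    rw [sub_zero, abs_of_nonneg this.1, one_mul]
    exact mul_le_of_le_one_right (norm_nonneg _) this.2

theorem volterra_apply (f : C(unitInterval, F)) (s : unitInterval) :
    volterra F f s = ∫ r in (0 : ℝ)..s, f (Set.projIcc 0 1 zero_le_one r) := rfl

theorem volterra_apply_of_eq {f : C(unitInterval, F)} {g : ℝ → F}
    (h : ∀ r : unitInterval, f r = g r) (s : unitInterval) :
    volterra F f s = ∫ r in (0 : ℝ)..s, g r := by
  rw [volterra_apply]
  refine intervalIntegral.integral_congr fun r hr => ?_
  rw [Set.uIcc_of_le s.2.1] at hr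
  have hr' : r ∈ Set.Icc (0 : ℝ) 1 := ⟨hr.1, hr.2.trans s.2.2⟩
  simp only [h, Set.projIcc_of_mem zero_le_one hr']

/-! ### Invertibility of 1 − K for a Volterra operator K -/

section Algebra

variable {𝔸 : Type*} [NormedRing 𝔸] [NormedAlgebra ℝ 𝔸]

/-- The operator `x ↦ ∫ A x`, as a function of `A`. -/
noncomputable def volterraMul (𝔸 : Type*) [NormedRing 𝔸] [NormedAlgebra ℝ 𝔸] :
    C(unitInterval, 𝔸) →L[ℝ] C(unitInterval, 𝔸) →L[ℝ] C(unitInterval, 𝔸) :=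
  (ContinuousLinearMap.compL ℝ _ _ _ (volterra 𝔸)).comp (ContinuousLinearMap.mul ℝ _)

theorem volterraMul_apply (A x : C(unitInterval, 𝔸)) :
    volterraMul 𝔸 A x = volterra 𝔸 (A * x) := rfl

/-- Iterated integration gains the factor sⁿ/n!, which makes the operator quasi-nilpotent however
large A is. -/
theorem norm_volterraMul_pow_apply_le (A x : C(unitInterval, 𝔸)) (n : ℕ) (s : unitInterval) :
    ‖(volterraMul 𝔸 A ^ n) x s‖ ≤ ‖A‖ ^ n * s ^ n / n.factorial * ‖x‖ := by
  induction n generalizing s with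
  | zero => simpa using x.norm_coe_le_norm s
  | succ n ih =>
    rw [pow_succ', mul_apply_eq_comp, volterraMul_apply, volterra_apply]
    have h1 : ∀ r ∈ Set.Ioc (0 : ℝ) s, ‖(A * (volterraMul 𝔸 A ^ n) x)
        (Set.projIcc 0 1 zero_le_one r)‖ ≤ ‖A‖ ^ (n + 1) / n.factorial * ‖x‖ * r ^ n := by
      intro r hr
      have hr' : r ∈ Set.Icc (0 : ℝ) 1 := ⟨hr.1.le, hr.2.trans s.2.2⟩
      rw [Set.projIcc_of_mem zero_le_one hr', ContinuousMap.mul_apply]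
      refine (norm_mul_le _ _).trans ((mul_le_mul (A.norm_coe_le_norm _) (ih _)
        (norm_nonneg _) (norm_nonneg _)).trans (le_of_eq ?_))
      ring
    refine (intervalIntegral.norm_integral_le_of_norm_le s.2.1
      (MeasureTheory.ae_of_all _ h1) ((by fun_prop : Continuous fun r : ℝ =>
        ‖A‖ ^ (n + 1) / n.factorial * ‖x‖ * r ^ n).intervalIntegrable _ _)).trans (le_of_eq ?_)
    rw [intervalIntegral.integral_const_mul, integral_pow, Nat.factorial_succ]
    push_cast
    have : (n.factorial : ℝ) ≠ 0 := by positivity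
    field_simp
    simp

/-- The geometric sum is a factor of 1 − xⁿ that commutes with the other factor 1 − x. -/
theorem isUnit_one_sub_of_isUnit_one_sub_pow {R : Type*} [Ring R] {x : R} {n : ℕ}
    (h : IsUnit (1 - x ^ n)) : IsUnit (1 - x) := by
  have hc : Commute (∑ i ∈ Finset.range n, x ^ i) (1 - x) :=
    Finset.sum_induction _ (fun y => Commute y (1 - x)) (fun _ _ => Commute.add_left)
      (Commute.zero_left _) fun i _ => (Commute.one_right _).sub_right (Commute.pow_self _ i)
  rw [← geom_sum_mul_neg, hc.isUnit_mul_iff] at h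
  exact h.2

/-- Since ‖A‖ⁿ/n! tends to 0, some power of the operator has norm less than 1, and the Neumann
series applies to that power. -/
theorem isUnit_one_sub_volterraMul [CompleteSpace 𝔸] (A : C(unitInterval, 𝔸)) :
    IsUnit (1 - volterraMul 𝔸 A) := by
  obtain ⟨n, hn⟩ := ((FloorSemiring.tendsto_pow_div_factorial_atTop ‖A‖).eventually
    (gt_mem_nhds one_half_pos)).exists
  have hK : ‖volterraMul 𝔸 A ^ n‖ < 1 := by
    refine lt_of_le_of_lt (ContinuousLinearMap.opNorm_le_bound _ (by positivity : (0:ℝ) ≤ 1 / 2)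
      fun x => (ContinuousMap.norm_le _ (by positivity)).2 fun s => ?_) one_half_lt_one
    refine (norm_volterraMul_pow_apply_le A x n s).trans
      (mul_le_mul_of_nonneg_right ?_ (norm_nonneg _))
    refine le_trans ?_ hn.le
    gcongr
    exact mul_le_of_le_one_right (by positivity) (pow_le_one₀ s.2.1 s.2.2)
  have h1 : IsUnit (1 - volterraMul 𝔸 A ^ n) := isUnit_one_sub_of_norm_lt_one
    (R := C(unitInterval, 𝔸) →L[ℝ] C(unitInterval, 𝔸)) hK
  exact isUnit_one_sub_of_isUnit_one_sub_pow (R := C(unitInterval, 𝔸) →L[ℝ] C(unitInterval, 𝔸)) h1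

end Algebra

/-- The functions `r ↦ u a r` on the intervals between `0` and `t`, scaled to the unit interval,
depend analytically on `(a, t)` in the uniform norm, for `a` in `𝒜` and `t` real. -/
def IsAnalyticFamily (𝒜 : Set ℝ) (u : ℝ → ℝ → F) : Prop :=
  ∃ U : ℝ × ℝ → C(unitInterval, F), AnalyticOnNhd ℝ U (𝒜 ×ˢ Set.univ) ∧
    ∀ a ∈ 𝒜, ∀ t : ℝ, ∀ s : unitInterval, U (a, t) s = u a (s * t)

/-! ### Operations on analytic families -/

namespace IsAnalyticFamily

variable {𝒜 : Set ℝ} {u v : ℝ → ℝ → F}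

theorem mono {ℬ : Set ℝ} (hu : IsAnalyticFamily 𝒜 u) (h : ℬ ⊆ 𝒜) : IsAnalyticFamily ℬ u := by
  obtain ⟨U, hU, hUu⟩ := hu
  exact ⟨U, hU.mono (Set.prod_mono h le_rfl), fun a ha => hUu a (h ha)⟩

theorem congr (hu : IsAnalyticFamily 𝒜 u) (h : ∀ a ∈ 𝒜, ∀ t, u a t = v a t) :
    IsAnalyticFamily 𝒜 v := by
  obtain ⟨U, hU, hUu⟩ := hu
  exact ⟨U, hU, fun a ha t s => by rw [hUu a ha, h a ha]⟩

/-- Evaluation at the endpoint s = 1 is continuous and linear on C([0,1]), and it recovers u a t. -/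
theorem analyticAt (hu : IsAnalyticFamily 𝒜 u) (h𝒜 : IsOpen 𝒜) {a : ℝ} (ha : a ∈ 𝒜) (t : ℝ) :
    AnalyticAt ℝ (fun p : ℝ × ℝ => u p.1 p.2) (a, t) := by
  obtain ⟨U, hU, hUu⟩ := hu
  have h1 : AnalyticAt ℝ (fun p : ℝ × ℝ => ContinuousMap.evalCLM ℝ (1 : unitInterval) (U p))
      (a, t) :=
    (ContinuousLinearMap.analyticAt _ _).comp (hU (a, t) ⟨ha, Set.mem_univ _⟩)
  refine h1.congr ?_
  filter_upwards [(h𝒜.prod isOpen_univ).mem_nhds (Set.mk_mem_prod ha (Set.mem_univ t))] with p hp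
  simpa using hUu p.1 hp.1 p.2 1

theorem continuous (hu : IsAnalyticFamily 𝒜 u) (h𝒜 : IsOpen 𝒜) {a : ℝ} (ha : a ∈ 𝒜) :
    Continuous (u a) := by
  refine continuous_iff_continuousAt.2 fun t => ?_
  exact ContinuousAt.comp (g := fun p : ℝ × ℝ => u p.1 p.2) (f := fun t : ℝ => (a, t))
    (hu.analyticAt h𝒜 ha t).continuousAt (Continuous.prodMk_right a).continuousAt

theorem clm_comp (hu : IsAnalyticFamily 𝒜 u) (L : F →L[ℝ] G) :
    IsAnalyticFamily 𝒜 fun a t => L (u a t) := by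
  obtain ⟨U, hU, hUu⟩ := hu
  exact ⟨fun p => L.compLeftContinuous ℝ unitInterval (U p),
    fun p hp => (ContinuousLinearMap.analyticAt _ _).comp (hU p hp),
    fun a ha t s => congrArg L (hUu a ha t s)⟩

theorem add (hu : IsAnalyticFamily 𝒜 u) (hv : IsAnalyticFamily 𝒜 v) :
    IsAnalyticFamily 𝒜 fun a t => u a t + v a t := by
  obtain ⟨U, hU, hUu⟩ := hu
  obtain ⟨V, hV, hVv⟩ := hv
  exact ⟨fun p => U p + V p, fun p hp => (hU p hp).fun_add (hV p hp),
    fun a ha t s => by simp [hUu a ha, hVv a ha]⟩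

theorem neg (hu : IsAnalyticFamily 𝒜 u) : IsAnalyticFamily 𝒜 fun a t => -u a t :=
  hu.clm_comp (-ContinuousLinearMap.id ℝ F)

theorem mul {𝔸 : Type*} [NormedRing 𝔸] [NormedAlgebra ℝ 𝔸] {u v : ℝ → ℝ → 𝔸}
    (hu : IsAnalyticFamily 𝒜 u) (hv : IsAnalyticFamily 𝒜 v) :
    IsAnalyticFamily 𝒜 fun a t => u a t * v a t := by
  obtain ⟨U, hU, hUu⟩ := hu
  obtain ⟨V, hV, hVv⟩ := hv
  exact ⟨fun p => U p * V p, fun p hp => (hU p hp).fun_mul (hV p hp),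
    fun a ha t s => by simp [hUu a ha, hVv a ha]⟩

theorem of_param {f : ℝ → ℝ} (hf : AnalyticOnNhd ℝ f 𝒜) : IsAnalyticFamily 𝒜 fun a _ => f a := by
  refine ⟨fun p => f p.1 • (1 : C(unitInterval, ℝ)), fun p hp => ?_, fun a ha t s => by simp⟩
  have h1 : AnalyticAt ℝ (fun p : ℝ × ℝ => f p.1) p := (hf p.1 hp.1).comp analyticAt_fst
  exact h1.fun_smul analyticAt_const

/-- A nowhere vanishing function is a unit of C([0,1]), and inversion in a Banach algebra is
analytic at units. -/
theorem inv {u : ℝ → ℝ → ℝ} (hu : IsAnalyticFamily 𝒜 u) (h0 : ∀ a ∈ 𝒜, ∀ t, u a t ≠ 0) :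
    IsAnalyticFamily 𝒜 fun a t => (u a t)⁻¹ := by
  obtain ⟨U, hU, hUu⟩ := hu
  have hun : ∀ a ∈ 𝒜, ∀ t, IsUnit (U (a, t)) := fun a ha t =>
    (ContinuousMap.isUnit_iff_forall_ne_zero _).2 fun s => by rw [hUu a ha]; exact h0 a ha _
  refine ⟨fun p => Ring.inverse (U p), fun p hp => ?_, fun a ha t s => ?_⟩
  · obtain ⟨w, hw⟩ := hun p.1 hp.1 p.2
    have h1 : AnalyticAt ℝ Ring.inverse (U p) := by
      have hw' : (w : C(unitInterval, ℝ)) = U p := hw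
      rw [← hw']; exact analyticAt_inverse w
    exact h1.comp (hU p hp)
  · have h1 := congrArg (fun f : C(unitInterval, ℝ) => f s)
      (Ring.mul_inverse_cancel _ (hun a ha t))
    simp only [ContinuousMap.mul_apply, ContinuousMap.one_apply, hUu a ha] at h1
    exact eq_inv_of_mul_eq_one_right h1

/-- Squaring has at q = √f the derivative 2q, a unit, so the analytic inverse function theorem
applies. Functions near q are positive, hence the local inverse is the pointwise square root. -/
theorem _root_.ContinuousMap.analyticAt_sqrt_comp {f : C(unitInterval, ℝ)} (hf : ∀ s, 0 < f s) :
    AnalyticAt ℝ (fun g : C(unitInterval, ℝ) => (⟨Real.sqrt, Real.continuous_sqrt⟩ : C(ℝ, ℝ)).comp g)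
      f := by
  set q : C(unitInterval, ℝ) := (⟨Real.sqrt, Real.continuous_sqrt⟩ : C(ℝ, ℝ)).comp f with hq
  have hqs : ∀ s, 0 < q s := fun s => Real.sqrt_pos.2 (hf s)
  have hqq : q * q = f := by
    ext s
    exact Real.mul_self_sqrt (hf s).le
  obtain ⟨w, hw⟩ : IsUnit (2 * q) :=
    (ContinuousMap.isUnit_iff_forall_ne_zero _).2 fun s => by
      have := hqs s
      have h2 : (2 * q) s = 2 * q s := rfl
      rw [h2]; positivity
  let e : C(unitInterval, ℝ) ≃L[ℝ] C(unitInterval, ℝ) :=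
    ContinuousLinearEquiv.equivOfInverse (ContinuousLinearMap.mul ℝ _ (w : C(unitInterval, ℝ)))
      (ContinuousLinearMap.mul ℝ _ ((w⁻¹ : (C(unitInterval, ℝ))ˣ) : C(unitInterval, ℝ)))
      (fun x => by simp) (fun x => by simp)
  have hc : ContDiffAt ℝ ω (fun g : C(unitInterval, ℝ) => g * g) q :=
    contDiffAt_id.mul contDiffAt_id
  have hd : HasFDerivAt (fun g : C(unitInterval, ℝ) => g * g) (e : C(unitInterval, ℝ) →L[ℝ] _) q := by
    refine ((hasFDerivAt_id q).mul (hasFDerivAt_id q)).congr_fderiv ?_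
    ext x s
    have h2 : (2 : C(unitInterval, ℝ)) s = 2 := rfl
    simp [e, hw, h2]
    ring
  have hs : HasStrictFDerivAt (fun g : C(unitInterval, ℝ) => g * g)
    (e : C(unitInterval, ℝ) →L[ℝ] _) q := hc.hasStrictFDerivAt' hd (by simp)
  have hpos : ∀ᶠ x in 𝓝 q, ∀ s, 0 < x s := by
    have : IsOpen {x : C(unitInterval, ℝ) | Set.MapsTo x Set.univ (Set.Ioi 0)} :=
      ContinuousMap.isOpen_setOfPred_mapsTo isCompact_univ isOpen_Ioi
    filter_upwards [this.mem_nhds (fun s _ => hqs s)] with x hx s using hx (Set.mem_univ s)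
  have hu := hs.localInverse_unique (g := fun g : C(unitInterval, ℝ) =>
    (⟨Real.sqrt, Real.continuous_sqrt⟩ : C(ℝ, ℝ)).comp g) (by
      filter_upwards [hpos] with x hx
      ext s
      exact Real.sqrt_mul_self (hx s).le)
  have ha : AnalyticAt ℝ (hc.localInverse hd (by simp)) f := by
    have := (hc.to_localInverse hd (by simp)).analyticAt
    rwa [hqq] at this
  rw [hqq] at hu
  exact ha.congr (hu.mono fun y hy => hy.symm)

theorem sqrt {u : ℝ → ℝ → ℝ} (hu : IsAnalyticFamily 𝒜 u) (h0 : ∀ a ∈ 𝒜, ∀ t, 0 < u a t) :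
    IsAnalyticFamily 𝒜 fun a t => √(u a t) := by
  obtain ⟨U, hU, hUu⟩ := hu
  refine ⟨fun p => (⟨Real.sqrt, Real.continuous_sqrt⟩ : C(ℝ, ℝ)).comp (U p), fun p hp => ?_,
    fun a ha t s => congrArg Real.sqrt (hUu a ha t s)⟩
  refine AnalyticAt.comp (g := fun g : C(unitInterval, ℝ) =>
    (⟨Real.sqrt, Real.continuous_sqrt⟩ : C(ℝ, ℝ)).comp g)
    (ContinuousMap.analyticAt_sqrt_comp fun s => ?_) (hU p hp)
  have := hUu p.1 hp.1 p.2 s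
  rw [Prod.mk.eta] at this
  rw [this]
  exact h0 _ hp.1 _

/-- This is the exponential of t • c in the Banach algebra C([0,1], ℂ), where c s = i s. Sine and
cosine are its imaginary and real parts. -/
theorem exp_mul_I (𝒜 : Set ℝ) :
    IsAnalyticFamily 𝒜 fun _ t : ℝ => Complex.exp (t * Complex.I) := by
  let c : C(unitInterval, ℂ) := ⟨fun s => (s : ℝ) * Complex.I, by fun_prop⟩
  refine ⟨fun p => NormedSpace.exp (p.2 • c), fun p _ => ?_, fun a ha t s => ?_⟩
  · refine AnalyticAt.comp (g := NormedSpace.exp) (NormedSpace.exp_analytic (𝕂 := ℝ) _) ?_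
    exact analyticAt_snd.fun_smul analyticAt_const
  · have h := NormedSpace.map_exp (ContinuousMap.evalAlgHom ℝ ℂ s)
      (ContinuousMap.evalCLM ℝ (M := ℂ) s).continuous (t • c)
    have h' : NormedSpace.exp (t • c) s = NormedSpace.exp ((t • c) s) := h
    rw [h', ← Complex.exp_eq_exp_ℂ]
    congr 1
    simp [c]
    ring

theorem sin (𝒜 : Set ℝ) : IsAnalyticFamily 𝒜 fun _ t : ℝ => Real.sin t :=
  ((exp_mul_I 𝒜).clm_comp Complex.imCLM).congr fun a _ t => by
    simp [Complex.exp_ofReal_mul_I_im]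

theorem cos (𝒜 : Set ℝ) : IsAnalyticFamily 𝒜 fun _ t : ℝ => Real.cos t :=
  ((exp_mul_I 𝒜).clm_comp Complex.reCLM).congr fun a _ t => by
    simp [Complex.exp_ofReal_mul_I_re]

/-- Rescaling [0, t] to [0, 1] turns the primitive into t times the linear operator `volterra`. -/
theorem integral (hu : IsAnalyticFamily 𝒜 u) :
    IsAnalyticFamily 𝒜 fun a t => ∫ r in (0 : ℝ)..t, u a r := by
  obtain ⟨U, hU, hUu⟩ := hu
  refine ⟨fun p => p.2 • volterra F (U p), fun p hp => ?_, fun a ha t s => ?_⟩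
  · exact analyticAt_snd.fun_smul ((ContinuousLinearMap.analyticAt _ _).comp (hU p hp))
  · have h := volterra_apply_of_eq (g := fun r => u a (r * t)) (hUu a ha t) s
    rw [ContinuousMap.smul_apply, h]
    change t • (∫ r in (0 : ℝ)..s, u a (r * t)) = _
    rw [intervalIntegral.smul_integral_comp_mul_right, zero_mul]

theorem hasDerivAt_integral [CompleteSpace F] (hu : IsAnalyticFamily 𝒜 u) (h𝒜 : IsOpen 𝒜) {a : ℝ}
    (ha : a ∈ 𝒜) (t : ℝ) : HasDerivAt (fun t => ∫ r in (0 : ℝ)..t, u a r) (u a t) t :=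
  (hu.continuous h𝒜 ha).integral_hasStrictDerivAt 0 t |>.hasDerivAt

/-- The fundamental solution of a linear differential equation is an analytic family if the
coefficient is. -/
theorem exists_fundamental_solution {𝔸 : Type*} [NormedRing 𝔸] [NormedAlgebra ℝ 𝔸]
    [CompleteSpace 𝔸] {A : ℝ → ℝ → 𝔸} (hA : IsAnalyticFamily 𝒜 A) (h𝒜 : IsOpen 𝒜) :
    ∃ X : ℝ → ℝ → 𝔸, IsAnalyticFamily 𝒜 X ∧
      ∀ a ∈ 𝒜, X a 0 = 1 ∧ ∀ t, HasDerivAt (X a) (A a t * X a t) t := by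
  obtain ⟨U, hU, hUA⟩ := hA
  have hun : ∀ p : ℝ × ℝ, IsUnit (1 - volterraMul 𝔸 (p.2 • U p)) := fun p =>
    isUnit_one_sub_volterraMul _
  -- x (a, t) is the solution on [0, t] rescaled to the unit interval: the solution of x = 1 + ∫ t A
  -- x. It is analytic in (a, t) because `Ring.inverse` is analytic at units.
  let x : ℝ × ℝ → C(unitInterval, 𝔸) := fun p =>
    Ring.inverse (1 - volterraMul 𝔸 (p.2 • U p)) 1
  have hx : ∀ p, x p - volterra 𝔸 (p.2 • U p * x p) = 1 := fun p =>
    congrArg (fun T : C(unitInterval, 𝔸) →L[ℝ] C(unitInterval, 𝔸) => T 1)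
      (Ring.mul_inverse_cancel _ (hun p))
  have huniq : ∀ p y, y - volterra 𝔸 (p.2 • U p * y) = 1 → y = x p := by
    intro p y hy
    have h1 := congrArg (fun T : C(unitInterval, 𝔸) →L[ℝ] C(unitInterval, 𝔸) => T y)
      (Ring.inverse_mul_cancel _ (hun p))
    have h2 : (1 - volterraMul 𝔸 (p.2 • U p)) y = 1 := hy
    simp only [mul_apply_eq_comp, h2, one_apply_eq_self] at h1
    exact h1.symm
  have hxs : ∀ a ∈ 𝒜, ∀ t, ∀ s : unitInterval, x (a, t) s =
      1 + ∫ r in (0 : ℝ)..s, t • (A a (r * t) * x (a, t) (Set.projIcc 0 1 zero_le_one r)) := by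
    intro a ha t s
    have h1 := congrArg (fun f : C(unitInterval, 𝔸) => f s) (hx (a, t))
    have h2 := volterra_apply_of_eq (f := t • U (a, t) * x (a, t)) (g := fun r =>
      t • (A a (r * t) * x (a, t) (Set.projIcc 0 1 zero_le_one r))) (fun r => by
        simp [hUA a ha, Set.projIcc_val]) s
    simp only [ContinuousMap.sub_apply, ContinuousMap.one_apply] at h1
    rw [← h2]
    exact sub_eq_iff_eq_add.1 h1
  -- The part of the solution for t over [0, s], rescaled, solves the integral equation for s t. By
  -- uniqueness it is x (a, s t), so all the x (a, t) come from one function of time.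
  have hscale : ∀ a ∈ 𝒜, ∀ t, ∀ s : unitInterval, x (a, t) s = x (a, s * t) 1 := by
    intro a ha t s
    let y : C(unitInterval, 𝔸) := ⟨fun r => x (a, t) (s * r), by fun_prop⟩
    have hy : y = x (a, s * t) := by
      refine huniq _ _ ?_
      ext r
      have h2 := volterra_apply_of_eq (f := (s * t : ℝ) • U (a, s * t) * y) (g := fun r =>
        (s : ℝ) • (t • (A a ((s * r) * t) *
          x (a, t) (Set.projIcc 0 1 zero_le_one ((s : ℝ) * r))))) (fun r => by
          have h3 : Set.projIcc (0 : ℝ) 1 zero_le_one ((s : ℝ) * r) = s * r :=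
            Set.projIcc_val zero_le_one (s * r)
          simp only [ContinuousMap.smul_apply, ContinuousMap.mul_apply, hUA a ha, h3, smul_smul,
            smul_mul_assoc, mul_assoc, mul_left_comm (r : ℝ)]
          rfl) r
      simp only [ContinuousMap.sub_apply, ContinuousMap.one_apply]
      rw [h2, intervalIntegral.integral_smul, intervalIntegral.smul_integral_comp_mul_left
        (fun r => t • (A a (r * t) * x (a, t) (Set.projIcc 0 1 zero_le_one r))), mul_zero]
      have h4 := hxs a ha t (s * r)
      rw [sub_eq_iff_eq_add]
      exact h4
    have := congrArg (fun f : C(unitInterval, 𝔸) => f 1) hy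
    simpa [y] using this
  have hfam : IsAnalyticFamily 𝒜 fun a t => x (a, t) 1 := by
    refine ⟨x, fun p hp => ?_, fun a ha t s => hscale a ha t s⟩
    have h1 : AnalyticAt ℝ (fun p : ℝ × ℝ => 1 - volterraMul 𝔸 (p.2 • U p)) p := by
      refine analyticAt_const.fun_sub ((ContinuousLinearMap.analyticAt _ _).comp ?_)
      exact analyticAt_snd.fun_smul (hU p hp)
    obtain ⟨w, hw⟩ := hun p
    have h2 : AnalyticAt ℝ Ring.inverse (1 - volterraMul 𝔸 (p.2 • U p)) := by
      rw [← hw]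
      exact analyticAt_inverse (𝕜 := ℝ) (A := C(unitInterval, 𝔸) →L[ℝ] C(unitInterval, 𝔸)) w
    have h3 := h2.comp (f := fun p : ℝ × ℝ => 1 - volterraMul 𝔸 (p.2 • U p)) h1
    exact (ContinuousLinearMap.analyticAt
      (ContinuousLinearMap.apply ℝ (C(unitInterval, 𝔸)) (1 : C(unitInterval, 𝔸))) _).comp h3
  have hA' : IsAnalyticFamily 𝒜 A := ⟨U, hU, hUA⟩
  refine ⟨_, hfam, fun a ha => ?_⟩
  have hint : ∀ t, x (a, t) 1 = 1 + ∫ r in (0 : ℝ)..t, A a r * x (a, r) 1 := by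
    intro t
    rw [hxs a ha t 1, intervalIntegral.integral_smul]
    have h1 : ∫ r in (0 : ℝ)..(1 : unitInterval), A a (r * t) *
        x (a, t) (Set.projIcc 0 1 zero_le_one r) =
        ∫ r in (0 : ℝ)..(1 : unitInterval), (fun r => A a r * x (a, r) 1) (r * t) := by
      refine intervalIntegral.integral_congr fun r hr => ?_
      rw [Set.uIcc_of_le (by simp)] at hr
      simp only [Set.projIcc_of_mem zero_le_one hr]
      rw [hscale a ha]
    rw [h1, intervalIntegral.smul_integral_comp_mul_right (fun r => A a r * x (a, r) 1)]
    simp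
  refine ⟨by simpa using hint 0, fun t => ?_⟩
  have hd := (hA'.mul hfam).hasDerivAt_integral h𝒜 ha t
  exact (hd.const_add 1).congr_of_eventuallyEq (Filter.Eventually.of_forall hint)

end IsAnalyticFamily

end AnalyticFamily

/-! ### The rotations generated by a rolling constraint -/

/-- The matrix of the equations `y' = v (x, y)`, `v' = -(x, y) ⬝ y`. -/
def rollingMatrix (x y : ℝ) : Matrix (Fin 3) (Fin 3) ℝ := !![0, 0, x; 0, 0, y; -x, -y, 0]

/-- The reflection of the second coordinate. -/
def secondReflection : Matrix (Fin 3) (Fin 3) ℝ := !![1, 0, 0; 0, -1, 0; 0, 0, 1]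

theorem secondReflection_mul_self : secondReflection * secondReflection = 1 := by
  ext i j; fin_cases i <;> fin_cases j <;> simp [secondReflection, Matrix.mul_apply, Fin.sum_univ_three]

theorem secondReflection_mul_rollingMatrix (x y : ℝ) :
    secondReflection * rollingMatrix x y = -rollingMatrix (-x) y * secondReflection := by
  ext i j; fin_cases i <;> fin_cases j <;>
    simp [secondReflection, rollingMatrix, Matrix.mul_apply, Fin.sum_univ_three]

theorem rollingMatrix_transpose (x y : ℝ) : (rollingMatrix x y)ᵀ = -rollingMatrix x y := by
  ext i j; fin_cases i <;> fin_cases j <;> simp [rollingMatrix]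

section MatrixODE

attribute [local instance] Matrix.linftyOpNormedRing Matrix.linftyOpNormedAlgebra

variable {n : ℕ}

/-- The norm on matrices is local to this section; elsewhere derivatives are taken entry by entry.
-/
theorem hasDerivAt_matrix_iff {X : ℝ → Matrix (Fin n) (Fin n) ℝ} {X' : Matrix (Fin n) (Fin n) ℝ}
    {t : ℝ} : HasDerivAt X X' t ↔ ∀ i j, HasDerivAt (fun t => X t i j) (X' i j) t := by
  have h : ∀ (Y : ℝ → Matrix (Fin n) (Fin n) ℝ) (Y' : Matrix (Fin n) (Fin n) ℝ),
      HasDerivAt Y Y' t → ∀ i j, HasDerivAt (fun t => Y t i j) (Y' i j) t := fun Y Y' h i j =>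
    (LinearMap.toContinuousLinearMap
      (Matrix.entryLinearMap ℝ ℝ i j)).hasFDerivAt.comp_hasDerivAt t h
  refine ⟨h X X', fun h' => ?_⟩
  have h1 : HasDerivAt (fun t => ∑ i, ∑ j, X t i j • Matrix.single i j (1 : ℝ))
      (∑ i, ∑ j, X' i j • Matrix.single i j (1 : ℝ)) t :=
    HasDerivAt.fun_sum fun i _ => HasDerivAt.fun_sum fun j _ => (h' i j).smul_const _
  have h2 : ∀ Y : Matrix (Fin n) (Fin n) ℝ, ∑ i, ∑ j, Y i j • Matrix.single i j (1 : ℝ) = Y := by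
    intro Y
    conv_rhs => rw [Matrix.matrix_eq_sum_single Y]
    simp [Matrix.smul_single]
  simpa only [h2] using h1

/-- The derivative of XᵀY is Xᵀ(Aᵀ + A)Y = 0. -/
theorem transpose_mul_eq_of_skew {A X Y : ℝ → Matrix (Fin n) (Fin n) ℝ}
    (hA : ∀ t, (A t)ᵀ = -A t) (hX : ∀ t i j, HasDerivAt (fun t => X t i j) ((A t * X t) i j) t)
    (hY : ∀ t i j, HasDerivAt (fun t => Y t i j) ((A t * Y t) i j) t) (t : ℝ) :
    (X t)ᵀ * Y t = (X 0)ᵀ * Y 0 := by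
  have h1 : ∀ t, HasDerivAt (fun t => (X t)ᵀ * Y t) 0 t := by
    intro t
    have hXt : HasDerivAt (fun t => (X t)ᵀ) ((A t * X t)ᵀ) t :=
      hasDerivAt_matrix_iff.2 fun i j => hX t j i
    refine (hXt.mul (hasDerivAt_matrix_iff.2 (hY t))).congr_deriv ?_
    rw [Matrix.transpose_mul, hA, Matrix.mul_assoc]
    simp
  exact is_const_of_deriv_eq_zero (fun t => (h1 t).differentiableAt) (fun t => (h1 t).deriv) t 0

/-- Uniqueness of solutions by orthogonality: XᵀX = 1 and XᵀY keeps its initial value. -/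
theorem eq_mul_of_skew {A X Y : ℝ → Matrix (Fin n) (Fin n) ℝ}
    (hA : ∀ t, (A t)ᵀ = -A t) (hX : ∀ t i j, HasDerivAt (fun t => X t i j) ((A t * X t) i j) t)
    (hX0 : X 0 = 1) (hY : ∀ t i j, HasDerivAt (fun t => Y t i j) ((A t * Y t) i j) t) (t : ℝ) :
    Y t = X t * Y 0 := by
  have h1 := transpose_mul_eq_of_skew hA hX hX t
  have h2 := transpose_mul_eq_of_skew hA hX hY t
  simp only [hX0, Matrix.transpose_one, Matrix.one_mul] at h1 h2
  rw [← h2, ← Matrix.mul_assoc, mul_eq_one_comm.1 h1, Matrix.one_mul]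

/-- `X` is the fundamental solution of the linear equation with the matrix
`rollingMatrix (p₁ a t) (p₂ a t)`, for the parameters `a ∈ 𝒜`. -/
structure IsRollingCocycle (𝒜 : Set ℝ) (p₁ p₂ : ℝ → ℝ → ℝ)
    (X : ℝ → ℝ → Matrix (Fin 3) (Fin 3) ℝ) : Prop where
  family : ∀ i j, IsAnalyticFamily 𝒜 fun a t => X a t i j
  zero : ∀ a ∈ 𝒜, X a 0 = 1
  deriv : ∀ a ∈ 𝒜, ∀ t i j,
    HasDerivAt (fun t => X a t i j) ((rollingMatrix (p₁ a t) (p₂ a t) * X a t) i j) t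

theorem exists_isRollingCocycle {𝒜 : Set ℝ} (h𝒜 : IsOpen 𝒜) {p₁ p₂ : ℝ → ℝ → ℝ}
    (h₁ : IsAnalyticFamily 𝒜 p₁) (h₂ : IsAnalyticFamily 𝒜 p₂) :
    ∃ X, IsRollingCocycle 𝒜 p₁ p₂ X := by
  have hA : IsAnalyticFamily 𝒜 fun a t => rollingMatrix (p₁ a t) (p₂ a t) := by
    refine ((h₁.clm_comp (ContinuousLinearMap.toSpanSingleton ℝ (rollingMatrix 1 0))).add
      (h₂.clm_comp (ContinuousLinearMap.toSpanSingleton ℝ (rollingMatrix 0 1)))).congr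
      fun a _ t => ?_
    ext i j; fin_cases i <;> fin_cases j <;> simp [rollingMatrix]
  obtain ⟨X, hX, hX'⟩ := hA.exists_fundamental_solution h𝒜
  exact ⟨X, fun i j => hX.clm_comp (LinearMap.toContinuousLinearMap
    (Matrix.entryLinearMap ℝ ℝ i j)), fun a ha => (hX' a ha).1,
    fun a ha t => hasDerivAt_matrix_iff.1 ((hX' a ha).2 t)⟩

end MatrixODE

namespace IsRollingCocycle

variable {𝒜 : Set ℝ} {p₁ p₂ : ℝ → ℝ → ℝ} {X : ℝ → ℝ → Matrix (Fin 3) (Fin 3) ℝ}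

theorem eq_mul (hX : IsRollingCocycle 𝒜 p₁ p₂ X) {a : ℝ} (ha : a ∈ 𝒜)
    {Y : ℝ → Matrix (Fin 3) (Fin 3) ℝ} (hY : ∀ t i j,
      HasDerivAt (fun t => Y t i j) ((rollingMatrix (p₁ a t) (p₂ a t) * Y t) i j) t) (t : ℝ) :
    Y t = X a t * Y 0 :=
  eq_mul_of_skew (fun _ => rollingMatrix_transpose _ _) (hX.deriv a ha) (hX.zero a ha) hY t

theorem transpose_mul_self (hX : IsRollingCocycle 𝒜 p₁ p₂ X) {a : ℝ} (ha : a ∈ 𝒜) (t : ℝ) :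
    (X a t)ᵀ * X a t = 1 := by
  have := transpose_mul_eq_of_skew (A := fun t => rollingMatrix (p₁ a t) (p₂ a t))
    (fun _ => rollingMatrix_transpose _ _) (hX.deriv a ha) (hX.deriv a ha) t
  simpa [hX.zero a ha] using this

/-- The determinant is continuous in t, has square 1, and equals 1 at t = 0. -/
theorem det_eq_one (hX : IsRollingCocycle 𝒜 p₁ p₂ X) (h𝒜 : IsOpen 𝒜) {a : ℝ} (ha : a ∈ 𝒜)
    (t : ℝ) : (X a t).det = 1 := by
  have hc : Continuous fun t => (X a t).det :=
    (continuous_matrix fun i j => (hX.family i j).continuous h𝒜 ha).matrix_det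
  have hs : ∀ t, (X a t).det ^ 2 = 1 := fun t => by
    have := congrArg Matrix.det (hX.transpose_mul_self ha t)
    rwa [Matrix.det_mul, Matrix.det_transpose, Matrix.det_one, ← sq] at this
  have h0 : (X a 0).det = 1 := by rw [hX.zero a ha, Matrix.det_one]
  rcases isPreconnected_univ.eq_one_or_eq_neg_one_of_sq_eq hc.continuousOn
    (fun t _ => by simpa using hs t) with h | h
  · simpa using h (Set.mem_univ t)
  · have := h (Set.mem_univ (0 : ℝ))
    simp [h0] at this
    norm_num at this

/-- The shifted solution satisfies the same equation, and its initial value is the monodromy. -/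
theorem periodic (hX : IsRollingCocycle 𝒜 p₁ p₂ X) {a : ℝ} (ha : a ∈ 𝒜)
    (h₁ : Function.Periodic (p₁ a) (2 * Real.pi)) (h₂ : Function.Periodic (p₂ a) (2 * Real.pi))
    (t : ℝ) : X a (t + 2 * Real.pi) = X a t * X a (2 * Real.pi) := by
  have := hX.eq_mul ha (Y := fun t => X a (t + 2 * Real.pi)) (fun t i j => by
    have := (hX.deriv a ha (t + 2 * Real.pi) i j).comp_add_const t (2 * Real.pi)
    rwa [h₁, h₂] at this) t
  simpa using this

/-- For p₁ odd and p₂ even the reflection R conjugates the equation to its time reversal, so R X(−t)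
is the solution with initial value R. -/
theorem reflect (hX : IsRollingCocycle 𝒜 p₁ p₂ X) {a : ℝ} (ha : a ∈ 𝒜)
    (h₁ : ∀ t, p₁ a (-t) = -p₁ a t) (h₂ : ∀ t, p₂ a (-t) = p₂ a t) (t : ℝ) :
    secondReflection * X a (-t) = X a t * secondReflection := by
  have h := hX.eq_mul ha (Y := fun t => secondReflection * X a (-t)) (fun t i j => by
    have h3 : ∀ k, HasDerivAt (fun t => X a (-t) k j)
        (-(rollingMatrix (p₁ a (-t)) (p₂ a (-t)) * X a (-t)) k j) t := fun k => by
      have := (hX.deriv a ha (-t) k j).scomp t (hasDerivAt_neg t)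
      simpa [Function.comp_def] using this
    have h4 : HasDerivAt (fun t => ∑ k, secondReflection i k * X a (-t) k j)
        (∑ k, secondReflection i k * -(rollingMatrix (p₁ a (-t)) (p₂ a (-t)) * X a (-t)) k j) t :=
      HasDerivAt.fun_sum fun k _ => (h3 k).const_mul _
    have h5 : ∑ k, secondReflection i k * -(rollingMatrix (p₁ a (-t)) (p₂ a (-t)) * X a (-t)) k j
        = (rollingMatrix (p₁ a t) (p₂ a t) * (secondReflection * X a (-t))) i j := by
      have h6 : -(secondReflection * (rollingMatrix (p₁ a (-t)) (p₂ a (-t)) * X a (-t))) =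
          rollingMatrix (p₁ a t) (p₂ a t) * (secondReflection * X a (-t)) := by
        rw [← Matrix.mul_assoc, secondReflection_mul_rollingMatrix, h₁, h₂, neg_neg,
          Matrix.mul_assoc, Matrix.neg_mul, neg_neg]
      rw [← h6, Matrix.neg_apply, Matrix.mul_apply, ← Finset.sum_neg_distrib]
      simp
    rw [h5] at h4
    exact h4) t
  simpa [hX.zero a ha] using h

/-- Periodicity from time −2π gives X(−2π) = M⁻¹ = Mᵀ, and the reflection gives X(−2π) = R M R. -/
theorem transpose_monodromy (hX : IsRollingCocycle 𝒜 p₁ p₂ X) {a : ℝ} (ha : a ∈ 𝒜)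
    (h₁ : Function.Periodic (p₁ a) (2 * Real.pi)) (h₂ : Function.Periodic (p₂ a) (2 * Real.pi))
    (h₁' : ∀ t, p₁ a (-t) = -p₁ a t) (h₂' : ∀ t, p₂ a (-t) = p₂ a t) :
    (X a (2 * Real.pi))ᵀ = secondReflection * X a (2 * Real.pi) * secondReflection := by
  have h := hX.periodic ha h₁ h₂ (-(2 * Real.pi))
  rw [neg_add_cancel, hX.zero a ha] at h
  have h3 := hX.reflect ha h₁' h₂' (-(2 * Real.pi))
  rw [neg_neg] at h3
  rw [h3, Matrix.mul_assoc, secondReflection_mul_self, Matrix.mul_one]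
  have h4 := hX.transpose_mul_self ha (2 * Real.pi)
  exact left_inv_eq_left_inv h4 h.symm

/-- The monodromy is not constant if its derivative with respect to the parameter at `0`, where
it fixes the second basis vector, does not vanish on this vector. -/
theorem exists_monodromy_ne_one (hX : IsRollingCocycle 𝒜 p₁ p₂ X) (h𝒜 : IsOpen 𝒜)
    (h0 : (0 : ℝ) ∈ 𝒜) {h : ℝ → ℝ → ℝ} (hh : IsAnalyticFamily 𝒜 h) {i : Fin 3} (hi : i ≠ 1)
    (hd : ∀ a ∈ 𝒜, ∀ t, (rollingMatrix (p₁ a t) (p₂ a t) * X a t) i 1 = a * h a t)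
    (hint : ∫ t in (0 : ℝ)..(2 * Real.pi), h 0 t ≠ 0) :
    ∃ a ∈ 𝒜, X a (2 * Real.pi) 1 1 ≠ 1 := by
  by_contra! hM
  -- The second column is a unit vector, so if its middle entry is 1 the others vanish.
  have hz : ∀ a ∈ 𝒜, X a (2 * Real.pi) i 1 = 0 := by
    intro a ha
    have h1 := congrFun (congrFun (hX.transpose_mul_self ha (2 * Real.pi)) 1) 1
    simp only [Matrix.mul_apply, Matrix.transpose_apply, Fin.sum_univ_three, hM a ha,
      Matrix.one_apply_eq] at h1
    fin_cases i
    · simp only [Fin.zero_eta]; nlinarith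
    · exact absurd rfl hi
    · simp only [Fin.reduceFinMk]; nlinarith
  -- The entry (i, 1) of the monodromy is the integral of a h, and a can be cancelled away from 0.
  have hH : ∀ a ∈ 𝒜, a ≠ 0 → ∫ t in (0 : ℝ)..(2 * Real.pi), h a t = 0 := by
    intro a ha ha0
    have h1 : ∫ t in (0 : ℝ)..(2 * Real.pi), a * h a t = X a (2 * Real.pi) i 1 - X a 0 i 1 := by
      refine intervalIntegral.integral_eq_sub_of_hasDerivAt
        (f := fun t => X a t i 1) (fun t _ => ?_)
        ((hh.continuous h𝒜 ha).const_mul a |>.intervalIntegrable _ _)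
      rw [← hd a ha]
      exact hX.deriv a ha t i 1
    rw [hz a ha, hX.zero a ha, Matrix.one_apply_ne hi, sub_zero,
      intervalIntegral.integral_const_mul] at h1
    exact (mul_eq_zero.1 h1).resolve_left ha0
  -- The integral of h is continuous in the parameter and vanishes for a ≠ 0, hence it vanishes at 0
  -- too, against `hint`.
  have hc : ContinuousAt (fun a => ∫ t in (0 : ℝ)..(2 * Real.pi), h a t) 0 :=
    ContinuousAt.comp (g := fun p : ℝ × ℝ => ∫ t in (0 : ℝ)..p.2, h p.1 t)
      (f := fun a : ℝ => (a, 2 * Real.pi)) (hh.integral.analyticAt h𝒜 h0 _).continuousAt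
      (Continuous.prodMk_left _).continuousAt
  have ht : Filter.Tendsto (fun a => ∫ t in (0 : ℝ)..(2 * Real.pi), h a t) (𝓝[≠] 0) (𝓝 0) := by
    refine Filter.Tendsto.congr' ?_ tendsto_const_nhds
    filter_upwards [self_mem_nhdsWithin, mem_nhdsWithin_of_mem_nhds (h𝒜.mem_nhds h0)] with a h1 h2
    exact (hH a h2 h1).symm
  exact hint (tendsto_nhds_unique (hc.tendsto.mono_left nhdsWithin_le_nhds) ht)

end IsRollingCocycle

/-- A rotation `M` whose inverse is conjugate to `M` by the reflection of the second coordinate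
has its axis in the plane of the first and third coordinates. -/
theorem rotation_frame {M : Matrix (Fin 3) (Fin 3) ℝ} (ho : Mᵀ * M = 1) (hd : M.det = 1)
    (ht : Mᵀ = secondReflection * M * secondReflection) {σ x y : ℝ} (hσ : σ ≠ 0)
    (hσ2 : σ ^ 2 = 1 - M 1 1 ^ 2) (hx : M 0 1 = -σ * x) (hy : M 2 1 = -σ * y) :
    x ^ 2 + y ^ 2 = 1 ∧ M *ᵥ ![y, 0, -x] = ![y, 0, -x] ∧
      M *ᵥ ![x, 0, y] = ![M 1 1 * x, σ, M 1 1 * y] ∧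
      M *ᵥ ![0, 1, 0] = ![-σ * x, M 1 1, -σ * y] := by
  -- M 1 1 and σ are the cosine and the sine of the angle of rotation. Every entry of a rotation
  -- equals its cofactor, and these relations yield the entries in the first and third rows and
  -- columns.
  have hadj : M.adjugate = Mᵀ := by
    have h1 : M.adjugate * M = 1 := by rw [Matrix.adjugate_mul, hd, one_smul]
    exact left_inv_eq_left_inv h1 (mul_eq_one_comm.1 (mul_eq_one_comm.1 ho))
  have e := fun i j => congrFun (congrFun ht i) j
  have e01 := e 0 1
  have e20 := e 2 0
  have e21 := e 2 1
  have o11 := congrFun (congrFun ho 1) 1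
  rw [Matrix.adjugate_fin_three] at hadj
  have a00 := congrFun (congrFun hadj 0) 0
  have a02 := congrFun (congrFun hadj 2) 0
  have a22 := congrFun (congrFun hadj 2) 2
  simp [secondReflection, Matrix.mul_apply, Fin.sum_univ_three, Matrix.vecMul, dotProduct]
    at e01 e20 e21 o11 a00 a02 a22
  have m10 : M 1 0 = σ * x := by rw [e01, hx]; ring
  have m12 : M 1 2 = σ * y := by rw [e21, hy]; ring
  rw [hx, hy] at o11
  rw [m12, hy] at a00
  rw [m10, hy, ← e20] at a02
  rw [hx, m10] at a22
  generalize hs1 : M 1 1 = s at *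
  have hσ' : σ ^ 2 ≠ 0 := pow_ne_zero 2 hσ
  have hxy : x ^ 2 + y ^ 2 = 1 := by
    apply mul_left_cancel₀ hσ'
    linear_combination o11 - hσ2
  have hs : 1 + s ≠ 0 := fun h => hσ' (by rw [hσ2]; linear_combination (1 - s) * h)
  have m02 : M 0 2 = -(1 - s) * x * y := by
    apply mul_left_cancel₀ hs
    linear_combination -a02 - x * y * hσ2
  have m00 : M 0 0 = s * x ^ 2 + y ^ 2 := by
    apply mul_left_cancel₀ hσ'
    linear_combination M 0 0 * hσ2 - a00 - s * a22
  have m22 : M 2 2 = s * y ^ 2 + x ^ 2 := by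
    apply mul_left_cancel₀ hσ'
    linear_combination M 2 2 * hσ2 - a22 - s * a00
  have m20 : M 2 0 = -(1 - s) * x * y := by rw [← e20, m02]
  refine ⟨hxy, ?_, ?_, ?_⟩
  · ext i
    fin_cases i <;> simp [Matrix.mulVec, dotProduct, Fin.sum_univ_three, m00, m02, m22, m20, m10, m12]
    · linear_combination y * hxy
    · ring
    · linear_combination -x * hxy
  · ext i
    fin_cases i <;> simp [Matrix.mulVec, dotProduct, Fin.sum_univ_three, m00, m02, m22, m20, m10, m12]
    · linear_combination s * x * hxy
    · linear_combination σ * hxy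
    · linear_combination s * y * hxy
  · ext i
    fin_cases i <;> simp [Matrix.mulVec, dotProduct, Fin.sum_univ_three, hx, hy, hs1]

/-! ### Derivatives along curves -/

section Curves

variable {M E : Type*} [NormedAddCommGroup M] [NormedSpace ℝ M]
  [NormedAddCommGroup E] [NormedSpace ℝ E]

/-- Differentials of charts are computed along curves, which avoids explicit formulas for them. -/
theorem fderiv_apply_eq_of_hasDerivAt {P : M → E} {γ : ℝ → M} {x v : M} {s : ℝ} {d : E}
    (hP : DifferentiableAt ℝ P x) (hγ : HasDerivAt γ v s) (hx : γ s = x)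
    (hd : HasDerivAt (fun s => P (γ s)) d s) : fderiv ℝ P x v = d := by
  subst hx
  exact (hP.hasFDerivAt.comp_hasDerivAt s hγ).unique hd

theorem hasDerivAt_line (x v : M) (s : ℝ) : HasDerivAt (fun s : ℝ => x + s • v) v s := by
  simpa using ((hasDerivAt_id s).smul_const v).const_add x

theorem hasDerivAt_comp_line {P : M → E} {x v : M} (hP : DifferentiableAt ℝ P x) :
    HasDerivAt (fun s : ℝ => P (x + s • v)) (fderiv ℝ P x v) 0 := by
  have h : HasFDerivAt P (fderiv ℝ P x) (x + (0 : ℝ) • v) := by simpa using hP.hasFDerivAt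
  exact h.comp_hasDerivAt 0 (hasDerivAt_line x v 0)

end Curves

theorem UnitAddCircle.coe_eq_coe_iff {x y : ℝ} :
    (x : UnitAddCircle) = y ↔ ∃ m : ℤ, y = x + m := by
  rw [QuotientAddGroup.eq, AddSubgroup.mem_zmultiples_iff]
  refine exists_congr fun m => ?_
  rw [zsmul_one]
  constructor <;> intro h <;> linarith

/-! ### Coverings of an open set by the components of a parameter -/

/-- The pieces lie over the connected components of O. By `hP` the parameter f is a function on the
image of P, so pieces over different components do not meet. -/
theorem exists_disjoint_family {M N : Type*} {f : M → ℝ} {P : M → N} {O : Set ℝ} {U : Set M}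
    {Φ : Set N → Prop} (hO : IsOpen O) (hf : ∀ x ∈ U, f x ∈ O)
    (hP : ∀ x ∈ U, ∀ x' ∈ U, P x = P x' → f x = f x')
    (hΦ : ∀ J ⊆ O, IsOpen J → IsConnected J → Φ (P '' {x ∈ U | f x ∈ J})) :
    ∃ 𝒲 : Set (Set N), (∀ W ∈ 𝒲, Φ W) ∧ 𝒲.PairwiseDisjoint id ∧ ⋃₀ 𝒲 = P '' U := by
  refine ⟨(fun a => P '' {x ∈ U | f x ∈ connectedComponentIn O a}) '' O, ?_, ?_, ?_⟩
  · rintro _ ⟨a, ha, rfl⟩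
    exact hΦ _ (connectedComponentIn_subset _ _) hO.connectedComponentIn
      (isConnected_connectedComponentIn_iff.2 ha)
  · rintro _ ⟨a, ha, rfl⟩ _ ⟨a', ha', rfl⟩ hne
    refine Set.disjoint_left.2 ?_
    rintro _ ⟨x, ⟨hx, hxa⟩, rfl⟩ ⟨x', ⟨hx', hxa'⟩, h⟩
    rw [hP x' hx' x hx h] at hxa'
    apply hne
    simp only
    rw [connectedComponentIn_eq hxa, connectedComponentIn_eq hxa']
  · ext q
    constructor
    · rintro ⟨_, ⟨a, ha, rfl⟩, ⟨x, ⟨hx, -⟩, rfl⟩⟩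
      exact ⟨x, hx, rfl⟩
    · rintro ⟨x, hx, rfl⟩
      exact ⟨_, ⟨f x, hf x hx, rfl⟩, ⟨x, ⟨hx, mem_connectedComponentIn (hf x hx)⟩, rfl⟩⟩

namespace CoupledSystem

variable {n c m : ℕ} (S : CoupledSystem n c m)

theorem coe_eq_coe_iff {q q' : (Fin m → ℝ) × ℝ × ℝ × ℝ} :
    (q : S.Down) = q' ↔ q'.1 = q.1 ∧ q'.2.1 = q.2.1 ∧ q'.2.2.1 - q.2.2.1 ∈ periods S.zAngle ∧
      q'.2.2.2 = q.2.2.2 := by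
  rw [QuotientAddGroup.eq, mem_downPeriods]
  simp only [neg_add_eq_sub, Prod.fst_sub, Prod.snd_sub, sub_eq_zero]

/-- There are action-angle variables on disjoint open sets whose union is dense in the set of the
points over the set `b` of values of `(z, z')`. -/
def IsRIntegrableOver (R : S.Down → S.Down) (p k : ℕ) (b : Set (ℝ × ℝ)) : Prop :=
  ∃ 𝒲 : Set (Set S.Down), (∀ W ∈ 𝒲, IsRIntegrableOn S.reducedField R p k W) ∧
    𝒲.PairwiseDisjoint id ∧
    (∀ q ∈ ⋃₀ 𝒲, ∃ y v, ∃ ζ ∈ b, q = (((y, v, ζ) : (Fin m → ℝ) × ℝ × ℝ × ℝ) : S.Down)) ∧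
    ∀ y v, ∀ ζ ∈ b, (((y, v, ζ) : (Fin m → ℝ) × ℝ × ℝ × ℝ) : S.Down) ∈ closure (⋃₀ 𝒲)

variable {S}

/-- The two families lie over b and b', which by `hd` have no point in common modulo the periods. -/
theorem IsRIntegrableOver.union {R : S.Down → S.Down} {p k : ℕ} {b b' : Set (ℝ × ℝ)}
    (h : S.IsRIntegrableOver R p k b) (h' : S.IsRIntegrableOver R p k b')
    (hd : ∀ ζ ∈ b, ∀ ζ' ∈ b', ¬(ζ'.1 - ζ.1 ∈ periods S.zAngle ∧ ζ'.2 = ζ.2)) :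
    S.IsRIntegrableOver R p k (b ∪ b') := by
  obtain ⟨𝒲, h1, h2, h3, h4⟩ := h
  obtain ⟨𝒲', h1', h2', h3', h4'⟩ := h'
  refine ⟨𝒲 ∪ 𝒲', ?_, ?_, ?_, ?_⟩
  · rintro W (hW | hW)
    exacts [h1 W hW, h1' W hW]
  · refine (Set.pairwiseDisjoint_union).2 ⟨h2, h2', fun W hW W' hW' _ => ?_⟩
    refine Set.disjoint_left.2 fun q hq hq' => ?_
    obtain ⟨y, v, ζ, hζ, rfl⟩ := h3 q ⟨W, hW, hq⟩
    obtain ⟨y', v', ζ', hζ', he⟩ := h3' _ ⟨W', hW', hq'⟩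
    exact hd ζ hζ ζ' hζ' (S.coe_eq_coe_iff.1 he).2.2
  · rw [Set.sUnion_union]
    rintro q (hq | hq)
    · obtain ⟨y, v, ζ, hζ, he⟩ := h3 q hq
      exact ⟨y, v, ζ, Or.inl hζ, he⟩
    · obtain ⟨y, v, ζ, hζ, he⟩ := h3' q hq
      exact ⟨y, v, ζ, Or.inr hζ, he⟩
  · rw [Set.sUnion_union, closure_union]
    rintro y v ζ (hζ | hζ)
    exacts [Or.inl (h4 y v ζ hζ), Or.inr (h4' y v ζ hζ)]

/-- For fixed y, v, z all but finitely many w are admissible, and the complement of a finite set in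
the line is dense. -/
theorem IsRIntegrableOver.isRIntegrable {R : S.Down → S.Down} {p k : ℕ} {b : Set (ℝ × ℝ)}
    (h : S.IsRIntegrableOver R p k b) (hb : ∀ z : ℝ, ∃ s : Set ℝ, s.Finite ∧
      ∀ w ∉ s, ∃ ζ ∈ b, ζ.1 - z ∈ periods S.zAngle ∧ ζ.2 = w) :
    IsRIntegrable S.reducedField R p k := by
  obtain ⟨𝒲, h1, h2, -, h4⟩ := h
  refine ⟨𝒲, h1, h2, fun q => ?_⟩
  obtain ⟨⟨y, v, z, w⟩, rfl⟩ := QuotientAddGroup.mk_surjective q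
  obtain ⟨s, hs, hsw⟩ := hb z
  let g : ℝ → S.Down := fun w => (((y, v, z, w) : (Fin m → ℝ) × ℝ × ℝ × ℝ) : S.Down)
  have hg : Continuous g := continuous_quotient_mk'.comp (by fun_prop)
  have hmaps : Set.MapsTo g sᶜ (closure (⋃₀ 𝒲)) := by
    intro w hw
    obtain ⟨ζ, hζ, h5, h6⟩ := hsw w hw
    have h7 : g w = (((y, v, ζ) : (Fin m → ℝ) × ℝ × ℝ × ℝ) : S.Down) :=
      S.coe_eq_coe_iff.2 ⟨rfl, rfl, h5, h6⟩
    rw [h7]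
    exact h4 y v ζ hζ
  have := map_mem_closure hg (hs.countable.dense_compl ℝ w) hmaps
  rwa [closure_closure] at this

end CoupledSystem

/-! ### Oscillators in one degree of freedom -/

/-- A family of symmetric periodic orbits `t ↦ ζ a t` of the equations `z' = w`, `w' = -V'(z)`,
up to a change of time with the derivative `u`.  The reversing symmetry is
`(z, w) ↦ (e - z, w)`. -/
structure OscillatorChart (b : Bool) (V : ℝ → ℝ) (e : ℝ) (O : Set ℝ) (ζ : ℝ → ℝ → ℝ × ℝ)
    (u : ℝ → ℝ → ℝ) : Prop where
  isOpen : IsOpen O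
  smooth : ∀ a ∈ O, ∀ t, ContDiffAt ℝ ∞ (fun q : ℝ × ℝ => ζ q.1 q.2) (a, t)
  immersion : ∀ a ∈ O, ∀ t, Function.Injective (fderiv ℝ (fun q : ℝ × ℝ => ζ q.1 q.2) (a, t))
  eq_iff : ∀ a ∈ O, ∀ a' ∈ O, ∀ t t',
    ((ζ a' t').1 - (ζ a t).1 ∈ periods b ∧ (ζ a' t').2 = (ζ a t).2) ↔
      a' = a ∧ ∃ k : ℤ, t' = t + k * (2 * Real.pi)
  reflect : ∀ a ∈ O, ∀ t, (ζ a (-t)).1 - (e - (ζ a t).1) ∈ periods b ∧ (ζ a (-t)).2 = (ζ a t).2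
  deriv_fst : ∀ a ∈ O, ∀ t, HasDerivAt (fun t => (ζ a t).1) (u a t * (ζ a t).2) t
  deriv_snd : ∀ a ∈ O, ∀ t, HasDerivAt (fun t => (ζ a t).2) (u a t * -deriv V (ζ a t).1) t
  family : IsAnalyticFamily O u
  periodic : ∀ a ∈ O, Function.Periodic (u a) (2 * Real.pi)
  even : ∀ a ∈ O, ∀ t, u a (-t) = u a t
  pos : ∀ a ∈ O, ∀ t, 0 < a * u a t

/-- The chart is an immersion if the energy is a nondegenerate function of the parameter. -/
theorem immersion_of_energy {V : ℝ → ℝ} {ζ : ℝ → ℝ → ℝ × ℝ} {ε : ℝ → ℝ} {O : Set ℝ} {a t u ε' : ℝ}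
    (hO : IsOpen O) (ha : a ∈ O) (hu : u ≠ 0) (hV : DifferentiableAt ℝ V (ζ a t).1)
    (hζ : DifferentiableAt ℝ (fun q : ℝ × ℝ => ζ q.1 q.2) (a, t))
    (hε : HasDerivAt ε ε' a) (hε' : ε' ≠ 0)
    (he : ∀ a ∈ O, ∀ t, (ζ a t).2 ^ 2 / 2 + V (ζ a t).1 = ε a)
    (h1 : HasDerivAt (fun t => (ζ a t).1) (u * (ζ a t).2) t)
    (h2 : HasDerivAt (fun t => (ζ a t).2) (u * -deriv V (ζ a t).1) t) :
    Function.Injective (fderiv ℝ (fun q : ℝ × ℝ => ζ q.1 q.2) (a, t)) := by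
  set L := fderiv ℝ (fun q : ℝ × ℝ => ζ q.1 q.2) (a, t) with hL
  -- The differential of the energy w²/2 + V takes L v to ε' v.1, by differentiation of `he`.
  have hen : ∀ v : ℝ × ℝ,
      (ζ a t).2 * (L v).2 + deriv V (ζ a t).1 * (L v).1 = ε' * v.1 := by
    intro v
    have hz := hζ.hasFDerivAt
    have hz1 : HasFDerivAt (fun q : ℝ × ℝ => (ζ q.1 q.2).1)
      ((ContinuousLinearMap.fst ℝ ℝ ℝ).comp L) (a, t) := hz.fst
    have hz2 : HasFDerivAt (fun q : ℝ × ℝ => (ζ q.1 q.2).2)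
      ((ContinuousLinearMap.snd ℝ ℝ ℝ).comp L) (a, t) := hz.snd
    have hV' : HasFDerivAt (fun q : ℝ × ℝ => V (ζ q.1 q.2).1)
        (deriv V (ζ a t).1 • ((ContinuousLinearMap.fst ℝ ℝ ℝ).comp L)) (a, t) :=
      HasDerivAt.comp_hasFDerivAt (a, t) (h₂ := V) (f := fun q : ℝ × ℝ => (ζ q.1 q.2).1)
        hV.hasDerivAt hz1
    have hε1 : HasFDerivAt (fun q : ℝ × ℝ => ε q.1) (ε' • ContinuousLinearMap.fst ℝ ℝ ℝ) (a, t) :=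
      HasDerivAt.comp_hasFDerivAt (a, t) (h₂ := ε) (f := fun q : ℝ × ℝ => q.1) hε hasFDerivAt_fst
    have hsum := (((hz2.mul hz2).const_mul (1 / 2 : ℝ)).add hV').congr_of_eventuallyEq
      (f₁ := fun q : ℝ × ℝ => ε q.1) (by
        filter_upwards [(hO.prod isOpen_univ).mem_nhds (Set.mk_mem_prod ha (Set.mem_univ t))]
          with q hq
        rw [← he q.1 hq.1 q.2]
        simp
        ring)
    have := congrArg (fun T : ℝ × ℝ →L[ℝ] ℝ => T v) (hε1.unique hsum)
    simp at this
    rw [this]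
    ring
  have ht : L (0, 1) = (u * (ζ a t).2, u * -deriv V (ζ a t).1) :=
    fderiv_apply_eq_of_hasDerivAt (γ := fun t => (a, t)) hζ
      ((hasDerivAt_const t a).prodMk (hasDerivAt_id t)) rfl (h1.prodMk h2)
  rw [injective_iff_map_eq_zero]
  rintro ⟨x, y⟩ hv
  have h3 := hen (x, y)
  rw [hv] at h3
  simp only [Prod.fst_zero, Prod.snd_zero, mul_zero, add_zero] at h3
  have hx : x = 0 := (mul_eq_zero.1 h3.symm).resolve_left hε'
  subst hx
  have h4 : y • L (0, 1) = 0 := by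
    rw [← map_smul, ← hv]
    simp
  rcases smul_eq_zero.1 h4 with h5 | h5
  · rw [h5]; rfl
  -- If L (0, 1) = 0 the point is an equilibrium, where the differential of the energy vanishes; but
  -- its value on L (1, 0) is ε' ≠ 0.
  · have h6 := hen (1, 0)
    rw [ht, Prod.mk_eq_zero] at h5
    have h7 : (ζ a t).2 = 0 := (mul_eq_zero.1 h5.1).resolve_left hu
    have h8 : deriv V (ζ a t).1 = 0 := by
      simpa using (mul_eq_zero.1 h5.2).resolve_left hu
    rw [h7, h8] at h6
    simp at h6
    exact absurd h6.symm hε'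

namespace OscillatorChart

variable {b : Bool} {V : ℝ → ℝ} {e : ℝ} {O : Set ℝ} {ζ : ℝ → ℝ → ℝ × ℝ} {u : ℝ → ℝ → ℝ}

/-- The period of the orbit with the parameter `a`. -/
noncomputable def period (u : ℝ → ℝ → ℝ) (a : ℝ) : ℝ := ∫ r in (0 : ℝ)..(2 * Real.pi), u a r

/-- The time along the orbit, as a fraction of the period. -/
noncomputable def phase (u : ℝ → ℝ → ℝ) (a t : ℝ) : ℝ := (∫ r in (0 : ℝ)..t, u a r) / period u a

variable (h : OscillatorChart b V e O ζ u)
include h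

theorem rate_ne_zero {a : ℝ} (ha : a ∈ O) (t : ℝ) : u a t ≠ 0 :=
  right_ne_zero_of_mul (h.pos a ha t).ne'

/-- The rate u has the sign of a. For a < 0 the parameter t runs against time and the period is
negative, but the phase still increases with t. -/
theorem mul_period_pos {a : ℝ} (ha : a ∈ O) : 0 < a * period u a := by
  rw [period, ← intervalIntegral.integral_const_mul]
  exact intervalIntegral.intervalIntegral_pos_of_pos
    (((h.family.continuous h.isOpen ha).const_mul a).intervalIntegrable _ _) (h.pos a ha)
    (by positivity)

theorem period_ne_zero {a : ℝ} (ha : a ∈ O) : period u a ≠ 0 :=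
  right_ne_zero_of_mul (h.mul_period_pos ha).ne'

theorem phase_hasDerivAt {a : ℝ} (ha : a ∈ O) (t : ℝ) :
    HasDerivAt (phase u a) (u a t / period u a) t :=
  (h.family.hasDerivAt_integral h.isOpen ha t).div_const _

theorem phase_deriv_pos {a : ℝ} (ha : a ∈ O) (t : ℝ) : 0 < u a t / period u a := by
  have h1 := h.pos a ha t
  have h2 := h.mul_period_pos ha
  have h3 : u a t / period u a = a * u a t / (a * period u a) := by
    rw [mul_div_mul_left _ _ (left_ne_zero_of_mul h1.ne')]
  rw [h3]
  positivity

theorem phase_strictMono {a : ℝ} (ha : a ∈ O) : StrictMono (phase u a) :=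
  strictMono_of_deriv_pos fun t => by
    rw [(h.phase_hasDerivAt ha t).deriv]
    exact h.phase_deriv_pos ha t

theorem phase_contDiffAt {a : ℝ} (ha : a ∈ O) (t : ℝ) :
    ContDiffAt ℝ ∞ (fun q : ℝ × ℝ => phase u q.1 q.2) (a, t) := by
  have h1 := (h.family.integral.analyticAt h.isOpen ha t).contDiffAt (n := ∞)
  have h2 : ContDiffAt ℝ ∞ (fun q : ℝ × ℝ => period u q.1) (a, t) :=
    ContDiffAt.comp (g := fun q : ℝ × ℝ => ∫ r in (0 : ℝ)..q.2, u q.1 r)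
      (f := fun q : ℝ × ℝ => (q.1, 2 * Real.pi)) (a, t)
      (h.family.integral.analyticAt h.isOpen ha (2 * Real.pi)).contDiffAt (by fun_prop)
  exact h1.div h2 (h.period_ne_zero ha)

theorem phase_neg {a : ℝ} (ha : a ∈ O) (t : ℝ) : phase u a (-t) = -phase u a t := by
  have h1 := intervalIntegral.integral_comp_neg (a := 0) (b := t) (u a)
  simp only [h.even a ha, neg_zero] at h1
  rw [phase, phase, h1, intervalIntegral.integral_symm, neg_div]

theorem phase_add_period {a : ℝ} (ha : a ∈ O) (t : ℝ) :
    phase u a (t + 2 * Real.pi) = phase u a t + 1 := by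
  have hc := h.family.continuous h.isOpen ha
  have h1 := (h.periodic a ha).intervalIntegral_add_eq t 0
  rw [zero_add] at h1
  rw [phase, phase, ← intervalIntegral.integral_add_adjacent_intervals
    (hc.intervalIntegrable 0 t) (hc.intervalIntegrable t _), h1, add_div]
  congr 1
  exact div_self (h.period_ne_zero ha)

/-- The phase minus t/(2π) is periodic. -/
theorem phase_add_int_mul {a : ℝ} (ha : a ∈ O) (t : ℝ) (k : ℤ) :
    phase u a (t + k * (2 * Real.pi)) = phase u a t + k := by
  have h1 : Function.Periodic (fun t => phase u a t - t / (2 * Real.pi)) (2 * Real.pi) := by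
    intro t
    simp only [h.phase_add_period ha]
    field_simp
    ring
  have h2 := h1.int_mul k t
  have : (t + k * (2 * Real.pi)) / (2 * Real.pi) = t / (2 * Real.pi) + k := by
    field_simp
  linarith

theorem phase_surjective {a : ℝ} (ha : a ∈ O) : Function.Surjective (phase u a) := by
  have hc : Continuous (phase u a) :=
    continuous_iff_continuousAt.2 fun t => (h.phase_hasDerivAt ha t).continuousAt
  have h0 : phase u a 0 = 0 := by simp [phase]
  have hk : ∀ k : ℤ, phase u a (k * (2 * Real.pi)) = k := fun k => by
    have := h.phase_add_int_mul ha 0 k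
    rwa [zero_add, h0, zero_add] at this
  intro y
  refine mem_range_of_exists_le_of_exists_ge hc ⟨_, (hk ⌊y⌋).le.trans (Int.floor_le y)⟩
    ⟨_, (Int.le_ceil y).trans (hk ⌈y⌉).ge⟩

theorem phase_eq_add_int_iff {a : ℝ} (ha : a ∈ O) {t t' : ℝ} {k : ℤ} :
    phase u a t' = phase u a t + k ↔ t' = t + k * (2 * Real.pi) := by
  rw [← h.phase_add_int_mul ha, (h.phase_strictMono ha).injective.eq_iff]

end OscillatorChart

theorem torusCover_eq_iff {p k : ℕ} {x y : (Fin p → ℝ) × (Fin k → ℝ)} :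
    torusCover p k x = torusCover p k y ↔ x.1 = y.1 ∧ ∀ j, ∃ i : ℤ, y.2 j = x.2 j + i := by
  simp only [torusCover, Prod.mk.injEq, funext_iff, UnitAddCircle.coe_eq_coe_iff]

theorem continuous_vecCons {m : ℕ} :
    Continuous fun x : ℝ × (Fin m → ℝ) => (Matrix.vecCons x.1 x.2 : Fin (m + 1) → ℝ) :=
  Continuous.matrixVecCons continuous_fst continuous_snd

theorem isOpen_vecCons {m : ℕ} {J : Set ℝ} {D : Set (Fin m → ℝ)} (hJ : IsOpen J) (hD : IsOpen D) :
    IsOpen {I : Fin (m + 1) → ℝ | I 0 ∈ J ∧ Matrix.vecTail I ∈ D} :=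
  (hJ.preimage (continuous_apply 0)).inter
    (hD.preimage (continuous_pi fun i => continuous_apply i.succ))

theorem isConnected_vecCons {m : ℕ} {J : Set ℝ} {D : Set (Fin m → ℝ)} (hJ : IsConnected J)
    (hD : IsConnected D) :
    IsConnected {I : Fin (m + 1) → ℝ | I 0 ∈ J ∧ Matrix.vecTail I ∈ D} := by
  convert (hJ.prod hD).image _ continuous_vecCons.continuousOn using 1
  ext I
  constructor
  · rintro ⟨h0, h1⟩
    exact ⟨(I 0, Matrix.vecTail I), ⟨h0, h1⟩, Matrix.cons_head_tail I⟩
  · rintro ⟨x, ⟨h0, h1⟩, rfl⟩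
    exact ⟨h0, h1⟩

namespace OscillatorChart

variable {n c m : ℕ} {e : ℝ} {O : Set ℝ} {ζ : ℝ → ℝ → ℝ × ℝ} {u : ℝ → ℝ → ℝ}

/-- Systems without the variables `y`. -/
theorem isRIntegrableOver {S : CoupledSystem n c 0} (h : OscillatorChart S.zAngle S.V e O ζ u)
    {g : ℝ → ℝ → ℝ} (hg : ∀ a ∈ O, ∀ t, ContDiffAt ℝ ∞ (fun q : ℝ × ℝ => g q.1 q.2) (a, t))
    (hgp : ∀ a ∈ O, Function.Periodic (g a) (2 * Real.pi)) (hge : ∀ a ∈ O, ∀ t, g a (-t) = g a t)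
    (hgd : ∀ a ∈ O, ∀ t, HasDerivAt (g a) (u a t * (S.κ (ζ a t).1 ⬝ᵥ S.f)) t) (σ : Fin 0 → ℝ) :
    S.IsRIntegrableOver (S.reflection σ e) 2 1 {z | ∃ a ∈ O, ∃ t, z = ζ a t} := by
  -- The third coordinate of x is the constant of integration: g is a primitive of κ ⬝ f along the
  -- orbit, so the velocity is this constant plus g.
  let P : (ℝ × ℝ) × ℝ → (Fin 0 → ℝ) × ℝ × ℝ × ℝ := fun x =>
    (0, x.2 + g x.1.1 x.1.2, ζ x.1.1 x.1.2)
  let Q : (ℝ × ℝ) × ℝ → (Fin 2 → ℝ) × (Fin 1 → ℝ) := fun x =>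
    (![x.1.1, x.2], ![phase u x.1.1 x.1.2])
  have hP : ∀ x : (ℝ × ℝ) × ℝ, x.1.1 ∈ O → ContDiffAt ℝ ∞ P x := by
    rintro ⟨⟨a, t⟩, v⟩ hx
    have h1 := (hg a hx t).comp ((a, t), v) contDiffAt_fst
    have h2 := (h.smooth a hx t).comp ((a, t), v) contDiffAt_fst
    exact contDiffAt_const.prodMk ((contDiffAt_snd.add h1).prodMk h2)
  have hQ : ∀ x : (ℝ × ℝ) × ℝ, x.1.1 ∈ O → ContDiffAt ℝ ∞ Q x := by
    rintro ⟨⟨a, t⟩, v⟩ hx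
    have h1 := (h.phase_contDiffAt hx t).comp ((a, t), v) contDiffAt_fst
    refine ContDiffAt.prodMk (contDiffAt_pi.2 fun i => ?_) (contDiffAt_pi.2 fun i => ?_)
    · fin_cases i
      · exact contDiffAt_fst.fst
      · exact contDiffAt_snd
    · fin_cases i
      exact h1
  have hPeq : ∀ x : (ℝ × ℝ) × ℝ, x.1.1 ∈ O → ∀ x' : (ℝ × ℝ) × ℝ, x'.1.1 ∈ O →
      ((P x : S.Down) = P x' ↔
        x'.1.1 = x.1.1 ∧ x'.2 = x.2 ∧ ∃ k : ℤ, x'.1.2 = x.1.2 + k * (2 * Real.pi)) := by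
    rintro ⟨⟨a, t⟩, v⟩ hx ⟨⟨a', t'⟩, v'⟩ hx'
    rw [S.coe_eq_coe_iff]
    simp only [P, true_and]
    rw [h.eq_iff a hx a' hx']
    constructor
    · rintro ⟨hv, rfl, k, rfl⟩
      rw [(hgp a' hx).int_mul k t] at hv
      exact ⟨rfl, add_right_cancel hv, k, rfl⟩
    · rintro ⟨rfl, rfl, k, rfl⟩
      exact ⟨by rw [(hgp a' hx).int_mul k t], rfl, k, rfl⟩
  have key : ∀ J ⊆ O, IsOpen J → IsConnected J → IsRIntegrableOn S.reducedField
      (S.reflection σ e) 2 1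
      ((fun x => (P x : S.Down)) '' {x ∈ {x : (ℝ × ℝ) × ℝ | x.1.1 ∈ O} | x.1.1 ∈ J}) := by
    intro J hJO hJ hJc
    have hfreq : ∀ a ∈ O, (period u a)⁻¹ ≠ 0 := fun a ha => inv_ne_zero (h.period_ne_zero ha)
    refine isRIntegrableOn_of_charts (D := {I | I 0 ∈ J ∧ Matrix.vecTail I ∈ Set.univ})
      (Q := Q) (fun I => ![(period u (I 0))⁻¹]) ?_ ?_ ?_
      (fun x hx => hP x hx.1) ?_ (fun x hx => hQ x hx.1) ?_ ?_ (isOpen_vecCons hJ isOpen_univ)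
      (isConnected_vecCons hJc isConnected_univ) (fun x hx => ⟨hx.2, trivial⟩) ?_ ?_ ?_ ?_
    · exact (h.isOpen.preimage (continuous_fst.comp continuous_fst)).inter
        (hJ.preimage (continuous_fst.comp continuous_fst))
    · simp
    · simp
    · rintro ⟨⟨a, t⟩, v⟩ ⟨hx, -⟩
      rw [injective_iff_map_eq_zero]
      rintro ⟨⟨δa, δt⟩, δv⟩ hv
      have h1 := hasDerivAt_comp_line (v := ((δa, δt), δv)) ((hP _ hx).differentiableAt (by simp))
      rw [hv] at h1
      have h2 : (δa, δt) = (0 : ℝ × ℝ) := by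
        refine (injective_iff_map_eq_zero _).1 (h.immersion a hx t) _ ?_
        exact fderiv_apply_eq_of_hasDerivAt ((h.smooth a hx t).differentiableAt (by simp))
          (hasDerivAt_line (a, t) (δa, δt) 0) (by simp) h1.snd.snd
      obtain ⟨rfl, rfl⟩ := Prod.mk_eq_zero.1 h2
      have h3 : HasDerivAt (fun s : ℝ => v + s * δv + g (a + s * 0) (t + s * 0)) 0 0 :=
        h1.snd.fst
      simp only [mul_zero, add_zero] at h3
      have h4 := h3.unique ((((hasDerivAt_id (0 : ℝ)).mul_const δv).const_add v).add_const (g a t))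
      simp only [one_mul] at h4
      rw [← h4]
      rfl
    · rintro ⟨⟨a, t⟩, v⟩ ⟨hx, -⟩
      rw [injective_iff_map_eq_zero]
      rintro ⟨⟨δa, δt⟩, δv⟩ hv
      have h1 := hasDerivAt_comp_line (v := ((δa, δt), δv)) ((hQ _ hx).differentiableAt (by simp))
      rw [hv] at h1
      have h2 := hasDerivAt_pi.1 h1.fst
      have h3 : δa = 0 := (hasDerivAt_line a δa 0).unique (h2 0)
      have h4 : δv = 0 := (hasDerivAt_line v δv 0).unique (h2 1)
      subst h3 h4
      have h5 : HasDerivAt (fun s : ℝ => phase u a (t + s • δt)) 0 0 := by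
        simpa [Q] using hasDerivAt_pi.1 h1.snd 0
      have h6 : HasDerivAt (phase u a) (u a t / period u a) (t + (0 : ℝ) • δt) := by
        simpa using h.phase_hasDerivAt hx t
      have h6' : HasDerivAt (fun s : ℝ => phase u a (t + s • δt)) (u a t / period u a * δt) 0 :=
        HasDerivAt.comp (h₂ := phase u a) (h := fun s : ℝ => t + s • δt) 0 h6
          (hasDerivAt_line t δt 0)
      have h7 := h5.unique h6'
      have h8 := (mul_eq_zero.1 h7.symm).resolve_left (h.phase_deriv_pos hx t).ne'
      rw [h8]
      rfl
    · rintro ⟨⟨a, t⟩, v⟩ ⟨hx, -⟩ ⟨⟨a', t'⟩, v'⟩ ⟨hx', -⟩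
      rw [hPeq _ hx _ hx', torusCover_eq_iff]
      simp only [Q, Fin.forall_fin_one, Matrix.cons_val_zero]
      constructor
      · rintro ⟨rfl, rfl, k, rfl⟩
        exact ⟨rfl, k, h.phase_add_int_mul hx t k⟩
      · rintro ⟨h1, k, h2⟩
        have h3 : a = a' := congrFun h1 0
        have h4 : v = v' := congrFun h1 1
        subst h3 h4
        exact ⟨rfl, rfl, k, (h.phase_eq_add_int_iff hx).1 h2⟩
    · rintro I ⟨hI, -⟩ θ
      obtain ⟨t, ht⟩ := h.phase_surjective (hJO hI) (θ 0)
      refine ⟨((I 0, t), I 1), ⟨hJO hI, hI⟩, ?_⟩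
      refine Prod.ext ?_ ?_
      · ext i; fin_cases i <;> rfl
      · ext i; fin_cases i; exact ht
    · rintro ⟨⟨a, t⟩, v⟩ ⟨hx, hxJ⟩
      refine ⟨((a, -t), v), ⟨hx, hxJ⟩, ?_, ?_⟩
      · rw [CoupledSystem.reflection_coe, S.coe_eq_coe_iff]
        exact ⟨Subsingleton.elim _ _, by simp [P, CoupledSystem.reflectionLift, hge a hx],
          (h.reflect a hx t).1, (h.reflect a hx t).2⟩
      · refine Prod.ext rfl ?_
        ext i; fin_cases i
        exact h.phase_neg hx t
    · rintro ⟨⟨a, t⟩, v⟩ ⟨hx, -⟩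
      have hu := h.rate_ne_zero hx t
      have hγ : HasDerivAt (fun t : ℝ => ((a, t), v)) ((0, 1), 0) t :=
        ((hasDerivAt_const t a).prodMk (hasDerivAt_id t)).prodMk (hasDerivAt_const t v)
      -- In the chart the flow moves only t, at the speed 1/u, because u is the time per unit of t.
      refine ⟨(u a t)⁻¹ • ((0, 1), 0), ?_, ?_⟩
      · have h1 : HasDerivAt (fun t => P ((a, t), v)) _ t :=
          (hasDerivAt_const t (0 : Fin 0 → ℝ)).prodMk (((hgd a hx t).const_add v).prodMk
            ((h.deriv_fst a hx t).prodMk (h.deriv_snd a hx t)))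
        rw [map_smul, fderiv_apply_eq_of_hasDerivAt ((hP _ hx).differentiableAt (by simp)) hγ rfl h1]
        simp only [CoupledSystem.reducedField_coe, CoupledSystem.reducedLift, P, Prod.smul_mk,
          smul_eq_mul, inv_mul_cancel_left₀ hu]
        refine Prod.ext (Subsingleton.elim _ _) (Prod.ext ?_ rfl)
        simp
      · have h1 : HasDerivAt (fun t => Q ((a, t), v)) (0, ![u a t / period u a]) t := by
          refine HasDerivAt.prodMk (hasDerivAt_const t ![a, v]) (hasDerivAt_pi.2 fun i => ?_)
          fin_cases i
          exact h.phase_hasDerivAt hx t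
        rw [map_smul, fderiv_apply_eq_of_hasDerivAt ((hQ _ hx).differentiableAt (by simp)) hγ rfl h1]
        refine Prod.ext (by simp) ?_
        ext i
        fin_cases i
        simp [Q]
        field_simp
    · intro L hL
      obtain ⟨a, ha⟩ := hJc.nonempty
      have h1 : ![(period u a)⁻¹] ∈ L := hL ⟨![a, 0], ⟨ha, trivial⟩, rfl⟩
      refine eq_top_iff.2 fun w _ => ?_
      have h2 : w = (w 0 * period u a) • ![(period u a)⁻¹] := by
        ext i; fin_cases i
        simp [h.period_ne_zero (hJO ha)]
      rw [h2]
      exact L.smul_mem _ h1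
  obtain ⟨𝒲, h1, h2, h3⟩ := exists_disjoint_family (f := fun x : (ℝ × ℝ) × ℝ => x.1.1)
    (P := fun x => (P x : S.Down)) (U := {x : (ℝ × ℝ) × ℝ | x.1.1 ∈ O}) h.isOpen
    (fun x hx => hx) (fun x hx x' hx' he => ((hPeq x hx x' hx').1 he).1.symm) key
  refine ⟨𝒲, h1, h2, ?_, ?_⟩
  · rw [h3]
    rintro _ ⟨⟨⟨a, t⟩, v⟩, hx, rfl⟩
    exact ⟨_, _, _, ⟨a, hx, t, rfl⟩, rfl⟩
  · rw [h3]
    rintro y v _ ⟨a, ha, t, rfl⟩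
    -- The constant of integration is unrestricted, so every state over these orbits is covered.
    refine subset_closure ⟨((a, t), v - g a t), ha, ?_⟩
    refine S.coe_eq_coe_iff.2 ⟨Subsingleton.elim _ _, by simp [P], ?_, rfl⟩
    simp [P, zero_mem]

end OscillatorChart

/-! ### Oscillators with rotating fibers -/

theorem hasDerivAt_vecCons_line_zero {m : ℕ} {a δa : ℝ} {c δc : Fin m → ℝ}
    (h : HasDerivAt (fun s : ℝ => (Matrix.vecCons (a + s • δa) (c + s • δc) : Fin (m + 1) → ℝ)) 0 0) :
    δa = 0 ∧ δc = 0 := by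
  have h2 := hasDerivAt_pi.1 h
  exact ⟨(hasDerivAt_line a δa 0).unique (h2 0), (hasDerivAt_line c δc 0).unique
    (hasDerivAt_pi.2 fun i => h2 i.succ)⟩

/-- Cramer's rule for the basis x, y. -/
theorem submodule_eq_top_of_pair {L : Submodule ℝ (Fin 2 → ℝ)} {x y : Fin 2 → ℝ} (hx : x ∈ L)
    (hy : y ∈ L) (h : x 0 * y 1 - x 1 * y 0 ≠ 0) : L = ⊤ := by
  refine eq_top_iff.2 fun w _ => ?_
  have h1 : w = ((w 0 * y 1 - w 1 * y 0) / (x 0 * y 1 - x 1 * y 0)) • x +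
      ((x 0 * w 1 - x 1 * w 0) / (x 0 * y 1 - x 1 * y 0)) • y := by
    ext i
    fin_cases i <;> simp <;>
      rw [div_mul_eq_mul_div, div_mul_eq_mul_div, ← add_div, eq_div_iff h] <;> ring
  rw [h1]
  exact L.add_mem (L.smul_mem _ hx) (L.smul_mem _ hy)

/-- Over the orbits `t ↦ ζ a t` of an oscillator chart, with `a ∈ O`, the fibers of the variables
`(y, v)` are parametrized by solutions `t ↦ Ξ a t c ψ` of the reduced equations of motion, where
`ψ` is an angle that turns by `α a` along the orbit.  The set of the values of `c` is `D`. -/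
structure FiberChart {n k m : ℕ} (S : CoupledSystem n k m) (σ : Fin m → ℝ) (O : Set ℝ)
    (ζ : ℝ → ℝ → ℝ × ℝ) (u : ℝ → ℝ → ℝ) (α : ℝ → ℝ) (D : Set (Fin m → ℝ))
    (Ξ : ℝ → ℝ → (Fin m → ℝ) → ℝ → (Fin m → ℝ) × ℝ) : Prop where
  isOpen : IsOpen O
  isOpen_actions : IsOpen D
  isConnected_actions : IsConnected D
  smooth_angle : ∀ a ∈ O, ContDiffAt ℝ ∞ α a
  smooth : ∀ a ∈ O, ∀ t, ∀ c ∈ D, ∀ ψ, ContDiffAt ℝ ∞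
    (fun x : (ℝ × ℝ) × (Fin m → ℝ) × ℝ => Ξ x.1.1 x.1.2 x.2.1 x.2.2) ((a, t), c, ψ)
  immersion : ∀ a ∈ O, ∀ t, ∀ c ∈ D, ∀ ψ δc δψ,
    HasDerivAt (fun s : ℝ => Ξ a t (c + s • δc) (ψ + s • δψ)) 0 0 → δc = 0 ∧ δψ = 0
  eq_iff : ∀ a ∈ O, ∀ t, ∀ c ∈ D, ∀ c' ∈ D, ∀ ψ ψ',
    Ξ a t c ψ = Ξ a t c' ψ' ↔ c' = c ∧ ∃ k : ℤ, ψ' = ψ + k * (2 * Real.pi)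
  periodic : ∀ a ∈ O, ∀ t c ψ, Ξ a (t + 2 * Real.pi) c ψ = Ξ a t c (ψ + α a)
  reflect : ∀ a ∈ O, ∀ t c ψ, Ξ a (-t) c (-ψ) = (σ * (Ξ a t c ψ).1, (Ξ a t c ψ).2)
  deriv : ∀ a ∈ O, ∀ t c ψ, HasDerivAt (fun t => Ξ a t c ψ)
    (u a t • ((Ξ a t c ψ).2 • (S.B *ᵥ S.κ (ζ a t).1),
      S.κ (ζ a t).1 ⬝ᵥ S.f - (S.B *ᵥ S.κ (ζ a t).1) ⬝ᵥ (Ξ a t c ψ).1)) t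
  continuous : ∀ a ∈ O, ∀ t ψ, Continuous fun c => Ξ a t c ψ
  surjective : ∀ a ∈ O, ∀ t ξ, ∃ c ∈ closure D, ∃ ψ, Ξ a t c ψ = ξ

namespace OscillatorChart

variable {n k m : ℕ} {e : ℝ} {O O' : Set ℝ} {ζ : ℝ → ℝ → ℝ × ℝ} {u : ℝ → ℝ → ℝ}
  {S : CoupledSystem n k m} {σ : Fin m → ℝ} {α : ℝ → ℝ} {D : Set (Fin m → ℝ)}
  {Ξ : ℝ → ℝ → (Fin m → ℝ) → ℝ → (Fin m → ℝ) × ℝ}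

theorem fiber_periodic_int (hΞ : FiberChart S σ O' ζ u α D Ξ) {a : ℝ} (ha : a ∈ O') (t : ℝ)
    (c : Fin m → ℝ) (ψ : ℝ) (i : ℤ) :
    Ξ a (t + i * (2 * Real.pi)) c ψ = Ξ a t c (ψ + i * α a) := by
  induction i using Int.induction_on generalizing ψ with
  | zero => simp
  | succ i ih =>
    have h1 : t + ((i + 1 : ℤ) : ℝ) * (2 * Real.pi) =
        t + ((i : ℤ) : ℝ) * (2 * Real.pi) + 2 * Real.pi := by push_cast; ring
    rw [h1, hΞ.periodic a ha, ih]
    congr 1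
    push_cast
    ring
  | pred i ih =>
    have h1 : t + ((-i : ℤ) : ℝ) * (2 * Real.pi) =
        t + ((-i - 1 : ℤ) : ℝ) * (2 * Real.pi) + 2 * Real.pi := by push_cast; ring
    have h2 := ih (ψ - α a)
    rw [h1, hΞ.periodic a ha, sub_add_cancel] at h2
    rw [h2]
    congr 1
    push_cast
    ring

/-- The actions are a and c. One turn along the orbit adds 1 to the phase and takes α from ψ, so ψ +
α · phase is well defined modulo 2π. The frequencies 1/T and α/(2πT) leave every line as soon as α
takes two values. The parameters in O but not in O' are recovered by density. -/
theorem isRIntegrableOver_of_fiberChart (h : OscillatorChart S.zAngle S.V e O ζ u)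
    (hO : O' ⊆ O) (hd : O ⊆ closure O') (hΞ : FiberChart S σ O' ζ u α D Ξ)
    (hα : ∀ J ⊆ O', IsOpen J → IsConnected J → ∃ a ∈ J, ∃ a' ∈ J, α a ≠ α a') :
    S.IsRIntegrableOver (S.reflection σ e) (m + 1) 2 {z | ∃ a ∈ O, ∃ t, z = ζ a t} := by
  let M := (ℝ × ℝ) × (Fin m → ℝ) × ℝ
  let P : M → (Fin m → ℝ) × ℝ × ℝ × ℝ := fun x =>
    ((Ξ x.1.1 x.1.2 x.2.1 x.2.2).1, (Ξ x.1.1 x.1.2 x.2.1 x.2.2).2, ζ x.1.1 x.1.2)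
  let Q : M → (Fin (m + 1) → ℝ) × (Fin 2 → ℝ) := fun x => (Matrix.vecCons x.1.1 x.2.1,
    ![phase u x.1.1 x.1.2, (x.2.2 + α x.1.1 * phase u x.1.1 x.1.2) / (2 * Real.pi)])
  let U : Set M := {x | x.1.1 ∈ O' ∧ x.2.1 ∈ D}
  have hπ : (2 * Real.pi) ≠ 0 := by positivity
  have hP : ∀ x ∈ U, ContDiffAt ℝ ∞ P x := by
    rintro ⟨⟨a, t⟩, c, ψ⟩ ⟨hx, hc⟩
    have h1 := hΞ.smooth a hx t c hc ψ
    have h2 := (h.smooth a (hO hx) t).comp (((a, t), c, ψ) : M) contDiffAt_fst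
    exact h1.fst.prodMk (h1.snd.prodMk h2)
  have hQ : ∀ x ∈ U, ContDiffAt ℝ ∞ Q x := by
    rintro ⟨⟨a, t⟩, c, ψ⟩ ⟨hx, hc⟩
    have h1 := (h.phase_contDiffAt (hO hx) t).comp (((a, t), c, ψ) : M) contDiffAt_fst
    have h2 : ContDiffAt ℝ ∞ (fun x : M => α x.1.1) (((a, t), c, ψ) : M) :=
      (hΞ.smooth_angle a hx).comp (((a, t), c, ψ) : M) contDiffAt_fst.fst
    have h3 : ContDiffAt ℝ ∞ (fun x : M => x.2.1) (((a, t), c, ψ) : M) := contDiffAt_snd.fst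
    refine ContDiffAt.prodMk (contDiffAt_pi.2 fun i => ?_) (contDiffAt_pi.2 fun i => ?_)
    · refine Fin.cases ?_ (fun i => ?_) i
      · exact contDiffAt_fst.fst
      · exact contDiffAt_pi.1 h3 i
    · fin_cases i
      · exact h1
      · exact (contDiffAt_snd.snd.add (h2.mul h1)).div_const _
  -- Here i counts the turns along the orbit and j the turns of the fiber.
  have hPeq : ∀ x ∈ U, ∀ x' ∈ U, ((P x : S.Down) = P x' ↔
        x'.1.1 = x.1.1 ∧ x'.2.1 = x.2.1 ∧ ∃ i j : ℤ, x'.1.2 = x.1.2 + i * (2 * Real.pi) ∧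
          x'.2.2 + i * α x.1.1 = x.2.2 + j * (2 * Real.pi)) := by
    rintro ⟨⟨a, t⟩, c, ψ⟩ ⟨hx, hc⟩ ⟨⟨a', t'⟩, c', ψ'⟩ ⟨hx', hc'⟩
    rw [S.coe_eq_coe_iff]
    simp only [P]
    rw [h.eq_iff a (hO hx) a' (hO hx')]
    constructor
    · rintro ⟨h1, h2, rfl, i, rfl⟩
      have h3 : Ξ a' t c ψ = Ξ a' (t + i * (2 * Real.pi)) c' ψ' := Prod.ext h1.symm h2.symm
      rw [fiber_periodic_int hΞ hx, hΞ.eq_iff a' hx t c hc c' hc'] at h3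
      obtain ⟨rfl, j, h4⟩ := h3
      exact ⟨rfl, rfl, i, j, rfl, h4⟩
    · rintro ⟨rfl, rfl, i, j, rfl, h4⟩
      have h3 : Ξ a' t c' ψ = Ξ a' (t + i * (2 * Real.pi)) c' ψ' := by
        rw [fiber_periodic_int hΞ hx, hΞ.eq_iff a' hx t c' hc c' hc']
        exact ⟨rfl, j, h4⟩
      exact ⟨by rw [h3], by rw [h3], rfl, i, rfl⟩
  have key : ∀ J ⊆ O', IsOpen J → IsConnected J → IsRIntegrableOn S.reducedField
      (S.reflection σ e) (m + 1) 2 ((fun x => (P x : S.Down)) '' {x ∈ U | x.1.1 ∈ J}) := by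
    intro J hJO hJ hJc
    have hc1 : Continuous fun x : M => x.1.1 := continuous_fst.comp continuous_fst
    have hc2 : Continuous fun x : M => x.2.1 := continuous_fst.comp continuous_snd
    refine isRIntegrableOn_of_charts (D := {I | I 0 ∈ J ∧ Matrix.vecTail I ∈ D})
      (Q := Q) (fun I => ![(period u (I 0))⁻¹, α (I 0) / (2 * Real.pi) * (period u (I 0))⁻¹])
      ?_ ?_ ?_
      (fun x hx => hP x hx.1) ?_ (fun x hx => hQ x hx.1) ?_ ?_ (isOpen_vecCons hJ hΞ.isOpen_actions)
      (isConnected_vecCons hJc hΞ.isConnected_actions) (fun x hx => ⟨hx.2, hx.1.2⟩) ?_ ?_ ?_ ?_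
    · exact ((hΞ.isOpen.preimage hc1).inter (hΞ.isOpen_actions.preimage hc2)).inter
        (hJ.preimage hc1)
    · simp [M]; ring
    · simp [M]; ring
    · rintro ⟨⟨a, t⟩, c, ψ⟩ ⟨hxc, -⟩
      obtain ⟨hx, hc⟩ := id hxc
      rw [injective_iff_map_eq_zero]
      rintro ⟨⟨δa, δt⟩, δc, δψ⟩ hv
      have h1 := hasDerivAt_comp_line (v := (((δa, δt), δc, δψ) : M))
        ((hP _ hxc).differentiableAt (by simp))
      rw [hv] at h1
      have h2 : (δa, δt) = (0 : ℝ × ℝ) := by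
        refine (injective_iff_map_eq_zero _).1 (h.immersion a (hO hx) t) _ ?_
        exact fderiv_apply_eq_of_hasDerivAt ((h.smooth a (hO hx) t).differentiableAt (by simp))
          (hasDerivAt_line (a, t) (δa, δt) 0) (by simp) h1.snd.snd
      obtain ⟨rfl, rfl⟩ := Prod.mk_eq_zero.1 h2
      have h3 : HasDerivAt (fun s : ℝ => Ξ (a + s * 0) (t + s * 0) (c + s • δc) (ψ + s • δψ)) 0 0 :=
        h1.fst.prodMk h1.snd.fst
      simp only [mul_zero, add_zero] at h3
      obtain ⟨rfl, rfl⟩ := hΞ.immersion a hx t c hc ψ δc δψ h3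
      rfl
    · rintro ⟨⟨a, t⟩, c, ψ⟩ ⟨hxc, -⟩
      obtain ⟨hx, hc⟩ := id hxc
      rw [injective_iff_map_eq_zero]
      rintro ⟨⟨δa, δt⟩, δc, δψ⟩ hv
      have h1 := hasDerivAt_comp_line (v := (((δa, δt), δc, δψ) : M))
        ((hQ _ hxc).differentiableAt (by simp))
      rw [hv] at h1
      obtain ⟨h3, h4⟩ := hasDerivAt_vecCons_line_zero h1.fst
      subst h3 h4
      have h2 := hasDerivAt_pi.1 h1.snd
      have h5 : HasDerivAt (fun s : ℝ => phase u (a + s * 0) (t + s • δt)) 0 0 := h2 0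
      simp only [mul_zero, add_zero] at h5
      have h6 : HasDerivAt (phase u a) (u a t / period u a) (t + (0 : ℝ) • δt) := by
        simpa using h.phase_hasDerivAt (hO hx) t
      have h6' : HasDerivAt (fun s : ℝ => phase u a (t + s • δt)) (u a t / period u a * δt) 0 :=
        HasDerivAt.comp (h₂ := phase u a) (h := fun s : ℝ => t + s • δt) 0 h6
          (hasDerivAt_line t δt 0)
      have h7 := h5.unique h6'
      have h8 := (mul_eq_zero.1 h7.symm).resolve_left (h.phase_deriv_pos (hO hx) t).ne'
      subst h8
      have h9 : HasDerivAt (fun s : ℝ => (ψ + s • δψ + α (a + s * 0) *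
        phase u (a + s * 0) (t + s * 0)) / (2 * Real.pi)) 0 0 := h2 1
      simp only [mul_zero, add_zero] at h9
      have h10 := h9.unique (((hasDerivAt_line ψ δψ 0).add_const _).div_const _)
      have h11 : δψ = 0 := (div_eq_zero_iff.1 h10.symm).resolve_right hπ
      subst h11
      rfl
    · rintro ⟨⟨a, t⟩, c, ψ⟩ ⟨hx, -⟩ ⟨⟨a', t'⟩, c', ψ'⟩ ⟨hx', -⟩
      rw [hPeq _ hx _ hx', torusCover_eq_iff]
      have ha := hO hx.1
      simp only [Q, Fin.forall_fin_two, Matrix.cons_val_zero, Matrix.cons_val_one,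
        Matrix.vecCons_inj]
      constructor
      · rintro ⟨rfl, rfl, i, j, rfl, h4⟩
        refine ⟨⟨rfl, rfl⟩, ⟨i, h.phase_add_int_mul ha t i⟩, j, ?_⟩
        rw [h.phase_add_int_mul ha t i]
        field_simp
        linear_combination h4
      · rintro ⟨⟨rfl, rfl⟩, ⟨i, h2⟩, j, h4⟩
        refine ⟨rfl, rfl, i, j, (h.phase_eq_add_int_iff ha).1 h2, ?_⟩
        rw [h2] at h4
        field_simp at h4
        linear_combination h4
    · rintro I ⟨hI, hID⟩ θ
      obtain ⟨t, ht⟩ := h.phase_surjective (hO (hJO hI)) (θ 0)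
      refine ⟨((I 0, t), Matrix.vecTail I, 2 * Real.pi * θ 1 - α (I 0) * θ 0),
        ⟨⟨hJO hI, hID⟩, hI⟩, ?_⟩
      refine Prod.ext (Matrix.cons_head_tail I) ?_
      ext i; fin_cases i
      · exact ht
      · simp [Q, ht]
    · rintro ⟨⟨a, t⟩, c, ψ⟩ ⟨⟨hx, hc⟩, hxJ⟩
      refine ⟨((a, -t), c, -ψ), ⟨⟨hx, hc⟩, hxJ⟩, ?_, ?_⟩
      · rw [CoupledSystem.reflection_coe, S.coe_eq_coe_iff]
        have h1 := hΞ.reflect a hx t c ψ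
        have h2 := congrArg Prod.fst h1
        have h3 := congrArg Prod.snd h1
        exact ⟨h2, h3, (h.reflect a (hO hx) t).1, (h.reflect a (hO hx) t).2⟩
      · refine Prod.ext rfl ?_
        have h1 := h.phase_neg (hO hx) t
        ext i; fin_cases i
        · exact h1
        · simp [Q, h1]
          ring
    · rintro ⟨⟨a, t⟩, c, ψ⟩ ⟨hx, -⟩
      have hu := h.rate_ne_zero (hO hx.1) t
      have hγ : HasDerivAt (fun t : ℝ => (((a, t), c, ψ) : M)) ((0, 1), 0) t :=
        ((hasDerivAt_const t a).prodMk (hasDerivAt_id t)).prodMk (hasDerivAt_const t (c, ψ))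
      refine ⟨(u a t)⁻¹ • ((0, 1), 0), ?_, ?_⟩
      · have h0 := hΞ.deriv a hx.1 t c ψ
        have h1 : HasDerivAt (fun t => P ((a, t), c, ψ)) _ t :=
          (hasFDerivAt_fst.comp_hasDerivAt t h0).prodMk ((hasFDerivAt_snd.comp_hasDerivAt t h0).prodMk
            ((h.deriv_fst a (hO hx.1) t).prodMk (h.deriv_snd a (hO hx.1) t)))
        rw [map_smul, fderiv_apply_eq_of_hasDerivAt ((hP _ hx).differentiableAt (by simp)) hγ rfl h1]
        simp [CoupledSystem.reducedField_coe, CoupledSystem.reducedLift, P, Prod.smul_mk,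
          smul_eq_mul, inv_mul_cancel_left₀ hu, inv_smul_smul₀ hu]
      · have hp := h.phase_hasDerivAt (hO hx.1) t
        have h1 : HasDerivAt (fun t => Q ((a, t), c, ψ)) (0, ![u a t / period u a,
            α a * (u a t / period u a) / (2 * Real.pi)]) t := by
          refine HasDerivAt.prodMk (hasDerivAt_const t (Matrix.vecCons a c))
            (hasDerivAt_pi.2 fun i => ?_)
          fin_cases i
          · exact hp
          · exact ((hp.const_mul (α a)).const_add ψ).div_const _
        rw [map_smul, fderiv_apply_eq_of_hasDerivAt ((hQ _ hx).differentiableAt (by simp)) hγ rfl h1]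
        refine Prod.ext (by simp) ?_
        ext i
        fin_cases i
        · simp [Q]
          field_simp
        · simp [Q]
          field_simp
    · intro L hL
      obtain ⟨a, ha, a', ha', hne⟩ := hα J hJO hJ hJc
      obtain ⟨c, hc⟩ := hΞ.isConnected_actions.nonempty
      have hf := fun a (ha : a ∈ J) => hL ⟨Matrix.vecCons a c, ⟨ha, hc⟩, rfl⟩
      -- The determinant of the two frequency vectors is (α a' − α a)/(2πTT'), where T and T' are
      -- the periods.
      refine submodule_eq_top_of_pair (hf a ha) (hf a' ha') ?_
      have h1 := h.period_ne_zero (hO (hJO ha))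
      have h2 := h.period_ne_zero (hO (hJO ha'))
      have h3 : α a' - α a ≠ 0 := sub_ne_zero.2 hne.symm
      simp
      field_simp
      exact fun h4 => h3 (by rw [h4, mul_zero])
  obtain ⟨𝒲, h1, h2, h3⟩ := exists_disjoint_family (f := fun x : M => x.1.1)
    (P := fun x => (P x : S.Down)) (U := U) hΞ.isOpen
    (fun x hx => hx.1) (fun x hx x' hx' he => ((hPeq x hx x' hx').1 he).1.symm) key
  refine ⟨𝒲, h1, h2, ?_, ?_⟩
  · rw [h3]
    rintro _ ⟨⟨⟨a, t⟩, c, ψ⟩, hx, rfl⟩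
    exact ⟨_, _, _, ⟨a, hO hx.1, t, rfl⟩, rfl⟩
  · rw [h3]
    rintro y v _ ⟨a, ha, t, rfl⟩
    have hmk : Continuous fun q : (Fin m → ℝ) × ℝ × ℝ × ℝ => (q : S.Down) := continuous_quotient_mk'
    -- Density has two steps: over a parameter in O' the fiber is reached with c in the closure of
    -- D, and the remaining parameters are limits of those in O'.
    have hgood : ∀ a ∈ O', (((y, v, ζ a t) : (Fin m → ℝ) × ℝ × ℝ × ℝ) : S.Down) ∈
        closure ((fun x => (P x : S.Down)) '' U) := by
      intro a ha
      obtain ⟨c, hc, ψ, hξ⟩ := hΞ.surjective a ha t (y, v)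
      have hcont : Continuous fun c => (P ((a, t), c, ψ) : S.Down) :=
        hmk.comp ((hΞ.continuous a ha t ψ).fst.prodMk
          ((hΞ.continuous a ha t ψ).snd.prodMk (continuous_const (y := ζ a t))))
      have hcl := map_mem_closure hcont hc (t := (fun x => (P x : S.Down)) '' U)
        fun c hc => ⟨((a, t), c, ψ), ⟨ha, hc⟩, rfl⟩
      simpa only [P, hξ] using hcl
    have hcont : ContinuousAt (fun a => (((y, v, ζ a t) : (Fin m → ℝ) × ℝ × ℝ × ℝ) : S.Down)) a := by
      refine hmk.continuousAt.comp ?_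
      refine continuousAt_const.prodMk (continuousAt_const.prodMk ?_)
      exact ContinuousAt.comp (g := fun q : ℝ × ℝ => ζ q.1 q.2) (f := fun a : ℝ => (a, t))
        (h.smooth a ha t).continuousAt (Continuous.prodMk_left t).continuousAt
    have := hcont.continuousWithinAt.mem_closure (hd ha) hgood
    rwa [closure_closure] at this

end OscillatorChart

/-! ### Polar coordinates -/

theorem polar_eq_iff {r r' ψ ψ' : ℝ} (hr : 0 < r) (hr' : 0 < r') :
    (r * Real.cos ψ = r' * Real.cos ψ' ∧ r * Real.sin ψ = r' * Real.sin ψ') ↔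
      r' = r ∧ ∃ k : ℤ, ψ' = ψ + k * (2 * Real.pi) := by
  constructor
  · rintro ⟨h1, h2⟩
    have h3 : r' = r := by
      have e1 := Real.sin_sq_add_cos_sq ψ
      have e2 := Real.sin_sq_add_cos_sq ψ'
      have h4 : r' ^ 2 = r ^ 2 := by
        linear_combination -r' ^ 2 * e2 + r ^ 2 * e1 -
          (r * Real.cos ψ + r' * Real.cos ψ') * h1 - (r * Real.sin ψ + r' * Real.sin ψ') * h2
      exact (pow_left_inj₀ hr'.le hr.le two_ne_zero).1 h4
    subst h3
    have h4 := (Real.Angle.cos_sin_inj (mul_left_cancel₀ hr.ne' h1) (mul_left_cancel₀ hr.ne' h2))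
    obtain ⟨k, hk⟩ := Real.Angle.angle_eq_iff_two_pi_dvd_sub.1 h4
    exact ⟨rfl, -k, by push_cast; linarith⟩
  · rintro ⟨rfl, k, rfl⟩
    rw [Real.cos_add_int_mul_two_pi, Real.sin_add_int_mul_two_pi]
    exact ⟨rfl, rfl⟩

theorem exists_polar (x y : ℝ) : ∃ r ψ : ℝ, 0 ≤ r ∧ r * Real.cos ψ = x ∧ r * Real.sin ψ = y :=
  ⟨‖(⟨x, y⟩ : ℂ)‖, Complex.arg ⟨x, y⟩, norm_nonneg _, Complex.norm_mul_cos_arg ⟨x, y⟩,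
    Complex.norm_mul_sin_arg ⟨x, y⟩⟩

theorem polar_immersion {r ψ δr δψ : ℝ} (hr : r ≠ 0)
    (h1 : HasDerivAt (fun s : ℝ => (r + s • δr) * Real.cos (ψ + s • δψ)) 0 0)
    (h2 : HasDerivAt (fun s : ℝ => (r + s • δr) * Real.sin (ψ + s • δψ)) 0 0) :
    δr = 0 ∧ δψ = 0 := by
  have e1 := h1.unique ((hasDerivAt_line r δr 0).mul (hasDerivAt_line ψ δψ 0).cos)
  have e2 := h2.unique ((hasDerivAt_line r δr 0).mul (hasDerivAt_line ψ δψ 0).sin)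
  simp only [zero_smul, add_zero] at e1 e2
  have e := Real.sin_sq_add_cos_sq ψ
  constructor
  · linear_combination -Real.cos ψ * e1 - Real.sin ψ * e2 - δr * e
  · apply mul_left_cancel₀ hr
    linear_combination Real.sin ψ * e1 - Real.cos ψ * e2 - r * δψ * e

/-! ### Analytic functions -/

/-- By the identity theorem, constancy on J would spread to all of 𝒜. -/
theorem AnalyticOnNhd.exists_ne_of_isOpen {f : ℝ → ℝ} {𝒜 J : Set ℝ} (hf : AnalyticOnNhd ℝ f 𝒜)
    (h𝒜 : IsPreconnected 𝒜) (hne : ∃ a ∈ 𝒜, ∃ a' ∈ 𝒜, f a ≠ f a') (hJ : IsOpen J)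
    (hJ𝒜 : J ⊆ 𝒜) (hJn : J.Nonempty) : ∃ a ∈ J, ∃ a' ∈ J, f a ≠ f a' := by
  by_contra! hJc
  obtain ⟨a₀, ha₀⟩ := hJn
  have h1 := hf.eqOn_of_preconnected_of_eventuallyEq
    (analyticOnNhd_const (v := f a₀)) h𝒜 (hJ𝒜 ha₀)
    (by filter_upwards [hJ.mem_nhds ha₀] with a ha using hJc a ha a₀ ha₀)
  obtain ⟨a, ha, a', ha', h⟩ := hne
  exact h ((h1 ha).trans (h1 ha').symm)

theorem IsAnalyticFamily.analyticOnNhd {𝒜 : Set ℝ} {u : ℝ → ℝ → ℝ} (hu : IsAnalyticFamily 𝒜 u)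
    (h𝒜 : IsOpen 𝒜) (t : ℝ) : AnalyticOnNhd ℝ (fun a => u a t) 𝒜 := fun a ha =>
  AnalyticAt.comp (g := fun p : ℝ × ℝ => u p.1 p.2) (f := fun a : ℝ => (a, t))
    (hu.analyticAt h𝒜 ha t) (by fun_prop)

theorem closure_setOf_apply_pos {m : ℕ} (i : Fin m) {c : Fin m → ℝ} (hc : 0 ≤ c i) :
    c ∈ closure {c : Fin m → ℝ | 0 < c i} := by
  have h1 := (isOpenMap_eval (X := fun _ : Fin m => ℝ) i).preimage_closure_eq_closure_preimage
    (continuous_apply i) (Set.Ioi (0 : ℝ))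
  rw [closure_Ioi] at h1
  have h2 : c ∈ closure (Function.eval i ⁻¹' Set.Ioi (0 : ℝ)) := h1 ▸ hc
  exact h2

theorem isConnected_setOf_apply_pos {m : ℕ} (i : Fin m) :
    IsConnected {c : Fin m → ℝ | 0 < c i} := by
  have h : Convex ℝ {c : Fin m → ℝ | 0 < c i} :=
    (convex_Ioi (0 : ℝ)).is_linear_preimage (LinearMap.proj (R := ℝ) (φ := fun _ => ℝ) i).isLinear
  exact ⟨⟨fun _ => 1, one_pos (α := ℝ)⟩, h.isPreconnected⟩

/-! ### The fibers of the continuously variable transmissions -/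

/-- The splitting of `ℝ³` into the variables `(y, v)`. -/
def toFiber (ξ : Fin 3 → ℝ) : (Fin 2 → ℝ) × ℝ := (![ξ 0, ξ 1], ξ 2)

theorem toFiber_injective : Function.Injective toFiber := by
  intro ξ η h
  have h1 := congrArg Prod.fst h
  have h2 := congrArg Prod.snd h
  ext i
  fin_cases i
  exacts [congrFun h1 0, congrFun h1 1, h2]

/-- Cylindrical coordinates around the axis `(y, 0, -x)`. -/
noncomputable def cylindrical (x y : ℝ) (c : Fin 2 → ℝ) (ψ : ℝ) : Fin 3 → ℝ :=
  ![c 0 * y + c 1 * Real.cos ψ * x, c 1 * Real.sin ψ, c 1 * Real.cos ψ * y - c 0 * x]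

/-- The vectors (y, 0, −x), (x, 0, y), (0, 1, 0) are orthonormal, and the components in this frame
recover c 0 and the point with polar coordinates c 1, ψ. -/
theorem cylindrical_coords {x y : ℝ} (h : x ^ 2 + y ^ 2 = 1) (c : Fin 2 → ℝ) (ψ : ℝ) :
    y * cylindrical x y c ψ 0 - x * cylindrical x y c ψ 2 = c 0 ∧
      x * cylindrical x y c ψ 0 + y * cylindrical x y c ψ 2 = c 1 * Real.cos ψ ∧
      cylindrical x y c ψ 1 = c 1 * Real.sin ψ := by
  refine ⟨?_, ?_, rfl⟩ <;> simp [cylindrical]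
  · linear_combination c 0 * h
  · linear_combination c 1 * Real.cos ψ * h

theorem cylindrical_eq_iff {x y : ℝ} (h : x ^ 2 + y ^ 2 = 1) {c c' : Fin 2 → ℝ} (hc : 0 < c 1)
    (hc' : 0 < c' 1) {ψ ψ' : ℝ} : cylindrical x y c ψ = cylindrical x y c' ψ' ↔
      c' = c ∧ ∃ k : ℤ, ψ' = ψ + k * (2 * Real.pi) := by
  constructor
  · intro he
    obtain ⟨h1, h2, h3⟩ := cylindrical_coords h c ψ
    obtain ⟨h1', h2', h3'⟩ := cylindrical_coords h c' ψ'
    rw [he] at h1 h2 h3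
    obtain ⟨h4, h5⟩ := (polar_eq_iff hc hc').1 ⟨h2.symm.trans h2', h3.symm.trans h3'⟩
    refine ⟨?_, h5⟩
    ext i; fin_cases i
    exacts [h1'.symm.trans h1, h4]
  · rintro ⟨rfl, k, rfl⟩
    simp only [cylindrical, Real.cos_add_int_mul_two_pi, Real.sin_add_int_mul_two_pi]

theorem cylindrical_surjective {x y : ℝ} (h : x ^ 2 + y ^ 2 = 1) (η : Fin 3 → ℝ) :
    ∃ c : Fin 2 → ℝ, 0 ≤ c 1 ∧ ∃ ψ, cylindrical x y c ψ = η := by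
  obtain ⟨r, ψ, hr, h1, h2⟩ := exists_polar (x * η 0 + y * η 2) (η 1)
  refine ⟨![y * η 0 - x * η 2, r], hr, ψ, ?_⟩
  ext i; fin_cases i <;> simp [cylindrical, h1, h2]
  · linear_combination η 0 * h
  · linear_combination η 2 * h

theorem cylindrical_immersion {x y : ℝ} (h : x ^ 2 + y ^ 2 = 1) {c δc : Fin 2 → ℝ} (hc : 0 < c 1)
    {ψ δψ : ℝ}
    (hd : ∀ i, HasDerivAt (fun s : ℝ => cylindrical x y (c + s • δc) (ψ + s • δψ) i) 0 0) :
    δc = 0 ∧ δψ = 0 := by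
  have hk := fun s : ℝ => cylindrical_coords h (c + s • δc) (ψ + s • δψ)
  have h0 := ((hd 0).const_mul y).sub ((hd 2).const_mul x)
  have h1 := ((hd 0).const_mul x).add ((hd 2).const_mul y)
  have h2 := hd 1
  simp only [mul_zero, sub_zero, add_zero] at h0 h1
  have h0' : HasDerivAt (fun s : ℝ => c 0 + s • δc 0) 0 0 :=
    h0.congr_of_eventuallyEq (Filter.Eventually.of_forall fun s => (hk s).1.symm)
  have h1' : HasDerivAt (fun s : ℝ => (c 1 + s • δc 1) * Real.cos (ψ + s • δψ)) 0 0 :=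
    h1.congr_of_eventuallyEq (Filter.Eventually.of_forall fun s => (hk s).2.1.symm)
  have h2' : HasDerivAt (fun s : ℝ => (c 1 + s • δc 1) * Real.sin (ψ + s • δψ)) 0 0 :=
    h2.congr_of_eventuallyEq (Filter.Eventually.of_forall fun s => (hk s).2.2.symm)
  obtain ⟨h3, h4⟩ := polar_immersion hc.ne' h1' h2'
  refine ⟨?_, h4⟩
  ext i; fin_cases i
  exacts [(hasDerivAt_line (c 0) (δc 0) 0).unique h0', h3]

/-- The hypotheses say that M fixes the axis (y, 0, −x) and turns the plane of (x, 0, y) and (0, 1,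
0) by α. -/
theorem mulVec_cylindrical {M : Matrix (Fin 3) (Fin 3) ℝ} {σ x y s α : ℝ}
    (hσ : σ = Real.sin α) (hs : s = Real.cos α)
    (h0 : M *ᵥ ![y, 0, -x] = ![y, 0, -x]) (h1 : M *ᵥ ![x, 0, y] = ![s * x, σ, s * y])
    (h2 : M *ᵥ ![0, 1, 0] = ![-σ * x, s, -σ * y]) (c : Fin 2 → ℝ) (ψ : ℝ) :
    M *ᵥ cylindrical x y c ψ = cylindrical x y c (ψ + α) := by
  have h : cylindrical x y c ψ = c 0 • ![y, 0, -x] + (c 1 * Real.cos ψ) • ![x, 0, y] +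
      (c 1 * Real.sin ψ) • ![0, 1, 0] := by
    ext i; fin_cases i <;> simp [cylindrical] ; ring
  rw [h, Matrix.mulVec_add, Matrix.mulVec_add, Matrix.mulVec_smul, Matrix.mulVec_smul,
    Matrix.mulVec_smul, h0, h1, h2, hσ, hs]
  ext i; fin_cases i <;> simp [cylindrical, Real.cos_add, Real.sin_add] <;> ring

/-- The reflection fixes the axis and (x, 0, y) and reverses (0, 1, 0), which changes the sign of ψ.
-/
theorem secondReflection_mulVec_cylindrical (x y : ℝ) (c : Fin 2 → ℝ) (ψ : ℝ) :
    secondReflection *ᵥ cylindrical x y c (-ψ) = cylindrical x y c ψ := by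
  ext i; fin_cases i <;> simp [cylindrical, secondReflection, Matrix.mulVec, dotProduct,
    Fin.sum_univ_three]

theorem toFiber_secondReflection_mulVec (ξ : Fin 3 → ℝ) :
    toFiber (secondReflection *ᵥ ξ) = (![1, -1] * (toFiber ξ).1, (toFiber ξ).2) := by
  refine Prod.ext ?_ ?_
  · ext i; fin_cases i <;> simp [toFiber, secondReflection, Matrix.mulVec, dotProduct,
      Fin.sum_univ_three]
  · simp [toFiber, secondReflection, Matrix.mulVec, dotProduct, Fin.sum_univ_three]

theorem hasDerivAt_toFiber {ξ : ℝ → Fin 3 → ℝ} {ξ' : Fin 3 → ℝ} {t : ℝ} :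
    HasDerivAt (fun t => toFiber (ξ t)) (toFiber ξ') t ↔
      ∀ i, HasDerivAt (fun t => ξ t i) (ξ' i) t := by
  constructor
  · intro h i
    have h1 := hasDerivAt_pi.1 (hasFDerivAt_fst.comp_hasDerivAt t h)
    have h2 := hasFDerivAt_snd.comp_hasDerivAt t h
    fin_cases i
    exacts [h1 0, h1 1, h2]
  · intro h
    refine HasDerivAt.prodMk (hasDerivAt_pi.2 fun i => ?_) (h 2)
    fin_cases i
    exacts [h 0, h 1]

namespace IsRollingCocycle

variable {𝒜 O : Set ℝ} {p₁ p₂ : ℝ → ℝ → ℝ} {X : ℝ → ℝ → Matrix (Fin 3) (Fin 3) ℝ}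

theorem monodromy_sq_le_one (hX : IsRollingCocycle 𝒜 p₁ p₂ X) {a : ℝ} (ha : a ∈ 𝒜) :
    X a (2 * Real.pi) 0 1 ^ 2 + X a (2 * Real.pi) 2 1 ^ 2 = 1 - X a (2 * Real.pi) 1 1 ^ 2 := by
  have h1 := congrFun (congrFun (hX.transpose_mul_self ha (2 * Real.pi)) 1) 1
  simp only [Matrix.mul_apply, Matrix.transpose_apply, Fin.sum_univ_three,
    Matrix.one_apply_eq] at h1
  linarith

/-- The fundamental solution carries cylindrical coordinates around the axis of the monodromy along
the orbit, and each period turns them by α. The condition M₁₁² < 1 keeps α strictly between 0 and π,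
where the axis and the arccosine are smooth functions of a. -/
theorem exists_fiberChart (hX : IsRollingCocycle 𝒜 p₁ p₂ X) (h𝒜 : IsOpen 𝒜) (hO : IsOpen O)
    (hO𝒜 : O ⊆ 𝒜) {S : CoupledSystem 2 1 2} (hB : ∀ x, S.B *ᵥ x = x) (hf : S.f = 0)
    {ζ : ℝ → ℝ → ℝ × ℝ} {u : ℝ → ℝ → ℝ}
    (hp₁ : ∀ a ∈ O, ∀ t, p₁ a t = u a t * S.κ (ζ a t).1 0)
    (hp₂ : ∀ a ∈ O, ∀ t, p₂ a t = u a t * S.κ (ζ a t).1 1)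
    (h₁ : ∀ a ∈ O, Function.Periodic (p₁ a) (2 * Real.pi))
    (h₂ : ∀ a ∈ O, Function.Periodic (p₂ a) (2 * Real.pi))
    (h₁' : ∀ a ∈ O, ∀ t, p₁ a (-t) = -p₁ a t) (h₂' : ∀ a ∈ O, ∀ t, p₂ a (-t) = p₂ a t) :
    ∃ Ξ, FiberChart S ![1, -1] {a ∈ O | X a (2 * Real.pi) 1 1 ^ 2 < 1} ζ u
      (fun a => Real.arccos (X a (2 * Real.pi) 1 1)) {c | 0 < c 1} Ξ := by
  let M : ℝ → Matrix (Fin 3) (Fin 3) ℝ := fun a => X a (2 * Real.pi)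
  -- σ is sin α, as α is an arccosine. The entries M 0 1 = −σ x and M 2 1 = −σ y then give x and y,
  -- hence the axis.
  let σ : ℝ → ℝ := fun a => √(1 - M a 1 1 ^ 2)
  let x : ℝ → ℝ := fun a => -(M a 0 1 / σ a)
  let y : ℝ → ℝ := fun a => -(M a 2 1 / σ a)
  let Ξ : ℝ → ℝ → (Fin 2 → ℝ) → ℝ → (Fin 2 → ℝ) × ℝ := fun a t c ψ =>
    toFiber (X a t *ᵥ cylindrical (x a) (y a) c ψ)
  have hM : ∀ i j, ∀ a ∈ 𝒜, ContDiffAt ℝ ∞ (fun a => M a i j) a := fun i j a ha =>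
    ((hX.family i j).analyticOnNhd h𝒜 _ a ha).contDiffAt
  have hσpos : ∀ a, M a 1 1 ^ 2 < 1 → 0 < σ a := fun a ha => Real.sqrt_pos.2 (sub_pos.2 ha)
  have hσ : ∀ a ∈ O, M a 1 1 ^ 2 < 1 → ContDiffAt ℝ ∞ σ a := fun a ha h =>
    (contDiffAt_const.sub ((hM 1 1 a (hO𝒜 ha)).pow 2)).sqrt (sub_pos.2 h).ne'
  have hx : ∀ a ∈ O, M a 1 1 ^ 2 < 1 → ContDiffAt ℝ ∞ x a := fun a ha h =>
    ((hM 0 1 a (hO𝒜 ha)).div (hσ a ha h) (hσpos a h).ne').neg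
  have hy : ∀ a ∈ O, M a 1 1 ^ 2 < 1 → ContDiffAt ℝ ∞ y a := fun a ha h =>
    ((hM 2 1 a (hO𝒜 ha)).div (hσ a ha h) (hσpos a h).ne').neg
  have hframe : ∀ a ∈ O, M a 1 1 ^ 2 < 1 → x a ^ 2 + y a ^ 2 = 1 ∧
      ∀ c ψ, M a *ᵥ cylindrical (x a) (y a) c ψ =
        cylindrical (x a) (y a) c (ψ + Real.arccos (M a 1 1)) := by
    intro a ha h
    have h0 := (hσpos a h).ne'
    have ha' := hO𝒜 ha
    obtain ⟨h1, h2, h3, h4⟩ := rotation_frame (hX.transpose_mul_self ha' _)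
      (hX.det_eq_one h𝒜 ha' _) (hX.transpose_monodromy ha' (h₁ a ha) (h₂ a ha) (h₁' a ha) (h₂' a ha))
      h0 (Real.sq_sqrt (sub_pos.2 h).le) (x := x a) (y := y a)
      (by simp only [x, M]; field_simp) (by simp only [y, M]; field_simp)
    have h5 := abs_lt.1 ((sq_lt_one_iff_abs_lt_one _).1 h)
    exact ⟨h1, mulVec_cylindrical (Real.sin_arccos _).symm
      (Real.cos_arccos h5.1.le h5.2.le).symm h2 h3 h4⟩
  have hinv : ∀ a ∈ O, ∀ t η, (X a t)ᵀ *ᵥ (X a t *ᵥ η) = η := fun a ha t η => by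
    rw [Matrix.mulVec_mulVec, hX.transpose_mul_self (hO𝒜 ha), Matrix.one_mulVec]
  have hinv' : ∀ a ∈ O, ∀ t η, X a t *ᵥ ((X a t)ᵀ *ᵥ η) = η := fun a ha t η => by
    rw [Matrix.mulVec_mulVec, mul_eq_one_comm.1 (hX.transpose_mul_self (hO𝒜 ha) t),
      Matrix.one_mulVec]
  refine ⟨Ξ, ?_, ?_, isConnected_setOf_apply_pos 1, ?_, ?_, ?_, ?_, ?_, ?_, ?_, ?_, ?_⟩
  · rw [isOpen_iff_mem_nhds]
    rintro a ⟨ha, h⟩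
    filter_upwards [hO.mem_nhds ha, ((hM 1 1 a (hO𝒜 ha)).continuousAt.pow 2).eventually_lt
      continuousAt_const h] with b hb hb' using ⟨hb, hb'⟩
  · exact isOpen_Ioi.preimage (continuous_apply 1)
  · rintro a ⟨ha, h⟩
    have h5 := abs_lt.1 ((sq_lt_one_iff_abs_lt_one _).1 h)
    exact ContDiffAt.comp (g := Real.arccos) (f := fun a => M a 1 1) a
      (Real.contDiffAt_arccos h5.1.ne' h5.2.ne) (hM 1 1 a (hO𝒜 ha))
  · rintro a ⟨ha, h⟩ t c - ψ
    have hXs : ∀ i j, ContDiffAt ℝ ∞ (fun z : (ℝ × ℝ) × (Fin 2 → ℝ) × ℝ => X z.1.1 z.1.2 i j)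
        ((a, t), c, ψ) := fun i j =>
      (((hX.family i j).analyticAt h𝒜 (hO𝒜 ha) t).contDiffAt (n := ∞)).comp
        (((a, t), c, ψ) : (ℝ × ℝ) × (Fin 2 → ℝ) × ℝ) contDiffAt_fst
    have hxs : ContDiffAt ℝ ∞ (fun z : (ℝ × ℝ) × (Fin 2 → ℝ) × ℝ => x z.1.1) ((a, t), c, ψ) :=
      ContDiffAt.comp (g := x) (f := fun z : (ℝ × ℝ) × (Fin 2 → ℝ) × ℝ => z.1.1) _
        (hx a ha h) contDiffAt_fst.fst
    have hys : ContDiffAt ℝ ∞ (fun z : (ℝ × ℝ) × (Fin 2 → ℝ) × ℝ => y z.1.1) ((a, t), c, ψ) :=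
      ContDiffAt.comp (g := y) (f := fun z : (ℝ × ℝ) × (Fin 2 → ℝ) × ℝ => z.1.1) _
        (hy a ha h) contDiffAt_fst.fst
    have hcs : ∀ i, ContDiffAt ℝ ∞ (fun z : (ℝ × ℝ) × (Fin 2 → ℝ) × ℝ => z.2.1 i)
        ((a, t), c, ψ) := contDiffAt_pi.1 contDiffAt_snd.fst
    have hcos : ContDiffAt ℝ ∞ (fun z : (ℝ × ℝ) × (Fin 2 → ℝ) × ℝ => Real.cos z.2.2)
        ((a, t), c, ψ) := contDiffAt_snd.snd.cos
    have hsin : ContDiffAt ℝ ∞ (fun z : (ℝ × ℝ) × (Fin 2 → ℝ) × ℝ => Real.sin z.2.2)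
        ((a, t), c, ψ) := contDiffAt_snd.snd.sin
    have hrow : ∀ i, ContDiffAt ℝ ∞ (fun z : (ℝ × ℝ) × (Fin 2 → ℝ) × ℝ =>
        (X z.1.1 z.1.2 *ᵥ cylindrical (x z.1.1) (y z.1.1) z.2.1 z.2.2) i) ((a, t), c, ψ) := by
      intro i
      simp only [Matrix.mulVec, dotProduct, Fin.sum_univ_three]
      refine (((hXs i 0).mul ?_).add ((hXs i 1).mul ?_)).add ((hXs i 2).mul ?_)
      · exact ((hcs 0).mul hys).add (((hcs 1).mul hcos).mul hxs)
      · exact (hcs 1).mul hsin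
      · exact (((hcs 1).mul hcos).mul hys).sub ((hcs 0).mul hxs)
    refine ContDiffAt.prodMk (contDiffAt_pi.2 fun i => ?_) (hrow 2)
    fin_cases i
    exacts [hrow 0, hrow 1]
  · rintro a ⟨ha, h⟩ t c hc ψ δc δψ hd
    refine cylindrical_immersion (ψ := ψ) (hframe a ha h).1 hc fun i => ?_
    have h0 : toFiber 0 = 0 := by
      refine Prod.ext ?_ rfl
      ext i; fin_cases i <;> rfl
    have h1 := hasDerivAt_toFiber.1 (h0.symm ▸ hd)
    have h2 : HasDerivAt (fun s : ℝ => ∑ j, X a t j i *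
        (X a t *ᵥ cylindrical (x a) (y a) (c + s • δc) (ψ + s • δψ)) j)
        (∑ j, X a t j i * (0 : Fin 3 → ℝ) j) 0 := HasDerivAt.fun_sum fun j _ => (h1 j).const_mul _
    simp only [Pi.zero_apply, mul_zero, Finset.sum_const_zero] at h2
    refine h2.congr_of_eventuallyEq (Filter.Eventually.of_forall fun s => ?_)
    exact (congrFun (hinv a ha t _) i).symm
  · rintro a ⟨ha, h⟩ t c hc c' hc' ψ ψ'
    rw [← cylindrical_eq_iff (hframe a ha h).1 hc hc']
    refine ⟨fun he => ?_, fun he => by simp only [Ξ, he]⟩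
    have h1 := toFiber_injective he
    rw [← hinv a ha t (cylindrical _ _ c ψ), h1, hinv a ha]
  · rintro a ⟨ha, h⟩ t c ψ
    simp only [Ξ]
    rw [hX.periodic (hO𝒜 ha) (h₁ a ha) (h₂ a ha), ← Matrix.mulVec_mulVec, (hframe a ha h).2]
  · rintro a ⟨ha, h⟩ t c ψ
    simp only [Ξ]
    rw [← toFiber_secondReflection_mulVec]
    have h1 := hX.reflect (hO𝒜 ha) (h₁' a ha) (h₂' a ha) t
    have h2 : X a (-t) = secondReflection * (X a t * secondReflection) := by
      rw [← h1, ← Matrix.mul_assoc, secondReflection_mul_self, Matrix.one_mul]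
    rw [h2, ← Matrix.mulVec_mulVec, ← Matrix.mulVec_mulVec, secondReflection_mulVec_cylindrical]
  · rintro a ⟨ha, h⟩ t c ψ
    set η := cylindrical (x a) (y a) c ψ with hη
    have h1 : HasDerivAt (fun t => toFiber (X a t *ᵥ η))
        (toFiber (rollingMatrix (p₁ a t) (p₂ a t) *ᵥ (X a t *ᵥ η))) t := by
      refine hasDerivAt_toFiber.2 fun i => ?_
      rw [Matrix.mulVec_mulVec]
      have h2 : HasDerivAt (fun t => ∑ j, X a t i j * η j)
          (∑ j, (rollingMatrix (p₁ a t) (p₂ a t) * X a t) i j * η j) t :=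
        HasDerivAt.fun_sum fun j _ => (hX.deriv a (hO𝒜 ha) t i j).mul_const _
      exact h2
    refine h1.congr_deriv ?_
    simp only [Ξ, ← hη]
    generalize X a t *ᵥ η = ξ
    rw [hB, hf, hp₁ a ha, hp₂ a ha]
    refine Prod.ext ?_ ?_
    · ext i
      fin_cases i <;> simp [toFiber, rollingMatrix, Matrix.mulVec, dotProduct, Fin.sum_univ_three]
        <;> ring
    · simp [toFiber, rollingMatrix, Matrix.mulVec, dotProduct, Fin.sum_univ_three]
      ring
  · rintro a ⟨ha, h⟩ t ψ
    simp only [Ξ, toFiber, cylindrical, Matrix.mulVec, dotProduct, Fin.sum_univ_three]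
    refine Continuous.prodMk (continuous_pi fun i => ?_) ?_
    · fin_cases i <;> simp <;> fun_prop
    · simp
      fun_prop
  · rintro a ⟨ha, h⟩ t ⟨η, v⟩
    obtain ⟨c, hc, ψ, hψ⟩ := cylindrical_surjective (hframe a ha h).1
      ((X a t)ᵀ *ᵥ ![η 0, η 1, v])
    refine ⟨c, closure_setOf_apply_pos 1 hc, ψ, ?_⟩
    simp only [Ξ, hψ, hinv' a ha]
    refine Prod.ext ?_ rfl
    ext i; fin_cases i <;> rfl

/-- Integrability over the orbits of an oscillator chart, if the rotation along the orbits is not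
constant. -/
theorem isRIntegrableOver (hX : IsRollingCocycle 𝒜 p₁ p₂ X) (h𝒜 : IsOpen 𝒜)
    (h𝒜c : IsPreconnected 𝒜) (hO𝒜 : O ⊆ 𝒜) {S : CoupledSystem 2 1 2} (hB : ∀ x, S.B *ᵥ x = x)
    (hf : S.f = 0) {e : ℝ} {ζ : ℝ → ℝ → ℝ × ℝ} {u : ℝ → ℝ → ℝ}
    (h : OscillatorChart S.zAngle S.V e O ζ u)
    (hp₁ : ∀ a ∈ O, ∀ t, p₁ a t = u a t * S.κ (ζ a t).1 0)
    (hp₂ : ∀ a ∈ O, ∀ t, p₂ a t = u a t * S.κ (ζ a t).1 1)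
    (h₁ : ∀ a ∈ O, Function.Periodic (p₁ a) (2 * Real.pi))
    (h₂ : ∀ a ∈ O, Function.Periodic (p₂ a) (2 * Real.pi))
    (h₁' : ∀ a ∈ O, ∀ t, p₁ a (-t) = -p₁ a t) (h₂' : ∀ a ∈ O, ∀ t, p₂ a (-t) = p₂ a t)
    (hone : ∃ a ∈ 𝒜, X a (2 * Real.pi) 1 1 = 1) (hne : ∃ a ∈ 𝒜, X a (2 * Real.pi) 1 1 ≠ 1) :
    S.IsRIntegrableOver (S.reflection ![1, -1] e) 3 2 {z | ∃ a ∈ O, ∃ t, z = ζ a t} := by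
  obtain ⟨Ξ, hΞ⟩ := hX.exists_fiberChart h𝒜 h.isOpen hO𝒜 hB hf hp₁ hp₂ h₁ h₂ h₁' h₂'
  have hs : AnalyticOnNhd ℝ (fun a => X a (2 * Real.pi) 1 1) 𝒜 :=
    (hX.family 1 1).analyticOnNhd h𝒜 _
  obtain ⟨a₀, ha₀, h0⟩ := hone
  obtain ⟨a₁, ha₁, h1⟩ := hne
  -- If the square were always 1, the entry would be constant on the connected set 𝒜, but it is 1 at
  -- a₀ and not at a₁.
  have hsq : ∃ a ∈ 𝒜, X a (2 * Real.pi) 1 1 ^ 2 ≠ 1 := by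
    by_contra! hc
    rcases h𝒜c.eq_one_or_eq_neg_one_of_sq_eq hs.continuousOn (fun a ha => by simpa using hc a ha)
      with h2 | h2
    · exact h1 (h2 ha₁)
    · have := h2 ha₀
      simp [h0] at this
      norm_num at this
  obtain ⟨a₂, ha₂, h2⟩ := hsq
  refine h.isRIntegrableOver_of_fiberChart (fun a ha => ha.1) ?_ hΞ ?_
  · intro a ha
    rw [mem_closure_iff]
    intro V hV haV
    -- The square takes two distinct values near a. Both are at most 1, so one is less than 1.
    obtain ⟨b, hb, b', hb', hbb⟩ := (hs.pow 2).exists_ne_of_isOpen h𝒜c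
      ⟨a₀, ha₀, a₂, ha₂, by simpa [h0] using h2.symm⟩ (hV.inter h.isOpen)
      (fun x hx => hO𝒜 hx.2) ⟨a, haV, ha⟩
    have hle : ∀ x ∈ 𝒜, X x (2 * Real.pi) 1 1 ^ 2 ≤ 1 := fun x hx => by
      have := hX.monodromy_sq_le_one hx
      nlinarith [sq_nonneg (X x (2 * Real.pi) 0 1), sq_nonneg (X x (2 * Real.pi) 2 1)]
    by_cases hlt : X b (2 * Real.pi) 1 1 ^ 2 < 1
    · exact ⟨b, hb.1, hb.2, hlt⟩
    · refine ⟨b', hb'.1, hb'.2, lt_of_le_of_ne (hle b' (hO𝒜 hb'.2)) fun he => hbb ?_⟩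
      exact (le_antisymm (hle b (hO𝒜 hb.2)) (not_lt.1 hlt)).trans he.symm
  · intro J hJ hJo hJc
    obtain ⟨b, hb, b', hb', hbb⟩ := hs.exists_ne_of_isOpen h𝒜c
      ⟨a₀, ha₀, a₁, ha₁, by rw [h0]; exact h1.symm⟩ hJo (fun x hx => hO𝒜 (hJ hx).1) hJc.nonempty
    have hI : ∀ x ∈ J, X x (2 * Real.pi) 1 1 ∈ Set.Icc (-1 : ℝ) 1 := fun x hx => by
      have h5 := abs_lt.1 ((sq_lt_one_iff_abs_lt_one _).1 (hJ hx).2)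
      exact ⟨h5.1.le, h5.2.le⟩
    exact ⟨b, hb, b', hb', fun he => hbb (Real.arccos_injOn (hI b hb) (hI b' hb') he)⟩

end IsRollingCocycle

/-! ### The oscillator charts of the examples -/

theorem IsAnalyticFamily.sq {𝒜 : Set ℝ} {u : ℝ → ℝ → ℝ} (hu : IsAnalyticFamily 𝒜 u) :
    IsAnalyticFamily 𝒜 fun a t => u a t ^ 2 :=
  (hu.mul hu).congr fun _ _ _ => (pow_two _).symm

theorem IsAnalyticFamily.inv_sqrt_one_add_sq {𝒜 : Set ℝ} {u : ℝ → ℝ → ℝ}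
    (hu : IsAnalyticFamily 𝒜 u) : IsAnalyticFamily 𝒜 fun a t => (√(1 + u a t ^ 2))⁻¹ :=
  (((IsAnalyticFamily.of_param analyticOnNhd_const).add hu.sq).sqrt
    fun _ _ _ => by positivity).inv fun _ _ _ => by positivity

theorem IsAnalyticFamily.mul_sin (𝒜 : Set ℝ) :
    IsAnalyticFamily 𝒜 fun a t : ℝ => a * Real.sin t :=
  (IsAnalyticFamily.of_param analyticOnNhd_id).mul (IsAnalyticFamily.sin 𝒜)

theorem mem_periods_true {x : ℝ} : x ∈ periods true ↔ ∃ k : ℤ, x = k * (2 * Real.pi) := by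
  simp only [periods, AddSubgroup.mem_zmultiples_iff, zsmul_eq_mul, eq_comm]

theorem mem_periods_false {x : ℝ} : x ∈ periods false ↔ x = 0 := Iff.rfl

theorem oscillatorChart_harmonic : OscillatorChart false (fun z => z ^ 2 / 2) 0 (Set.Ioi 0)
    (fun a t => (a * Real.sin t, a * Real.cos t)) fun _ _ => 1 := by
  have h1 : ∀ a t : ℝ, HasDerivAt (fun t => a * Real.sin t) (1 * (a * Real.cos t)) t := fun a t => by
    simpa using (Real.hasDerivAt_sin t).const_mul a
  have hV : ∀ z : ℝ, HasDerivAt (fun z : ℝ => z ^ 2 / 2) z z := fun z => by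
    simpa using ((hasDerivAt_id z).pow 2).div_const 2
  have h2 : ∀ a t : ℝ, HasDerivAt (fun t => a * Real.cos t)
      (1 * -deriv (fun z : ℝ => z ^ 2 / 2) (a * Real.sin t)) t := fun a t => by
    simpa [(hV _).deriv] using (Real.hasDerivAt_cos t).const_mul a
  have hs : ContDiff ℝ ∞ fun q : ℝ × ℝ => (q.1 * Real.sin q.2, q.1 * Real.cos q.2) := by fun_prop
  refine ⟨isOpen_Ioi, fun a _ t => hs.contDiffAt, fun a ha t => ?_, fun a ha a' ha' t t' => ?_,
    fun a _ t => ?_, fun a _ t => h1 a t, fun a _ t => h2 a t,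
    IsAnalyticFamily.of_param analyticOnNhd_const, fun a _ t => rfl, fun a _ t => rfl,
    fun a ha t => by simpa using ha⟩
  · refine immersion_of_energy (ζ := fun a t => (a * Real.sin t, a * Real.cos t))
      (ε := fun a => a ^ 2 / 2) isOpen_Ioi ha one_ne_zero
      (hV _).differentiableAt (hs.differentiable (by simp) _) (hV a) (ne_of_gt ha) (fun a _ t => ?_)
      (h1 a t) (h2 a t)
    linear_combination a ^ 2 / 2 * Real.sin_sq_add_cos_sq t
  · rw [mem_periods_false, sub_eq_zero, ← polar_eq_iff ha ha', eq_comm, and_comm,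
      eq_comm (a := a' * Real.cos t')]
  · simp

/-- The parameter a is the velocity, of either sign, and t is z − d, so that z ↦ 2d − z becomes t ↦
−t. -/
theorem oscillatorChart_free {d e : ℝ} (he : e = 2 * d) :
    OscillatorChart true (fun _ => 0) e {0}ᶜ (fun a t => (t + d, a)) fun a _ => a⁻¹ := by
  have h1 : ∀ a ∈ ({0}ᶜ : Set ℝ), ∀ t : ℝ, HasDerivAt (fun t => t + d) (a⁻¹ * a) t :=
    fun a ha t => by
      rw [inv_mul_cancel₀ ha]
      exact (hasDerivAt_id t).add_const d
  have h2 : ∀ a t : ℝ, HasDerivAt (fun _ : ℝ => a) (a⁻¹ * -deriv (fun _ : ℝ => (0 : ℝ)) (t + d)) t :=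
    fun a t => by simpa using hasDerivAt_const t a
  have hs : ContDiff ℝ ∞ fun q : ℝ × ℝ => (q.2 + d, q.1) := by fun_prop
  have hV : ∀ z : ℝ, HasDerivAt (fun z : ℝ => z ^ 2 / 2) z z := fun z => by
    simpa using ((hasDerivAt_id z).pow 2).div_const 2
  refine ⟨isOpen_compl_singleton, fun a _ t => hs.contDiffAt, fun a ha t => ?_,
    fun a ha a' ha' t t' => ?_, fun a _ t => ?_, h1, fun a _ t => h2 a t,
    IsAnalyticFamily.of_param fun a ha => analyticAt_id.inv ha, fun a _ t => rfl,
    fun a _ t => rfl, fun a ha t => by rw [mul_inv_cancel₀ ha]; exact one_pos⟩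
  · exact immersion_of_energy (V := fun _ => 0) (ζ := fun a t => (t + d, a)) (ε := fun a => a ^ 2 / 2) isOpen_compl_singleton ha
      (inv_ne_zero ha) (by fun_prop) (hs.differentiable (by simp) _) (hV a) ha
      (fun a _ t => by simp) (h1 a ha t) (h2 a t)
  · rw [mem_periods_true, and_comm]
    refine and_congr Iff.rfl (exists_congr fun k => ?_)
    constructor <;> intro h <;> linarith
  · refine ⟨?_, rfl⟩
    rw [he, show -t + d - (2 * d - (t + d)) = 0 by ring]
    exact zero_mem _

theorem half_mul_sin_sq_lt_one {a : ℝ} (ha : a ∈ Set.Ioo (-2 : ℝ) 2) (t : ℝ) :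
    0 < 1 - (a / 2 * Real.sin t) ^ 2 := by
  have h1 : (a / 2) ^ 2 < 1 := by
    rw [sq_lt_one_iff_abs_lt_one, abs_lt]
    constructor <;> linarith [ha.1, ha.2]
  have h2 := Real.sin_sq_le_one t
  rw [mul_pow]
  nlinarith [sq_nonneg (a / 2), sq_nonneg (Real.sin t)]

theorem hasDerivAt_cos_sub (d z : ℝ) :
    HasDerivAt (fun z => Real.cos (z - d)) (-Real.sin (z - d)) z := by
  simpa using ((hasDerivAt_id z).sub_const d).cos

/-- The oscillations of the pendulum. -/
theorem oscillatorChart_oscillation {d e : ℝ} (he : e = 2 * d) :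
    OscillatorChart true (fun z => Real.cos (z - d)) e (Set.Ioo 0 2)
      (fun a t => (2 * Real.arcsin (a / 2 * Real.sin t) + Real.pi + d, a * Real.cos t))
      fun a t => (√(1 - (a / 2 * Real.sin t) ^ 2))⁻¹ := by
  -- The potential has a minimum at d + π. At energy a²/2 − 1 its conservation reads w² + 4 sin²((z
  -- − d − π)/2) = a², and t is the polar angle on this circle.
  have hO : ∀ a ∈ Set.Ioo (0 : ℝ) 2, a ∈ Set.Ioo (-2 : ℝ) 2 := fun a ha => ⟨by linarith [ha.1], ha.2⟩
  have hlt : ∀ a ∈ Set.Ioo (0 : ℝ) 2, ∀ t, -1 < a / 2 * Real.sin t ∧ a / 2 * Real.sin t < 1 := by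
    intro a ha t
    have := half_mul_sin_sq_lt_one (hO a ha) t
    exact abs_lt.1 ((sq_lt_one_iff_abs_lt_one _).1 (by linarith))
  have hr : ∀ a ∈ Set.Ioo (0 : ℝ) 2, ∀ t, √(1 - (a / 2 * Real.sin t) ^ 2) ≠ 0 := fun a ha t =>
    (Real.sqrt_pos.2 (half_mul_sin_sq_lt_one (hO a ha) t)).ne'
  have h1 : ∀ a ∈ Set.Ioo (0 : ℝ) 2, ∀ t, HasDerivAt
      (fun t => 2 * Real.arcsin (a / 2 * Real.sin t) + Real.pi + d)
      ((√(1 - (a / 2 * Real.sin t) ^ 2))⁻¹ * (a * Real.cos t)) t := by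
    intro a ha t
    have h := ((((Real.hasDerivAt_arcsin (hlt a ha t).1.ne' (hlt a ha t).2.ne).comp t
      ((Real.hasDerivAt_sin t).const_mul (a / 2))).const_mul 2).add_const Real.pi).add_const d
    refine h.congr_deriv ?_
    rw [one_div]
    ring
  have hz : ∀ a ∈ Set.Ioo (0 : ℝ) 2, ∀ t,
      Real.sin (2 * Real.arcsin (a / 2 * Real.sin t) + Real.pi + d - d) =
        -(a * Real.sin t * √(1 - (a / 2 * Real.sin t) ^ 2)) ∧
      Real.cos (2 * Real.arcsin (a / 2 * Real.sin t) + Real.pi + d - d) =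
        2 * (a / 2 * Real.sin t) ^ 2 - 1 := by
    intro a ha t
    have hs := Real.sin_arcsin (hlt a ha t).1.le (hlt a ha t).2.le
    rw [add_sub_cancel_right, Real.sin_add_pi, Real.cos_add_pi, Real.sin_two_mul, Real.cos_two_mul,
      Real.cos_sq', Real.cos_arcsin, hs]
    constructor <;> ring
  have h2 : ∀ a ∈ Set.Ioo (0 : ℝ) 2, ∀ t, HasDerivAt (fun t => a * Real.cos t)
      ((√(1 - (a / 2 * Real.sin t) ^ 2))⁻¹ * -deriv (fun z => Real.cos (z - d))
        (2 * Real.arcsin (a / 2 * Real.sin t) + Real.pi + d)) t := by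
    intro a ha t
    refine ((Real.hasDerivAt_cos t).const_mul a).congr_deriv ?_
    rw [(hasDerivAt_cos_sub d _).deriv, (hz a ha t).1]
    have := hr a ha t
    generalize √(1 - (a / 2 * Real.sin t) ^ 2) = ρ at *
    field_simp
  have hs : ∀ a ∈ Set.Ioo (0 : ℝ) 2, ∀ t, ContDiffAt ℝ ∞ (fun q : ℝ × ℝ =>
      (2 * Real.arcsin (q.1 / 2 * Real.sin q.2) + Real.pi + d, q.1 * Real.cos q.2)) (a, t) := by
    intro a ha t
    have h3 : ContDiffAt ℝ ∞ (fun q : ℝ × ℝ => Real.arcsin (q.1 / 2 * Real.sin q.2)) (a, t) :=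
      ContDiffAt.comp (g := Real.arcsin) (f := fun q : ℝ × ℝ => q.1 / 2 * Real.sin q.2) (a, t)
        (Real.contDiffAt_arcsin (hlt a ha t).1.ne' (hlt a ha t).2.ne) (by fun_prop)
    fun_prop
  refine ⟨isOpen_Ioo, hs, fun a ha t => ?_, fun a ha a' ha' t t' => ?_, fun a _ t => ?_, h1, h2,
    ?_, fun a _ t => ?_, fun a _ t => ?_, fun a ha t => ?_⟩
  · refine immersion_of_energy (V := fun z => Real.cos (z - d))
      (ζ := fun a t => (2 * Real.arcsin (a / 2 * Real.sin t) + Real.pi + d, a * Real.cos t))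
      (ε := fun a => a ^ 2 / 2 - 1)
      (ε' := a) isOpen_Ioo ha
      (inv_ne_zero (hr a ha t)) (hasDerivAt_cos_sub d _).differentiableAt
      ((hs a ha t).differentiableAt (by simp)) ?_ ha.1.ne' (fun a ha t => ?_) (h1 a ha t) (h2 a ha t)
    · simpa using (((hasDerivAt_id a).pow 2).div_const 2).sub_const 1
    · simp only [(hz a ha t).2]
      linear_combination a ^ 2 / 2 * Real.sin_sq_add_cos_sq t
  · rw [mem_periods_true, ← polar_eq_iff ha.1 ha'.1, eq_comm, and_comm]
    refine and_congr_right fun _ => ⟨?_, fun h => ⟨0, ?_⟩⟩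
    -- Both positions are within π of d + π, so they differ by less than a period and k = 0.
    · rintro ⟨k, hk⟩
      have hpi := Real.pi_pos
      have b1 := Real.neg_pi_div_two_lt_arcsin.2 (hlt a ha t).1
      have b2 := Real.arcsin_lt_pi_div_two.2 (hlt a ha t).2
      have b1' := Real.neg_pi_div_two_lt_arcsin.2 (hlt a' ha' t').1
      have b2' := Real.arcsin_lt_pi_div_two.2 (hlt a' ha' t').2
      have k1 : (k : ℝ) < 1 := by
        by_contra! hc
        nlinarith
      have k2 : (-1 : ℝ) < k := by
        by_contra! hc
        nlinarith
      have k0 : k = 0 := by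
        have k1' : k < 1 := by exact_mod_cast k1
        have k2' : -1 < k := by exact_mod_cast k2
        omega
      rw [k0] at hk
      have h4 : Real.arcsin (a / 2 * Real.sin t) = Real.arcsin (a' / 2 * Real.sin t') := by
        push_cast at hk
        linarith
      have h5 := Real.injOn_arcsin ⟨(hlt a ha t).1.le, (hlt a ha t).2.le⟩
        ⟨(hlt a' ha' t').1.le, (hlt a' ha' t').2.le⟩ h4
      linarith
    · have h5 : a' / 2 * Real.sin t' = a / 2 * Real.sin t := by linarith
      simp [h5]
  -- The center d + π and its mirror image d − π differ by one period.
  · refine ⟨mem_periods_true.2 ⟨1, ?_⟩, by simp⟩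
    simp only [Real.sin_neg, mul_neg, Real.arcsin_neg, he]
    push_cast
    ring
  · have h3 : IsAnalyticFamily (Set.Ioo (0 : ℝ) 2)
        fun a t => -1 * (1 / 2 * (a * Real.sin t)) ^ 2 :=
      (IsAnalyticFamily.of_param analyticOnNhd_const).mul
        ((IsAnalyticFamily.of_param analyticOnNhd_const).mul (IsAnalyticFamily.mul_sin _)).sq
    have h4 := ((IsAnalyticFamily.of_param (analyticOnNhd_const (v := (1 : ℝ)))).add h3).congr
      (v := fun a t => 1 - (a / 2 * Real.sin t) ^ 2) fun a _ t => by ring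
    exact (h4.sqrt fun a ha t => half_mul_sin_sq_lt_one (hO a ha) t).inv hr
  · simp
  · simp
  · have := Real.sqrt_pos.2 (half_mul_sin_sq_lt_one (hO a ha) t)
    have := ha.1
    positivity

/-- The squares of these parameters are less than `1 / 2`. -/
def rotationParameters : Set ℝ := Set.Ioo (-√(1 / 2)) √(1 / 2)

theorem mem_rotationParameters {a : ℝ} : a ∈ rotationParameters ↔ 2 * a ^ 2 < 1 := by
  rw [rotationParameters, Set.mem_Ioo, ← abs_lt, Real.lt_sqrt (abs_nonneg a), sq_abs]
  constructor <;> intro h <;> linarith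

theorem rotation_radicand_pos {a : ℝ} (ha : a ∈ rotationParameters) (t : ℝ) :
    0 < 1 - 2 * a ^ 2 * Real.cos t := by
  have h1 := mem_rotationParameters.1 ha
  have h2 := Real.cos_le_one t
  nlinarith [sq_nonneg a]

theorem isAnalyticFamily_rotation :
    IsAnalyticFamily rotationParameters fun a t => (√(1 - 2 * a ^ 2 * Real.cos t))⁻¹ := by
  have h3 : IsAnalyticFamily rotationParameters fun a t => -2 * a ^ 2 * Real.cos t :=
    (IsAnalyticFamily.of_param (f := fun a => -2 * a ^ 2) fun a _ => by fun_prop).mul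
      (IsAnalyticFamily.cos _)
  have h4 := ((IsAnalyticFamily.of_param (analyticOnNhd_const (v := (1 : ℝ)))).add h3).congr
    (v := fun a t => 1 - 2 * a ^ 2 * Real.cos t) fun a _ t => by ring
  exact (h4.sqrt fun a ha t => rotation_radicand_pos ha t).inv fun a ha t =>
    (Real.sqrt_pos.2 (rotation_radicand_pos ha t)).ne'

/-- The rotations of the pendulum. -/
theorem oscillatorChart_rotation {d e : ℝ} (he : e = 2 * d) :
    OscillatorChart true (fun z => Real.cos (z - d)) e (rotationParameters \ {0})
      (fun a t => (t + d, √(1 - 2 * a ^ 2 * Real.cos t) / a))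
      fun a t => a * (√(1 - 2 * a ^ 2 * Real.cos t))⁻¹ := by
  -- The energy is 1/(2a²), which exceeds the maximum 1 of the potential precisely when 2a² < 1. The
  -- sign of a is the direction of rotation, and a → 0 means infinite speed.
  have hopen : IsOpen (rotationParameters \ {0}) := isOpen_Ioo.sdiff isClosed_singleton
  have hp : ∀ a ∈ rotationParameters \ {0}, ∀ t, 0 < √(1 - 2 * a ^ 2 * Real.cos t) :=
    fun a ha t => Real.sqrt_pos.2 (rotation_radicand_pos ha.1 t)
  have ha0 : ∀ a ∈ rotationParameters \ {0}, a ≠ 0 := fun a ha => ha.2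
  have h1 : ∀ a ∈ rotationParameters \ {0}, ∀ t, HasDerivAt (fun t => t + d)
      (a * (√(1 - 2 * a ^ 2 * Real.cos t))⁻¹ * (√(1 - 2 * a ^ 2 * Real.cos t) / a)) t := by
    intro a ha t
    have h2 := hp a ha t
    have h3 := ha0 a ha
    refine ((hasDerivAt_id t).add_const d).congr_deriv ?_
    generalize √(1 - 2 * a ^ 2 * Real.cos t) = ρ at *
    field_simp
  have h2 : ∀ a ∈ rotationParameters \ {0}, ∀ t,
      HasDerivAt (fun t => √(1 - 2 * a ^ 2 * Real.cos t) / a)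
        (a * (√(1 - 2 * a ^ 2 * Real.cos t))⁻¹ *
          -deriv (fun z => Real.cos (z - d)) (t + d)) t := by
    intro a ha t
    have h4 := hp a ha t
    have h3 := ha0 a ha
    have h5 := ((((Real.hasDerivAt_cos t).const_mul (2 * a ^ 2)).const_sub 1).sqrt
      (rotation_radicand_pos ha.1 t).ne').div_const a
    refine h5.congr_deriv ?_
    rw [(hasDerivAt_cos_sub d _).deriv, add_sub_cancel_right]
    field_simp
  have hs : ∀ a ∈ rotationParameters \ {0}, ∀ t, ContDiffAt ℝ ∞ (fun q : ℝ × ℝ =>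
      (q.2 + d, √(1 - 2 * q.1 ^ 2 * Real.cos q.2) / q.1)) (a, t) := by
    intro a ha t
    have h3 : ContDiffAt ℝ ∞ (fun q : ℝ × ℝ => √(1 - 2 * q.1 ^ 2 * Real.cos q.2)) (a, t) :=
      ContDiffAt.sqrt (by fun_prop) (rotation_radicand_pos ha.1 t).ne'
    exact (contDiffAt_snd.add contDiffAt_const).prodMk (h3.div contDiffAt_fst (ha0 a ha))
  have hen : ∀ a ∈ rotationParameters \ {0}, ∀ t,
      (√(1 - 2 * a ^ 2 * Real.cos t) / a) ^ 2 / 2 + Real.cos (t + d - d) = (a ^ 2)⁻¹ / 2 := by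
    intro a ha t
    have h3 := ha0 a ha
    rw [div_pow, Real.sq_sqrt (rotation_radicand_pos ha.1 t).le, add_sub_cancel_right]
    field_simp
    ring
  have hu : ∀ a ∈ rotationParameters \ {0}, ∀ t, 0 < a * (a * (√(1 - 2 * a ^ 2 * Real.cos t))⁻¹) := by
    intro a ha t
    have h3 := hp a ha t
    have h4 : 0 < a * a := mul_self_pos.2 (ha0 a ha)
    rw [← mul_assoc]
    positivity
  refine ⟨hopen, hs, fun a ha t => ?_, fun a ha a' ha' t t' => ?_, fun a _ t => ?_, h1, h2,
    ?_, fun a _ t => ?_, fun a _ t => ?_, hu⟩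
  · refine immersion_of_energy (V := fun z => Real.cos (z - d))
      (ζ := fun a t => (t + d, √(1 - 2 * a ^ 2 * Real.cos t) / a)) (ε := fun a => (a ^ 2)⁻¹ / 2)
      (ε' := -(2 * a) / (a ^ 2) ^ 2 / 2) hopen ha (right_ne_zero_of_mul (hu a ha t).ne')
      (hasDerivAt_cos_sub d _).differentiableAt
      ((hs a ha t).differentiableAt (by simp)) ?_ ?_ (fun a ha t => hen a ha t) (h1 a ha t) (h2 a ha t)
    · simpa using (((hasDerivAt_id a).pow 2).inv (pow_ne_zero 2 (ha0 a ha))).div_const 2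
    · have := ha0 a ha
      simp [this]
  · rw [mem_periods_true]
    have h3 := ha0 a ha
    have h3' := ha0 a' ha'
    constructor
    · rintro ⟨⟨k, hk⟩, h4⟩
      have ht : t' = t + k * (2 * Real.pi) := by linarith
      have h5 := hen a ha t
      have h6 := hen a' ha' t'
      have h7 : Real.cos (t' + d - d) = Real.cos (t + d - d) := by
        rw [ht, add_sub_cancel_right, add_sub_cancel_right, Real.cos_add_int_mul_two_pi]
      dsimp only at h4
      rw [h7, h4, h5, div_left_inj' two_ne_zero, _root_.inv_inj] at h6
      refine ⟨?_, k, ht⟩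
      rcases sq_eq_sq_iff_eq_or_eq_neg.1 h6 with h8 | h8
      · exact h8.symm
      · have h9 := hp a ha t
        have h10 := hp a' ha' t'
        rw [h8, neg_sq] at h9
        rw [h8, neg_sq, div_neg] at h4
        field_simp at h4
        linarith
    · rintro ⟨rfl, k, rfl⟩
      exact ⟨⟨k, by ring⟩, by rw [Real.cos_add_int_mul_two_pi]⟩
  · refine ⟨?_, by simp⟩
    rw [he, show -t + d - (2 * d - (t + d)) = 0 by ring]
    exact zero_mem _
  · exact ((IsAnalyticFamily.of_param analyticOnNhd_id).mul isAnalyticFamily_rotation).mono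
      Set.sdiff_subset
  · simp
  · simp

theorem cos_sub_eq_of_mem_periods {z z' d : ℝ} (h : z' - z ∈ periods true) :
    Real.cos (z' - d) = Real.cos (z - d) := by
  obtain ⟨k, hk⟩ := mem_periods_true.1 h
  rw [show z' - d = z - d + k * (2 * Real.pi) by linarith, Real.cos_add_int_mul_two_pi]

/-- The energy separates the two kinds of motion: oscillations lie below the maximum 1 of the
potential and rotations above it. -/
theorem oscillation_energy {d : ℝ} {ζ : ℝ × ℝ} (h : ζ ∈ {z : ℝ × ℝ | ∃ a ∈ Set.Ioo (0 : ℝ) 2, ∃ t,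
    z = (2 * Real.arcsin (a / 2 * Real.sin t) + Real.pi + d, a * Real.cos t)}) :
    ζ.2 ^ 2 / 2 + Real.cos (ζ.1 - d) < 1 := by
  obtain ⟨a, ha, t, rfl⟩ := h
  have h0 := half_mul_sin_sq_lt_one (a := a) ⟨by linarith [ha.1], ha.2⟩ t
  have h1 := abs_lt.1 ((sq_lt_one_iff_abs_lt_one (a / 2 * Real.sin t)).1 (by linarith))
  simp only [add_sub_cancel_right, Real.cos_add_pi, Real.cos_two_mul, Real.cos_sq',
    Real.sin_arcsin h1.1.le h1.2.le]
  have h2 : a ^ 2 < 4 := by nlinarith [ha.1, ha.2]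
  nlinarith [Real.sin_sq_add_cos_sq t]

theorem rotation_energy {d : ℝ} {ζ : ℝ × ℝ}
    (h : ζ ∈ {z : ℝ × ℝ | ∃ a ∈ rotationParameters \ {0}, ∃ t,
      z = (t + d, √(1 - 2 * a ^ 2 * Real.cos t) / a)}) :
    1 < ζ.2 ^ 2 / 2 + Real.cos (ζ.1 - d) := by
  obtain ⟨a, ha, t, rfl⟩ := h
  have h3 : a ≠ 0 := ha.2
  have h4 := mem_rotationParameters.1 ha.1
  simp only [add_sub_cancel_right, div_pow, Real.sq_sqrt (rotation_radicand_pos ha.1 t).le]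
  have h5 : (1 - 2 * a ^ 2 * Real.cos t) / a ^ 2 / 2 + Real.cos t = 1 / (2 * a ^ 2) := by
    field_simp
    ring
  rw [h5, lt_div_iff₀ (by positivity)]
  linarith

/-- All states of the pendulum up to its equilibria and separatrices oscillate or rotate. -/
theorem pendulum_cover (d z : ℝ) : ∃ s : Set ℝ, s.Finite ∧ ∀ w ∉ s,
    ∃ ζ ∈ {z : ℝ × ℝ | ∃ a ∈ Set.Ioo (0 : ℝ) 2, ∃ t,
        z = (2 * Real.arcsin (a / 2 * Real.sin t) + Real.pi + d, a * Real.cos t)} ∪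
      {z : ℝ × ℝ | ∃ a ∈ rotationParameters \ {0}, ∃ t,
        z = (t + d, √(1 - 2 * a ^ 2 * Real.cos t) / a)},
      ζ.1 - z ∈ periods true ∧ ζ.2 = w := by
  -- r is the speed on the separatrix at z. Excluding w = 0 as well removes the equilibria.
  set r := √(2 - 2 * Real.cos (z - d)) with hr
  have hr2 : r ^ 2 = 2 - 2 * Real.cos (z - d) :=
    Real.sq_sqrt (by linarith [Real.cos_le_one (z - d)])
  refine ⟨{0, r, -r}, by simp, fun w hw => ?_⟩
  simp only [Set.mem_insert_iff, Set.mem_singleton_iff, not_or] at hw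
  obtain ⟨hw0, hw1, hw2⟩ := hw
  have hne : w ^ 2 ≠ r ^ 2 := fun h => (sq_eq_sq_iff_eq_or_eq_neg.1 h).elim hw1 hw2
  rcases lt_or_gt_of_ne hne with hlt | hgt
  -- z₀ is the displacement from the minimum taken in [−π, π), so that the arcsine inverts the sine
  -- at z₀/2.
  · obtain ⟨k, hk, -⟩ := existsUnique_add_zsmul_mem_Ico (Real.two_pi_pos) (z - d - Real.pi) (-Real.pi)
    set z₀ := z - d - Real.pi + k • (2 * Real.pi) with hz₀
    rw [zsmul_eq_mul] at hz₀
    have hzcos : Real.cos (z - d) = -Real.cos z₀ := by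
      rw [hz₀, Real.cos_add_int_mul_two_pi, Real.cos_sub_pi, neg_neg]
    have hhalf : Real.cos z₀ = 1 - 2 * Real.sin (z₀ / 2) ^ 2 := by
      have := Real.cos_two_mul (z₀ / 2)
      rw [mul_div_cancel₀ z₀ two_ne_zero, Real.cos_sq'] at this
      linarith
    obtain ⟨a, t, ha, h1, h2⟩ := exists_polar w (2 * Real.sin (z₀ / 2))
    have ha2 : a ^ 2 = w ^ 2 + 4 * Real.sin (z₀ / 2) ^ 2 := by
      rw [← h1]
      linear_combination -a ^ 2 * Real.sin_sq_add_cos_sq t +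
        (a * Real.sin t + 2 * Real.sin (z₀ / 2)) * h2
    have ha0 : a ≠ 0 := fun h => hw0 (by rw [← h1, h, zero_mul])
    refine ⟨_, Or.inl ⟨a, ⟨lt_of_le_of_ne ha ha0.symm, ?_⟩, t, rfl⟩, ?_, h1⟩
    · have : a ^ 2 < 2 ^ 2 := by
        rw [ha2]
        linarith
      exact lt_of_pow_lt_pow_left₀ 2 (by norm_num) this
    · have h3 : a / 2 * Real.sin t = Real.sin (z₀ / 2) := by linarith
      have h4 : Real.arcsin (Real.sin (z₀ / 2)) = z₀ / 2 :=
        Real.arcsin_sin (by linarith [hk.1]) (by linarith [hk.2])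
      refine mem_periods_true.2 ⟨k, ?_⟩
      simp only [h3, h4]
      linarith
  · set h := w ^ 2 / 2 + Real.cos (z - d) with hh
    have h1 : 1 < h := by linarith
    set σ := √(2 * h) with hσ
    have hσ2 : σ ^ 2 = 2 * h := Real.sq_sqrt (by linarith)
    have hσ0 : 0 < σ := Real.sqrt_pos.2 (by linarith)
    have hw : 0 < |w| := abs_pos.2 hw0
    have ha2 : (w / (|w| * σ)) ^ 2 = 1 / (2 * h) := by
      rw [div_pow, mul_pow, sq_abs, hσ2]
      field_simp
    -- The energy h = 1/(2a²) and the direction of w determine a.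
    refine ⟨_, Or.inr ⟨w / (|w| * σ), ⟨mem_rotationParameters.2 ?_, ?_⟩, z - d, rfl⟩, ?_, ?_⟩
    · rw [ha2]
      field_simp
      linarith
    · have : w / (|w| * σ) ≠ 0 := by positivity
      exact this
    · simp [zero_mem]
    · have h3 : 1 - 2 * (w / (|w| * σ)) ^ 2 * Real.cos (z - d) = (|w| / σ) ^ 2 := by
        rw [ha2, div_pow, sq_abs, hσ2]
        field_simp
        linarith
      simp only [h3]
      rw [Real.sqrt_sq (by positivity)]
      field_simp
      exact sq_abs w

/-! ### The rotation of the transmissions is not constant -/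

namespace IsRollingCocycle

variable {𝒜 : Set ℝ} {p₁ p₂ : ℝ → ℝ → ℝ} {X : ℝ → ℝ → Matrix (Fin 3) (Fin 3) ℝ}

/-- The case in which the parameter `0` corresponds to small oscillations, in resonance with the
rotation of the fiber. -/
theorem monodromy_of_resonance (hX : IsRollingCocycle 𝒜 p₁ p₂ X) (h𝒜 : IsOpen 𝒜)
    (h0 : (0 : ℝ) ∈ 𝒜) {q : ℝ → ℝ → ℝ} (hq : IsAnalyticFamily 𝒜 q)
    (hp₁ : ∀ a ∈ 𝒜, ∀ t, p₁ a t = a * q a t) (hp₂ : ∀ t, p₂ 0 t = 1) {η : ℝ} (hη : η ≠ 0)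
    (hq0 : ∀ t, q 0 t = η * Real.sin t) :
    (∃ a ∈ 𝒜, X a (2 * Real.pi) 1 1 = 1) ∧ ∃ a ∈ 𝒜, X a (2 * Real.pi) 1 1 ≠ 1 := by
  -- At a = 0 the fiber makes one uniform turn around the first axis in the time 2π, so its
  -- monodromy is the identity.
  have hX0 : ∀ t, X 0 t = !![1, 0, 0; 0, Real.cos t, Real.sin t; 0, -Real.sin t, Real.cos t] := by
    intro t
    have h1 := hX.eq_mul h0
      (Y := fun t => !![1, 0, 0; 0, Real.cos t, Real.sin t; 0, -Real.sin t, Real.cos t])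
      (fun t i j => by
        rw [hp₁ 0 h0, hp₂, zero_mul]
        fin_cases i <;> fin_cases j <;>
          simp [rollingMatrix]
        · exact hasDerivAt_const t (1 : ℝ)
        · exact hasDerivAt_const t (0 : ℝ)
        · exact hasDerivAt_const t (0 : ℝ)
        · exact hasDerivAt_const t (0 : ℝ)
        · exact Real.hasDerivAt_cos t
        · exact Real.hasDerivAt_sin t
        · exact hasDerivAt_const t (0 : ℝ)
        · exact (Real.hasDerivAt_sin t).neg
        · exact Real.hasDerivAt_cos t) t
    have h2 : (!![1, 0, 0; 0, Real.cos 0, Real.sin 0; 0, -Real.sin 0, Real.cos 0] :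
        Matrix (Fin 3) (Fin 3) ℝ) = 1 := by
      ext i j; fin_cases i <;> fin_cases j <;> simp
    rw [h2, Matrix.mul_one] at h1
    exact h1.symm
  refine ⟨⟨0, h0, by simp [hX0]⟩, hX.exists_monodromy_ne_one h𝒜 h0 (hq.mul (hX.family 2 1))
    (i := 0) (by decide) (fun a ha t => ?_) ?_⟩
  · simp [rollingMatrix, Matrix.mul_apply, Fin.sum_univ_three, hp₁ a ha]
    ring
  -- The forcing η sin t is in resonance with this turn, which leaves the integral −η ∫ sin² = −ηπ.
  · have h1 : ∀ t, q 0 t * X 0 t 2 1 = -η * Real.sin t ^ 2 := fun t => by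
      simp [hq0, hX0]
      ring
    simp only [h1]
    rw [intervalIntegral.integral_const_mul, integral_sin_sq]
    simp [hη, Real.pi_ne_zero]

/-- The case in which the parameter `0` corresponds to an infinite velocity. -/
theorem monodromy_of_fast_rotation (hX : IsRollingCocycle 𝒜 p₁ p₂ X) (h𝒜 : IsOpen 𝒜)
    (h0 : (0 : ℝ) ∈ 𝒜) {q₁ q₂ : ℝ → ℝ → ℝ} (hq₁ : IsAnalyticFamily 𝒜 q₁)
    (hq₂ : IsAnalyticFamily 𝒜 q₂) (hp₁ : ∀ a ∈ 𝒜, ∀ t, p₁ a t = a * q₁ a t)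
    (hp₂ : ∀ a ∈ 𝒜, ∀ t, p₂ a t = a * q₂ a t) (hpos : ∀ t, 0 < q₂ 0 t) :
    (∃ a ∈ 𝒜, X a (2 * Real.pi) 1 1 = 1) ∧ ∃ a ∈ 𝒜, X a (2 * Real.pi) 1 1 ≠ 1 := by
  have hX0 : ∀ t, X 0 t = 1 := by
    intro t
    have h1 := hX.eq_mul h0 (Y := fun _ => 1) (fun t i j => by
      have h2 : rollingMatrix (p₁ 0 t) (p₂ 0 t) * 1 = 0 := by
        rw [hp₁ 0 h0, hp₂ 0 h0, zero_mul, zero_mul, Matrix.mul_one]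
        ext i j; fin_cases i <;> fin_cases j <;> simp [rollingMatrix]
      rw [h2]
      exact hasDerivAt_const t _) t
    rw [Matrix.mul_one] at h1
    exact h1.symm
  refine ⟨⟨0, h0, by simp [hX0]⟩, hX.exists_monodromy_ne_one h𝒜 h0
    ((hq₁.mul (hX.family 0 1)).add (hq₂.mul (hX.family 1 1))).neg
    (i := 2) (by decide) (fun a ha t => ?_) ?_⟩
  · simp [rollingMatrix, Matrix.mul_apply, Fin.sum_univ_three, hp₁ a ha, hp₂ a ha]
    ring
  -- At a = 0 the solution is constantly 1, so to first order only −q₂ remains.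
  · simp only [hX0, Matrix.one_apply_ne (show (0 : Fin 3) ≠ 1 by decide), Matrix.one_apply_eq,
      mul_zero, mul_one, zero_add, intervalIntegral.integral_neg]
    have h1 : 0 < ∫ t in (0 : ℝ)..(2 * Real.pi), q₂ 0 t :=
      intervalIntegral.intervalIntegral_pos_of_pos
        ((hq₂.continuous h𝒜 h0).intervalIntegrable _ _) hpos (by positivity)
    linarith

end IsRollingCocycle

/-! ### The examples -/

theorem identity_matrix_mulVec (x : Fin 2 → ℝ) :
    (!![1, 0; 0, 1] : Matrix (Fin 2) (Fin 2) ℝ) *ᵥ x = x := by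
  ext i; fin_cases i <;> simp [Matrix.mulVec, dotProduct, Fin.sum_univ_two]

theorem transmission_involution : (![1, -1] : Fin 2 → ℝ) * ![1, -1] = 1 := by
  ext i; fin_cases i <;> simp

theorem harmonicCVT_isFibratedOverRIntegrable :
    IsFibratedOverRIntegrable harmonicCVT.proj harmonicCVT.field 3 2 := by
  refine harmonicCVT.isFibratedOverRIntegrable transmission_involution 0 ?_
  -- The orbits need a > 0, but the coefficients are analytic for all real a, with a factor a in the
  -- first one.
  have hb := (IsAnalyticFamily.mul_sin Set.univ).inv_sqrt_one_add_sq
  have hq := (IsAnalyticFamily.sin Set.univ).neg.mul hb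
  obtain ⟨X, hX⟩ := exists_isRollingCocycle isOpen_univ
    ((IsAnalyticFamily.of_param analyticOnNhd_id).mul hq) hb
  obtain ⟨h1, h2⟩ := hX.monodromy_of_resonance isOpen_univ (Set.mem_univ _) hq
    (fun a _ t => rfl) (by simp) (neg_ne_zero.2 one_ne_zero) (by simp)
  refine CoupledSystem.IsRIntegrableOver.isRIntegrable (hX.isRIntegrableOver isOpen_univ
    isPreconnected_univ (Set.subset_univ _) (S := harmonicCVT) identity_matrix_mulVec rfl
    oscillatorChart_harmonic ?_ ?_ ?_ ?_ ?_ ?_ h1 h2) fun z => ⟨{0}, Set.finite_singleton 0, ?_⟩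
  · intro a _ t
    simp [harmonicCVT]
    ring
  · intro a _ t
    simp [harmonicCVT]
  · intro a _ t
    simp
  · intro a _ t
    simp
  · intro a _ t
    simp
  · intro a _ t
    simp
  · intro w hw
    obtain ⟨a, t, ha, h3, h4⟩ := exists_polar w z
    have ha0 : a ≠ 0 := fun h => hw (by rw [Set.mem_singleton_iff, ← h3, h, zero_mul])
    exact ⟨_, ⟨a, lt_of_le_of_ne ha ha0.symm, t, rfl⟩, sub_eq_zero.2 h4, h3⟩

theorem pendulumCVT_potential : (pendulumCVT 0).V = fun z => Real.cos (z - 0) := by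
  funext z
  simp [pendulumCVT]

/-- Along the orbits sin z has the factor a, so the coefficients continue to −2 < a < 2. At a = 0
the linearized pendulum and the fiber both turn at rate 1, the resonant case. -/
theorem pendulumCVT_oscillation : (pendulumCVT 0).IsRIntegrableOver
    ((pendulumCVT 0).reflection ![1, -1] 0) 3 2 {z : ℝ × ℝ | ∃ a ∈ Set.Ioo (0 : ℝ) 2, ∃ t,
      z = (2 * Real.arcsin (a / 2 * Real.sin t) + Real.pi + 0, a * Real.cos t)} := by
  have hr : IsAnalyticFamily (Set.Ioo (-2 : ℝ) 2) fun a t => √(1 - (a / 2 * Real.sin t) ^ 2) := by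
    have h3 : IsAnalyticFamily (Set.Ioo (-2 : ℝ) 2)
        fun a t => -1 * (1 / 2 * (a * Real.sin t)) ^ 2 :=
      (IsAnalyticFamily.of_param analyticOnNhd_const).mul
        ((IsAnalyticFamily.of_param analyticOnNhd_const).mul (IsAnalyticFamily.mul_sin _)).sq
    have h4 := ((IsAnalyticFamily.of_param (analyticOnNhd_const (v := (1 : ℝ)))).add h3).congr
      (v := fun a t => 1 - (a / 2 * Real.sin t) ^ 2) fun a _ t => by ring
    exact h4.sqrt fun a ha t => half_mul_sin_sq_lt_one ha t
  have hr0 : ∀ a ∈ Set.Ioo (-2 : ℝ) 2, ∀ t, √(1 - (a / 2 * Real.sin t) ^ 2) ≠ 0 := fun a ha t =>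
    (Real.sqrt_pos.2 (half_mul_sin_sq_lt_one ha t)).ne'
  have hb := ((IsAnalyticFamily.mul_sin _).mul hr).inv_sqrt_one_add_sq
  have hq := (IsAnalyticFamily.sin _).mul hb
  have h0 : (0 : ℝ) ∈ Set.Ioo (-2 : ℝ) 2 := by norm_num
  obtain ⟨X, hX⟩ := exists_isRollingCocycle isOpen_Ioo
    ((IsAnalyticFamily.of_param analyticOnNhd_id).mul hq) ((hr.inv hr0).mul hb)
  obtain ⟨h1, h2⟩ := hX.monodromy_of_resonance isOpen_Ioo h0 hq
    (fun a _ t => rfl) (by simp) one_ne_zero (by simp)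
  have hO : Set.Ioo (0 : ℝ) 2 ⊆ Set.Ioo (-2 : ℝ) 2 := Set.Ioo_subset_Ioo_left (by norm_num)
  have hz : ∀ a ∈ Set.Ioo (0 : ℝ) 2, ∀ t,
      Real.sin (2 * Real.arcsin (a / 2 * Real.sin t) + Real.pi + 0) =
        -(a * Real.sin t * √(1 - (a / 2 * Real.sin t) ^ 2)) := by
    intro a ha t
    have h3 := half_mul_sin_sq_lt_one (hO ha) t
    have h4 := abs_lt.1 ((sq_lt_one_iff_abs_lt_one (a / 2 * Real.sin t)).1 (by linarith))
    rw [add_zero, Real.sin_add_pi, Real.sin_two_mul, Real.cos_arcsin,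
      Real.sin_arcsin h4.1.le h4.2.le]
    ring
  have hchart := oscillatorChart_oscillation (d := 0) (e := 0) (by simp)
  rw [← pendulumCVT_potential] at hchart
  refine hX.isRIntegrableOver isOpen_Ioo isPreconnected_Ioo hO (S := pendulumCVT 0)
    identity_matrix_mulVec rfl hchart ?_ ?_ ?_ ?_ ?_ ?_ h1 h2
  · intro a ha t
    have h3 := hr0 a (hO ha) t
    simp only [pendulumCVT, hz a ha, Pi.smul_apply, smul_eq_mul, Matrix.cons_val_zero, neg_neg,
      neg_sq]
    generalize √(1 - (a / 2 * Real.sin t) ^ 2) = ρ at *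
    field_simp
  · intro a ha t
    simp only [pendulumCVT, hz a ha]
    simp
  · intro a _ t
    simp
  · intro a _ t
    simp
  · intro a _ t
    simp
  · intro a _ t
    simp

/-- Both coefficients of the fiber equation have the factor a, so they extend to a = 0 although the
orbits do not. -/
theorem pendulumCVT_rotation : (pendulumCVT 0).IsRIntegrableOver
    ((pendulumCVT 0).reflection ![1, -1] 0) 3 2 {z : ℝ × ℝ | ∃ a ∈ rotationParameters \ {0}, ∃ t,
      z = (t + 0, √(1 - 2 * a ^ 2 * Real.cos t) / a)} := by
  have hr := isAnalyticFamily_rotation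
  have hb := (IsAnalyticFamily.sin rotationParameters).inv_sqrt_one_add_sq
  have hq₁ := (hr.mul hb).mul (IsAnalyticFamily.sin rotationParameters).neg
  have hq₂ := hr.mul hb
  have h0 : (0 : ℝ) ∈ rotationParameters := mem_rotationParameters.2 (by norm_num)
  have ha := IsAnalyticFamily.of_param (𝒜 := rotationParameters) analyticOnNhd_id
  obtain ⟨X, hX⟩ := exists_isRollingCocycle isOpen_Ioo (ha.mul hq₁) (ha.mul hq₂)
  obtain ⟨h1, h2⟩ := hX.monodromy_of_fast_rotation isOpen_Ioo h0 hq₁ hq₂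
    (fun a _ t => rfl) (fun a _ t => rfl) (fun t => by simp; positivity)
  have hchart := oscillatorChart_rotation (d := 0) (e := 0) (by simp)
  rw [← pendulumCVT_potential] at hchart
  refine hX.isRIntegrableOver isOpen_Ioo isPreconnected_Ioo Set.sdiff_subset (S := pendulumCVT 0)
    identity_matrix_mulVec rfl hchart ?_ ?_ ?_ ?_ ?_ ?_ h1 h2
  · intro a ha t
    simp [pendulumCVT]
    ring
  · intro a ha t
    simp [pendulumCVT]
    ring
  · intro a _ t
    simp
  · intro a _ t
    simp
  · intro a _ t
    simp
  · intro a _ t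
    simp

theorem pendulum_disjoint (d : ℝ) :
    ∀ ζ ∈ {z : ℝ × ℝ | ∃ a ∈ Set.Ioo (0 : ℝ) 2, ∃ t,
        z = (2 * Real.arcsin (a / 2 * Real.sin t) + Real.pi + d, a * Real.cos t)},
      ∀ ζ' ∈ {z : ℝ × ℝ | ∃ a ∈ rotationParameters \ {0}, ∃ t,
        z = (t + d, √(1 - 2 * a ^ 2 * Real.cos t) / a)},
      ¬(ζ'.1 - ζ.1 ∈ periods true ∧ ζ'.2 = ζ.2) := by
  rintro ζ hζ ζ' hζ' ⟨h1, h2⟩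
  have h3 := oscillation_energy hζ
  have h4 := rotation_energy hζ'
  rw [cos_sub_eq_of_mem_periods h1, h2] at h4
  exact lt_asymm h3 h4

theorem pendulumCVT_isFibratedOverRIntegrable :
    IsFibratedOverRIntegrable (pendulumCVT 0).proj (pendulumCVT 0).field 3 2 :=
  (pendulumCVT 0).isFibratedOverRIntegrable transmission_involution 0
    ((pendulumCVT_oscillation.union pendulumCVT_rotation (pendulum_disjoint 0)).isRIntegrable
      (pendulum_cover 0))

/-- With z = t + π/2 the force cos z is −sin t, which is odd, and its primitive in time, cos t / a,
is even and periodic. This fixes the reflection z ↦ π − z. -/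
theorem knifeEdge_isFibratedOverRIntegrable :
    IsFibratedOverRIntegrable knifeEdge.proj knifeEdge.field 2 1 := by
  refine knifeEdge.isFibratedOverRIntegrable (σ := 1) (mul_one 1) Real.pi ?_
  have hchart := oscillatorChart_free (d := Real.pi / 2) (e := Real.pi) (by ring)
  refine CoupledSystem.IsRIntegrableOver.isRIntegrable
    (hchart.isRIntegrableOver (S := knifeEdge) (g := fun a t => a⁻¹ * Real.cos t)
      (fun a ha t => ?_) (fun a _ t => ?_) (fun a _ t => ?_) (fun a _ t => ?_) 1)
    fun z => ⟨{0}, Set.finite_singleton 0, fun w hw => ?_⟩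
  · exact (contDiffAt_fst.inv (by simpa using ha)).mul contDiffAt_snd.cos
  · simp
  · simp
  · refine ((Real.hasDerivAt_cos t).const_mul a⁻¹).congr_deriv ?_
    simp [knifeEdge, dotProduct, Fin.sum_univ_two, Real.cos_add_pi_div_two]
  · refine ⟨_, ⟨w, hw, z - Real.pi / 2, rfl⟩, ?_, rfl⟩
    simp [zero_mem]

theorem rollingDisk_isFibratedOverRIntegrable :
    IsFibratedOverRIntegrable rollingDisk.proj rollingDisk.field 2 1 := by
  refine rollingDisk.isFibratedOverRIntegrable (σ := 1) (mul_one 1) 0 ?_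
  have hchart := oscillatorChart_free (d := 0) (e := 0) (by ring)
  refine CoupledSystem.IsRIntegrableOver.isRIntegrable
    (hchart.isRIntegrableOver (S := rollingDisk) (g := fun _ _ => 0)
      (fun a ha t => contDiffAt_const) (fun a _ t => rfl) (fun a _ t => rfl) (fun a _ t => ?_) 1)
    fun z => ⟨{0}, Set.finite_singleton 0, fun w hw => ?_⟩
  · simpa [rollingDisk, diskWithPotential] using hasDerivAt_const t (0 : ℝ)
  · refine ⟨_, ⟨w, hw, z, rfl⟩, ?_, rfl⟩
    simp [zero_mem]

/-- As sin z = cos (z − π/2), this is a pendulum displaced by π/2, next to a conserved velocity v.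
-/
theorem mobileRobot_isFibratedOverRIntegrable :
    IsFibratedOverRIntegrable mobileRobot.proj mobileRobot.field 2 1 := by
  refine mobileRobot.isFibratedOverRIntegrable (σ := 1) (mul_one 1) Real.pi ?_
  have hV : mobileRobot.V = fun z => Real.cos (z - Real.pi / 2) := by
    funext z
    simp [mobileRobot, diskWithPotential, Real.cos_sub_pi_div_two]
  have h1 := oscillatorChart_oscillation (d := Real.pi / 2) (e := Real.pi) (by ring)
  have h2 := oscillatorChart_rotation (d := Real.pi / 2) (e := Real.pi) (by ring)
  rw [← hV] at h1 h2
  have hd : ∀ a t : ℝ, ∀ κ, HasDerivAt (fun _ : ℝ => (0 : ℝ)) (a * (κ ⬝ᵥ mobileRobot.f)) t :=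
    fun a t κ => by simpa [mobileRobot, diskWithPotential] using hasDerivAt_const t (0 : ℝ)
  exact ((h1.isRIntegrableOver (S := mobileRobot) (g := fun _ _ => 0)
      (fun a ha t => contDiffAt_const) (fun a _ t => rfl) (fun a _ t => rfl)
      (fun a _ t => hd _ _ _) 1).union
    (h2.isRIntegrableOver (S := mobileRobot) (g := fun _ _ => 0)
      (fun a ha t => contDiffAt_const) (fun a _ t => rfl) (fun a _ t => rfl)
      (fun a _ t => hd _ _ _) 1) (pendulum_disjoint (Real.pi / 2))).isRIntegrable
    (pendulum_cover (Real.pi / 2))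

/-! ### The nonholonomic particle -/

/-- The rate of rotation of the variables `(y, v)` of the nonholonomic particle. -/
noncomputable def particleRate (a t : ℝ) : ℝ := (√(1 + (a * Real.sin t) ^ 2))⁻¹

/-- The rotation of the variables `(y, v)` of the nonholonomic particle. -/
noncomputable def particleAngle (a t : ℝ) : ℝ := ∫ r in (0 : ℝ)..t, particleRate a r

theorem isAnalyticFamily_particleRate : IsAnalyticFamily Set.univ particleRate :=
  (IsAnalyticFamily.mul_sin Set.univ).inv_sqrt_one_add_sq

theorem continuous_particleRate (a : ℝ) : Continuous (particleRate a) :=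
  isAnalyticFamily_particleRate.continuous isOpen_univ (Set.mem_univ a)

theorem particleAngle_hasDerivAt (a t : ℝ) :
    HasDerivAt (particleAngle a) (particleRate a t) t :=
  isAnalyticFamily_particleRate.hasDerivAt_integral isOpen_univ (Set.mem_univ a) t

theorem particleAngle_neg (a t : ℝ) : particleAngle a (-t) = -particleAngle a t := by
  have h1 := intervalIntegral.integral_comp_neg (a := 0) (b := t) (particleRate a)
  have h2 : ∀ t, particleRate a (-t) = particleRate a t := fun t => by simp [particleRate]
  simp only [h2, neg_zero] at h1
  rw [particleAngle, particleAngle, h1, intervalIntegral.integral_symm]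

theorem particleAngle_add (a t : ℝ) :
    particleAngle a (t + 2 * Real.pi) = particleAngle a t + particleAngle a (2 * Real.pi) := by
  have hp : Function.Periodic (particleRate a) (2 * Real.pi) := fun t => by simp [particleRate]
  have h1 := hp.intervalIntegral_add_eq t 0
  rw [zero_add] at h1
  rw [particleAngle, particleAngle, particleAngle, ← h1,
    intervalIntegral.integral_add_adjacent_intervals] <;>
  exact (continuous_particleRate a).intervalIntegrable _ _

/-- The rate is identically 1 for a = 0, and for a = 1 it is at most 1 and smaller at t = π/2. -/
theorem particleAngle_ne : particleAngle 0 (2 * Real.pi) ≠ particleAngle 1 (2 * Real.pi) := by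
  refine (intervalIntegral.integral_lt_integral_of_continuousOn_of_le_of_exists_lt
    (by positivity) (continuous_particleRate 1).continuousOn (continuous_particleRate 0).continuousOn
    (fun t _ => ?_) ⟨Real.pi / 2, ⟨by positivity, by linarith [Real.pi_pos]⟩, ?_⟩).ne'
  · simp only [particleRate]
    exact inv_anti₀ (by positivity) (Real.sqrt_le_sqrt (by nlinarith [sq_nonneg (Real.sin t)]))
  · simp only [particleRate]
    exact inv_strictAnti₀ (by positivity) (Real.sqrt_lt_sqrt (by positivity) (by simp))

/-- The equations y' = κ₂ v, v' = −κ₂ y rotate the plane at the rate κ₂ = (1 + z²)^(-1/2), the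
second component of κ. Their solution is explicit and no parameter is exceptional. -/
theorem particle_fiberChart : FiberChart nonholonomicParticle ![-1] (Set.Ioi 0)
    (fun a t => (a * Real.sin t, a * Real.cos t)) (fun _ _ => 1)
    (fun a => particleAngle a (2 * Real.pi)) {c | 0 < c 0} fun a t c ψ =>
      (![c 0 * Real.sin (ψ + particleAngle a t)], c 0 * Real.cos (ψ + particleAngle a t)) := by
  have hangle : ∀ a t : ℝ, ContDiffAt ℝ ∞ (fun q : ℝ × ℝ => particleAngle q.1 q.2) (a, t) :=
    fun a t => (isAnalyticFamily_particleRate.integral.analyticAt isOpen_univ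
      (Set.mem_univ a) t).contDiffAt
  refine ⟨isOpen_Ioi, isOpen_Ioi.preimage (continuous_apply 0), isConnected_setOf_apply_pos 0,
    fun a _ => ?_, fun a _ t c _ ψ => ?_, fun a _ t c hc ψ δc δψ hd => ?_,
    fun a _ t c hc c' hc' ψ ψ' => ?_, fun a _ t c ψ => ?_, fun a _ t c ψ => ?_,
    fun a _ t c ψ => ?_, fun a _ t ψ => ?_, fun a _ t ξ => ?_⟩
  · exact ContDiffAt.comp (g := fun q : ℝ × ℝ => particleAngle q.1 q.2)
      (f := fun a : ℝ => (a, 2 * Real.pi)) a (hangle a _) (by fun_prop)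
  · have h1 : ContDiffAt ℝ ∞ (fun x : (ℝ × ℝ) × (Fin 1 → ℝ) × ℝ => particleAngle x.1.1 x.1.2)
        ((a, t), c, ψ) := ContDiffAt.comp (g := fun q : ℝ × ℝ => particleAngle q.1 q.2)
      (f := fun x : (ℝ × ℝ) × (Fin 1 → ℝ) × ℝ => x.1) _ (hangle a t) contDiffAt_fst
    have h2 : ContDiffAt ℝ ∞ (fun x : (ℝ × ℝ) × (Fin 1 → ℝ) × ℝ => x.2.1 0) ((a, t), c, ψ) :=
      contDiffAt_pi.1 contDiffAt_snd.fst 0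
    refine ContDiffAt.prodMk (contDiffAt_pi.2 fun i => ?_)
      (h2.mul (contDiffAt_snd.snd.add h1).cos)
    fin_cases i
    exact h2.mul (contDiffAt_snd.snd.add h1).sin
  · have h1 : HasDerivAt (fun s : ℝ => (c 0 + s • δc 0) *
        Real.sin (ψ + particleAngle a t + s • δψ)) 0 0 := by
      refine (hasDerivAt_pi.1 (hasFDerivAt_fst.comp_hasDerivAt 0 hd) 0).congr_of_eventuallyEq
        (Filter.Eventually.of_forall fun s => ?_)
      simp only [add_right_comm ψ]
      rfl
    have h2 : HasDerivAt (fun s : ℝ => (c 0 + s • δc 0) *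
        Real.cos (ψ + particleAngle a t + s • δψ)) 0 0 := by
      refine (hasFDerivAt_snd.comp_hasDerivAt 0 hd).congr_of_eventuallyEq
        (Filter.Eventually.of_forall fun s => ?_)
      simp only [add_right_comm ψ]
      rfl
    obtain ⟨h3, h4⟩ := polar_immersion (ne_of_gt hc) h2 h1
    refine ⟨?_, h4⟩
    ext i; fin_cases i
    exact h3
  · have h1 := polar_eq_iff (ψ := ψ + particleAngle a t) (ψ' := ψ' + particleAngle a t) hc hc'
    have h2 : c' 0 = c 0 ↔ c' = c := by simp [funext_iff]
    rw [h2] at h1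
    have h3 : (∃ k : ℤ, ψ' + particleAngle a t = ψ + particleAngle a t + k * (2 * Real.pi)) ↔
        ∃ k : ℤ, ψ' = ψ + k * (2 * Real.pi) :=
      exists_congr fun k => by constructor <;> intro h <;> linarith
    rw [h3] at h1
    rw [← h1, Prod.mk.injEq, and_comm]
    simp
  · rw [particleAngle_add, add_assoc, add_comm (particleAngle a t)]
  · have h1 : -ψ + -particleAngle a t = -(ψ + particleAngle a t) := by ring
    rw [particleAngle_neg, h1, Real.sin_neg, Real.cos_neg]
    refine Prod.ext (funext fun i => ?_) ?_
    · fin_cases i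
      simp
    · simp
  · have h1 : HasDerivAt (fun t => ψ + particleAngle a t) (particleRate a t) t :=
      (particleAngle_hasDerivAt a t).const_add ψ
    refine ((hasDerivAt_pi.2 fun i => ?_ : HasDerivAt
      (fun t => ![c 0 * Real.sin (ψ + particleAngle a t)])
      ![c 0 * (Real.cos (ψ + particleAngle a t) * particleRate a t)] t).prodMk
        (h1.cos.const_mul (c 0))).congr_deriv ?_
    · fin_cases i
      exact h1.sin.const_mul (c 0)
    · refine Prod.ext ?_ ?_
      · ext i; fin_cases i
        simp [nonholonomicParticle, particleRate, Matrix.mulVec, dotProduct, Fin.sum_univ_two]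
        ring
      · simp [nonholonomicParticle, particleRate, Matrix.mulVec, dotProduct, Fin.sum_univ_two]
        ring
  · refine Continuous.prodMk (continuous_pi fun i => ?_) (by fun_prop)
    fin_cases i
    simp
    fun_prop
  · obtain ⟨y, v⟩ := ξ
    obtain ⟨r, ψ, hr, h1, h2⟩ := exists_polar v (y 0)
    refine ⟨![r], closure_setOf_apply_pos 0 hr, ψ - particleAngle a t, ?_⟩
    refine Prod.ext ?_ (by simpa using h1)
    ext i; fin_cases i
    simpa using h2

theorem nonholonomicParticle_isFibratedOverRIntegrable :
    IsFibratedOverRIntegrable nonholonomicParticle.proj nonholonomicParticle.field 2 2 := by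
  refine nonholonomicParticle.isFibratedOverRIntegrable (σ := ![-1])
    (by ext i; fin_cases i; simp) 0 ?_
  refine CoupledSystem.IsRIntegrableOver.isRIntegrable
    (OscillatorChart.isRIntegrableOver_of_fiberChart (S := nonholonomicParticle)
      oscillatorChart_harmonic le_rfl subset_closure particle_fiberChart
      fun J hJ hJo hJc => ?_) fun z => ⟨{0}, Set.finite_singleton 0, fun w hw => ?_⟩
  · exact (isAnalyticFamily_particleRate.integral.analyticOnNhd isOpen_univ
      (2 * Real.pi)).exists_ne_of_isOpen isPreconnected_univ
      ⟨0, Set.mem_univ _, 1, Set.mem_univ _, particleAngle_ne⟩ hJo (Set.subset_univ _) hJc.nonempty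
  · obtain ⟨a, t, ha, h3, h4⟩ := exists_polar w z
    have ha0 : a ≠ 0 := fun h => hw (by rw [Set.mem_singleton_iff, ← h3, h, zero_mul])
    exact ⟨_, ⟨a, lt_of_le_of_ne ha ha0.symm, t, rfl⟩, sub_eq_zero.2 h4, h3⟩

theorem mainTheorem1 :
    IsFibratedOverRIntegrable harmonicCVT.proj harmonicCVT.field 3 2 ∧
    IsFibratedOverRIntegrable (pendulumCVT 0).proj (pendulumCVT 0).field 3 2 ∧
    IsFibratedOverRIntegrable nonholonomicParticle.proj nonholonomicParticle.field 2 2 ∧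
    IsFibratedOverRIntegrable knifeEdge.proj knifeEdge.field 2 1 ∧
    IsFibratedOverRIntegrable rollingDisk.proj rollingDisk.field 2 1 ∧
    IsFibratedOverRIntegrable mobileRobot.proj mobileRobot.field 2 1 :=
  ⟨harmonicCVT_isFibratedOverRIntegrable, pendulumCVT_isFibratedOverRIntegrable,
    nonholonomicParticle_isFibratedOverRIntegrable, knifeEdge_isFibratedOverRIntegrable,
    rollingDisk_isFibratedOverRIntegrable, mobileRobot_isFibratedOverRIntegrable⟩
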